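/- Let $G=(V,E)$ be a finite simple undirected graph with $n=|V|$ vertices and $m=|E|$ edges. A set $S\subseteq V$ is a 2-club if any two vertices of $S$ have distance at most two in the induced subgraph $G[S]$. For an integer $t\ge 0$, a set $S\subseteq V$ is - a $t$-robust 2-club if any two distinct vertices of $S$ are joined in $G[S]$ by $t$ distinct, pairwise internally vertex-disjoint paths of length at most two; - a $t$-hereditary 2-club if $S\setminus U$ is a 2-club for every $U\subset S$ with $|U|\le t$; - a $t$-connected 2-club if $S$ is a 2-club, $|S|>t$, and $G[S\setminus U]$ is connected for every $U\subseteq S$ with $|U|<t$. (Sets with at most one vertex satisfy the first two conditions vacuously.) In the problems $t$-Robust, $t$-Hereditary and $t$-Connected 2-Club, the input consists of $G$ and integers $t,k\ge 0$, and the question is whether $G$ contains a $t$-robust, $t$-hereditary or $t$-connected 2-club, respectively, with at least $k$ vertices. Put $\ell:=\max(n-k,0)$. Theorem. On a word RAM with unit-cost instructions and words of $O(\log(n+m+t+k+2))$ bits, with $G$ given by its number of vertices, its number of edges and a list of its edges, $t$-Hereditary 2-Club and $t$-Robust 2-Club can be solved in $O(2^{\ell}\cdot nm+1)$ time, and $t$-Connected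 2-Club can be solved in $O(2^{\ell}\cdot \max(t,1)^2\,nm+1)$ time. In each case a single algorithm handles all inputs and the hidden constant is absolute. -/

import Mathlib

namespace WellConnectedClub

/-! ### The three models of well-connected 2-clubs -/

section Clubs

variable {V : Type*}

/-- `S` is a 2-club of `G`: the induced subgraph `G[S]` has diameter at most two, i.e. any two
vertices of `S` are at distance at most two in `G[S]` (`edist` is `⊤` for disconnected vertices). -/
def IsTwoClub (G : SimpleGraph V) (S : Set V) : Prop :=
  ∀ u v : S, (G.induce S).edist u v ≤ 2

/-- `S` is a `t`-robust 2-club: any two distinct vertices of `S` are joined in `G[S]` by `t`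
(distinct) pairwise internally vertex-disjoint paths of length at most two. -/
def IsRobustTwoClub (G : SimpleGraph V) (t : ℕ) (S : Finset V) : Prop :=
  ∀ u v : (S : Set V), u ≠ v →
    ∃ P : Fin t → (G.induce (S : Set V)).Path u v,
      Function.Injective P ∧
      (∀ i, (P i : (G.induce (S : Set V)).Walk u v).length ≤ 2) ∧
      ∀ i j, i ≠ j → ∀ w,
        w ∈ (P i : (G.induce (S : Set V)).Walk u v).support →
        w ∈ (P j : (G.induce (S : Set V)).Walk u v).support → w = u ∨ w = v

/-- `S` is a `t`-hereditary 2-club: it stays a 2-club after deleting any at most `t` of its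
vertices. -/
def IsHereditaryTwoClub (G : SimpleGraph V) (t : ℕ) (S : Finset V) : Prop :=
  ∀ U : Finset V, U ⊂ S → U.card ≤ t → IsTwoClub G ((S : Set V) \ (U : Set V))

/-- `S` is a `t`-connected 2-club: it is a 2-club, it has more than `t` vertices, and `G[S]` stays
connected after deleting any fewer than `t` vertices. -/
def IsConnectedTwoClub (G : SimpleGraph V) (t : ℕ) (S : Finset V) : Prop :=
  IsTwoClub G (S : Set V) ∧ t < S.card ∧
    ∀ U : Finset V, U ⊆ S → U.card < t → (G.induce ((S : Set V) \ (U : Set V))).Connected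

/-- The decision problems: does `G` contain a set of size at least `k` of the given kind? -/
def RobustTwoClubProblem (G : SimpleGraph V) (t k : ℕ) : Prop :=
  ∃ S : Finset V, k ≤ S.card ∧ IsRobustTwoClub G t S

def HereditaryTwoClubProblem (G : SimpleGraph V) (t k : ℕ) : Prop :=
  ∃ S : Finset V, k ≤ S.card ∧ IsHereditaryTwoClub G t S

def ConnectedTwoClubProblem (G : SimpleGraph V) (t k : ℕ) : Prop :=
  ∃ S : Finset V, k ≤ S.card ∧ IsConnectedTwoClub G t S

end Clubs

/-! ### The machine model: a word RAM with unit-cost instructions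

A program has access to finitely many registers (those it names) and to a random-access memory.
Control flow is structured (`ite`, `loop`), so a program is in particular a RAM program with
jumps, with the same running time up to a constant factor. -/

/-- Arithmetic instructions; subtraction is truncated at zero. -/
inductive ArithOp
  | add
  | sub
  | mul

def ArithOp.eval : ArithOp → ℕ → ℕ → ℕ
  | .add, a, b => a + b
  | .sub, a, b => a - b
  | .mul, a, b => a * b

/-- RAM programs. Registers are named by natural numbers. -/
inductive Prog
  /-- do nothing -/
  | skip
  /-- `R[x] := c` -/
  | const (x c : ℕ)
  /-- `R[x] := R[y] op R[z]` -/
  | arith (op : ArithOp) (x y z : ℕ)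
  /-- `R[x] := M[R[y]]` -/
  | load (x y : ℕ)
  /-- `M[R[x]] := R[y]` -/
  | store (x y : ℕ)
  /-- first `p`, then `q` -/
  | seq (p q : Prog)
  /-- if `R[x] < R[y]` then `p` else `q` -/
  | ite (x y : ℕ) (p q : Prog)
  /-- while `R[x] < R[y]` do `p` -/
  | loop (x y : ℕ) (p : Prog)

/-- The contents of the registers and of the memory. -/
structure State where
  reg : ℕ → ℕ
  mem : ℕ → ℕ

def State.setReg (s : State) (x a : ℕ) : State :=
  { s with reg := Function.update s.reg x a }

def State.setMem (s : State) (x a : ℕ) : State :=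
  { s with mem := Function.update s.mem x a }

/-- `Exec W p s τ s'`: started in state `s`, the program `p` halts after exactly `τ` steps in state
`s'`, and no number larger than `W` is ever written. Every instruction and every evaluation of a
test costs one step. A program that computes a number larger than `W` gets stuck. -/
inductive Exec (W : ℕ) : Prog → State → ℕ → State → Prop
  | skip (s : State) : Exec W .skip s 1 s
  | const (s : State) (x c : ℕ) (h : c ≤ W) : Exec W (.const x c) s 1 (s.setReg x c)
  | arith (s : State) (op : ArithOp) (x y z : ℕ) (h : op.eval (s.reg y) (s.reg z) ≤ W) :
      Exec W (.arith op x y z) s 1 (s.setReg x (op.eval (s.reg y) (s.reg z)))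
  | load (s : State) (x y : ℕ) : Exec W (.load x y) s 1 (s.setReg x (s.mem (s.reg y)))
  | store (s : State) (x y : ℕ) : Exec W (.store x y) s 1 (s.setMem (s.reg x) (s.reg y))
  | seq {p q : Prog} {s s' s'' : State} {a b : ℕ} (hp : Exec W p s a s') (hq : Exec W q s' b s'') :
      Exec W (.seq p q) s (a + b) s''
  | ite_true {x y : ℕ} {p q : Prog} {s s' : State} {a : ℕ} (h : s.reg x < s.reg y)
      (hp : Exec W p s a s') : Exec W (.ite x y p q) s (a + 1) s'
  | ite_false {x y : ℕ} {p q : Prog} {s s' : State} {a : ℕ} (h : ¬ s.reg x < s.reg y)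
      (hq : Exec W q s a s') : Exec W (.ite x y p q) s (a + 1) s'
  | loop_true {x y : ℕ} {p : Prog} {s s' s'' : State} {a b : ℕ} (h : s.reg x < s.reg y)
      (hp : Exec W p s a s') (hl : Exec W (.loop x y p) s' b s'') :
      Exec W (.loop x y p) s (a + b + 1) s''
  | loop_false {x y : ℕ} {p : Prog} {s : State} (h : ¬ s.reg x < s.reg y) :
      Exec W (.loop x y p) s 1 s

/-- `E` lists every edge of `G` exactly once, in an arbitrary order and orientation. -/
def IsEdgeList {n : ℕ} (G : SimpleGraph (Fin n)) (E : List (Fin n × Fin n)) : Prop :=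
  (E.map fun e => s(e.1, e.2)).Nodup ∧ ∀ e, e ∈ (E.map fun e => s(e.1, e.2)) ↔ e ∈ G.edgeSet

/-- The initial state for a graph with vertices `0, …, n - 1` and edge list `E` and for the numbers
`t` and `k`: registers `0, 1, 2, 3` hold `n, m, t, k`, the memory holds the endpoints of the edges
one after the other, and everything else is zero. -/
def inputState (n : ℕ) (E : List (Fin n × Fin n)) (t k : ℕ) : State where
  reg := fun x => [n, E.length, t, k].getD x 0
  mem := fun a => (E.flatMap fun e => [e.1.val, e.2.val]).getD a 0

/-- The problem `Q` about a graph `G` with `n` vertices and `m` edges and numbers `t` and `k` can be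
solved in time `O(T n m t k)`: one RAM program decides all instances (answer `1` for yes and `0` for
no in register `0`) in at most `C * T n m t k` steps, on words of logarithmic length, i.e. without
ever writing a number larger than `(n + m + t + k + 2) ^ c`, where `C` and `c` are constants. -/
def SolvableInTime (Q : ∀ n : ℕ, SimpleGraph (Fin n) → ℕ → ℕ → Prop)
    (T : ℕ → ℕ → ℕ → ℕ → ℕ) : Prop :=
  ∃ (p : Prog) (C c : ℕ), ∀ (n : ℕ) (G : SimpleGraph (Fin n)) (t k : ℕ)
    (E : List (Fin n × Fin n)), IsEdgeList G E →
      ∃ (τ : ℕ) (s : State),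
        Exec ((n + G.edgeSet.ncard + t + k + 2) ^ c) p (inputState n E t k) τ s ∧
        τ ≤ C * T n G.edgeSet.ncard t k ∧
        (Q n G t k → s.reg 0 = 1) ∧ (¬ Q n G t k → s.reg 0 = 0)

end WellConnectedClub

/-!
The three models are instances of one notion of a club: any two vertices of a club have sufficiently
many common neighbours in it, where an edge between them may count as some of these, and they cannot
be separated by too few vertices of it. A pair of vertices that violates this condition in a set `F`
violates it in every subset of `F` that contains both. So a club in `F` misses one of the two
vertices, and branching on the vertex to delete gives a search tree of depth `n - k`.

A bad pair is found in time `O(n m)` by counting common neighbours. A separator of fewer than `t`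
vertices misses one of the first `t` vertices and separates it from some vertex, so only `t` sources
are tested against all targets. Each test takes at most `t` augmentations of a system of internally
disjoint paths, each in time `O(n + m)`. Unless every set is a club, clubs with two or more vertices
contain no isolated vertices, so these are deleted at the start, which gives `n ≤ 2 m` and the bound
`O(t² n m)`.
-/

namespace WellConnectedClub

open Finset

/-! ### Clubs by forbidden pairs -/

section Criterion

variable {V : Type*} {G : SimpleGraph V} {S F U A : Finset V} {c k : ℕ} {u v : V}

/-- The parameters of a notion of a club: any two of its vertices have at least `threshold` common
neighbours in the club, where an edge between them counts as `edgeWeight` common neighbours, and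
they cannot be separated by fewer than `cut` vertices of the club. The three models of
well-connected 2-clubs are instances. -/
structure Criterion where
  edgeWeight : ℕ
  threshold : ℕ
  cut : ℕ

open Classical in
/-- The number of common neighbours of `u` and `v` in `S`, where an edge between `u` and `v` counts
as `w` common neighbours. -/
noncomputable def linkCount (G : SimpleGraph V) (w : ℕ) (S : Finset V) (u v : V) : ℕ :=
  #{x ∈ S | G.Adj u x ∧ G.Adj x v} + if G.Adj u v then w else 0

/-- `A` is a union of connected components of `G[S \ U]`. -/
structure IsSeparation (G : SimpleGraph V) (S U A : Finset V) : Prop where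
  subset : A ⊆ S
  disjoint : Disjoint A U
  mem_or_mem : ∀ a ∈ A, ∀ b ∈ S, G.Adj a b → b ∈ A ∨ b ∈ U

/-- Fewer than `c` vertices separate `u` from `v` in `G[S]`. -/
def Separated (G : SimpleGraph V) (S : Finset V) (c : ℕ) (u v : V) : Prop :=
  ∃ U A, IsSeparation G S U A ∧ #U < c ∧ u ∈ A ∧ v ∉ A ∧ v ∉ U

/-- `u` and `v` cannot both lie in a club inside `S`. -/
def IsBadPair (G : SimpleGraph V) (κ : Criterion) (S : Finset V) (u v : V) : Prop :=
  linkCount G κ.edgeWeight S u v < κ.threshold ∨ Separated G S κ.cut u v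

/-- `S` is a club for the criterion `κ`. -/
def IsClub (G : SimpleGraph V) (κ : Criterion) (S : Finset V) : Prop :=
  ∀ u ∈ S, ∀ v ∈ S, u ≠ v → ¬ IsBadPair G κ S u v

/-- `F` contains a club with at least `k` vertices. -/
def HasClub (G : SimpleGraph V) (κ : Criterion) (k : ℕ) (F : Finset V) : Prop :=
  ∃ S ⊆ F, k ≤ #S ∧ IsClub G κ S

theorem linkCount_mono {w : ℕ} (h : S ⊆ F) : linkCount G w S u v ≤ linkCount G w F u v := by
  unfold linkCount
  gcongr

theorem IsSeparation.inter [DecidableEq V] (h : IsSeparation G F U A) (hS : S ⊆ F) :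
    IsSeparation G S U (A ∩ S) where
  subset := inter_subset_right
  disjoint := h.disjoint.mono_left inter_subset_left
  mem_or_mem a ha b hb hab :=
    (h.mem_or_mem a (mem_inter.1 ha).1 b (hS hb) hab).imp_left fun hbA => mem_inter.2 ⟨hbA, hb⟩

theorem IsSeparation.sdiff [DecidableEq V] (h : IsSeparation G S U A) :
    IsSeparation G S U ((S \ U) \ A) where
  subset := sdiff_subset.trans sdiff_subset
  disjoint := sdiff_disjoint.mono_left sdiff_subset
  mem_or_mem x hx y hy hxy := by
    simp only [mem_sdiff] at hx ⊢
    by_contra! hcon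
    have hyA : y ∈ A := by
      by_contra hyA
      exact hyA (hcon.1 ⟨hy, hcon.2⟩)
    exact (h.mem_or_mem y hyA x hx.1.1 hxy.symm).elim hx.2 hx.1.2

theorem Separated.anti (h : Separated G F c u v) (hS : S ⊆ F) (hu : u ∈ S) :
    Separated G S c u v := by
  classical
  obtain ⟨U, A, hA, hU, huA, hvA, hvU⟩ := h
  exact ⟨U, A ∩ S, hA.inter hS, hU, mem_inter.2 ⟨huA, hu⟩, fun h => hvA (mem_inter.1 h).1, hvU⟩

theorem Separated.ne (h : Separated G S c u v) : u ≠ v := by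
  rintro rfl
  obtain ⟨_, _, _, _, huA, hvA, _⟩ := h
  exact hvA huA

theorem not_separated_zero : ¬ Separated G S 0 u v := fun ⟨_, _, _, h, _⟩ => Nat.not_lt_zero _ h

theorem not_separated_of_adj (hv : v ∈ S) (h : G.Adj u v) : ¬ Separated G S c u v :=
  fun ⟨_, _, hA, _, huA, hvA, hvU⟩ => (hA.mem_or_mem u huA v hv h).elim hvA hvU

/-- A separator of size less than `c` misses some source `a`, and separates `a` from one of `u` and
`v`. -/
theorem not_separated_of_sources (hAF : A ⊆ F) (hc : c ≤ #A)
    (h : ∀ u ∈ A, ∀ v ∈ F, ¬ Separated G F c u v) (hu : u ∈ F) (hv : v ∈ F) :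
    ¬ Separated G F c u v := by
  classical
  rintro ⟨U, D, hD, hU, huD, hvD, hvU⟩
  obtain ⟨a, haA, haU⟩ := exists_mem_notMem_of_card_lt_card (hU.trans_le hc)
  by_cases haD : a ∈ D
  · exact h a haA v hv ⟨U, D, hD, hU, haD, hvD, hvU⟩
  · exact h a haA u hu ⟨U, (F \ U) \ D, hD.sdiff, hU, by simp [hAF haA, haU, haD],
      by simp [huD], disjoint_left.1 hD.disjoint huD⟩

theorem IsBadPair.anti {κ : Criterion} (h : IsBadPair G κ F u v) (hS : S ⊆ F) (hu : u ∈ S) :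
    IsBadPair G κ S u v :=
  h.imp (linkCount_mono hS).trans_lt fun h => h.anti hS hu

theorem isBadPair_of_isolated {κ : Criterion} (hκ : 0 < κ.threshold) (hu : ∀ x, ¬ G.Adj u x) :
    IsBadPair G κ S u v :=
  .inl (by simpa [linkCount, hu] using hκ)

theorem HasClub.mono {κ : Criterion} (h : HasClub G κ k S) (hS : S ⊆ F) : HasClub G κ k F :=
  let ⟨X, hX, hk, hclub⟩ := h
  ⟨X, hX.trans hS, hk, hclub⟩

theorem HasClub.le_card {κ : Criterion} (h : HasClub G κ k F) : k ≤ #F :=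
  let ⟨_, hS, hk, _⟩ := h
  hk.trans (card_le_card hS)

theorem IsBadPair.hasClub_iff [DecidableEq V] {κ : Criterion} (h : IsBadPair G κ F u v)
    (huv : u ≠ v) : HasClub G κ k F ↔ HasClub G κ k (F.erase u) ∨ HasClub G κ k (F.erase v) := by
  refine ⟨?_, fun h => h.elim (.mono · (erase_subset _ _)) (.mono · (erase_subset _ _))⟩
  rintro ⟨S, hS, hk, hclub⟩
  by_cases hu : u ∈ S
  · have hv : v ∉ S := fun hv => hclub u hu v hv huv (h.anti hS hu)
    exact .inr ⟨S, subset_erase.2 ⟨hS, hv⟩, hk, hclub⟩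
  · exact .inl ⟨S, subset_erase.2 ⟨hS, hu⟩, hk, hclub⟩

theorem hasClub_of_le_one {κ : Criterion} (hk : k ≤ 1) (hF : k ≤ #F) : HasClub G κ k F := by
  obtain ⟨S, hS, hcard⟩ := exists_subset_card_eq hF
  refine ⟨S, hS, hcard.ge, fun u hu v hv huv => absurd ?_ huv⟩
  exact card_le_one.1 (hcard.trans_le hk) u hu v hv

theorem hasClub_of_trivial {κ : Criterion} (hθ : κ.threshold = 0) (hc : κ.cut = 0)
    (hF : k ≤ #F) : HasClub G κ k F := by
  refine ⟨F, Subset.rfl, hF, fun u _ v _ _ h => ?_⟩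
  rw [IsBadPair, hθ, hc] at h
  exact h.elim (Nat.not_lt_zero _) not_separated_zero

/-- A club with two vertices has no isolated vertices. -/
theorem hasClub_iff_of_adj_mem {κ : Criterion} (hκ : 0 < κ.threshold) (hk : 2 ≤ k) (hS : S ⊆ F)
    (h : ∀ x y, G.Adj x y → x ∈ S) : HasClub G κ k F ↔ HasClub G κ k S := by
  refine ⟨fun ⟨X, _, hkX, hclub⟩ => ⟨X, fun x hx => ?_, hkX, hclub⟩, fun h => h.mono hS⟩
  obtain ⟨y, hy, hyx⟩ := exists_mem_ne (hk.trans hkX) x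
  by_contra hxS
  exact hclub x hx y hy hyx.symm (isBadPair_of_isolated hκ fun z hz => hxS (h x z hz))

section Map

variable {W : Type*} (f : V ↪ W)

theorem linkCount_map (w : ℕ) : linkCount (G.map f) w (S.map f) (f u) (f v) =
    linkCount G w S u v := by
  classical
  simp only [linkCount, filter_map, card_map, Function.comp_def, SimpleGraph.map_adj_apply]

theorem separated_map_iff :
    Separated (G.map f) (S.map f) c (f u) (f v) ↔ Separated G S c u v := by
  constructor
  · rintro ⟨U, A, hA, hU, huA, hvA, hvU⟩
    refine ⟨U.preimage f f.injective.injOn, A.preimage f f.injective.injOn,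
      ⟨fun x hx => ?_, ?_, fun a ha b hb hab => ?_⟩, ?_,
      mem_preimage.2 huA, mem_preimage.not.2 hvA, mem_preimage.not.2 hvU⟩
    · exact (mem_map' f).1 (hA.subset (mem_preimage.1 hx))
    · exact disjoint_left.2 fun x hx hxU =>
        disjoint_left.1 hA.disjoint (mem_preimage.1 hx) (mem_preimage.1 hxU)
    · simpa only [mem_preimage] using hA.mem_or_mem (f a) (mem_preimage.1 ha) (f b)
        (mem_map_of_mem f hb) (SimpleGraph.map_adj_apply.2 hab)
    · exact (card_le_card_of_injOn f (fun x hx => mem_preimage.1 hx) f.injective.injOn).trans_lt hU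
  · rintro ⟨U, A, hA, hU, huA, hvA, hvU⟩
    refine ⟨U.map f, A.map f, ⟨map_subset_map.2 hA.subset, (disjoint_map f).2 hA.disjoint, ?_⟩,
      by rwa [card_map], mem_map_of_mem f huA, by rwa [mem_map'], by rwa [mem_map']⟩
    simp only [forall_mem_map, mem_map', SimpleGraph.map_adj_apply]
    exact hA.mem_or_mem

theorem isClub_map_iff {κ : Criterion} : IsClub (G.map f) κ (S.map f) ↔ IsClub G κ S := by
  simp only [IsClub, IsBadPair, forall_mem_map, linkCount_map, separated_map_iff, ne_eq,
    f.apply_eq_iff_eq]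

theorem hasClub_map_iff {κ : Criterion} :
    HasClub (G.map f) κ k (F.map f) ↔ HasClub G κ k F := by
  simp only [HasClub, subset_map_iff]
  constructor
  · rintro ⟨_, ⟨S, hS, rfl⟩, hk, hclub⟩
    exact ⟨S, hS, by rwa [card_map] at hk, (isClub_map_iff f).1 hclub⟩
  · rintro ⟨S, hS, hk, hclub⟩
    exact ⟨S.map f, ⟨S, hS, rfl⟩, by rwa [card_map], (isClub_map_iff f).2 hclub⟩

end Map

end Criterion

/-! ### The three models as clubs for a criterion -/

section Models

variable {V : Type*} {G : SimpleGraph V} {S : Finset V} {t w : ℕ} {u v : V}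

theorem linkCount_of_not_adj [DecidableRel G.Adj] (h : ¬ G.Adj u v) :
    linkCount G w S u v = #{x ∈ S | G.Adj u x ∧ G.Adj x v} := by
  rw [linkCount, if_neg h, add_zero]
  convert rfl

theorem le_linkCount_of_adj (h : G.Adj u v) : w ≤ linkCount G w S u v := by
  rw [linkCount, if_pos h]
  exact Nat.le_add_left _ _

theorem walk_eq_of_length_le_two (huv : u ≠ v) (p : G.Walk u v) (hp : p.length ≤ 2) :
    (∃ h : G.Adj u v, p = .cons h .nil) ∨
      ∃ (x : V) (h : G.Adj u x) (h' : G.Adj x v), p = .cons h (.cons h' .nil) := by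
  cases p with
  | nil => exact absurd rfl huv
  | cons h q =>
    cases q with
    | nil => exact .inl ⟨h, rfl⟩
    | cons h' q =>
      cases q with
      | nil => exact .inr ⟨_, h, h', rfl⟩
      | cons h'' q => simp only [SimpleGraph.Walk.length_cons] at hp; omega

theorem isTwoClub_iff {X : Set V} : IsTwoClub G X ↔
    ∀ u ∈ X, ∀ v ∈ X, u ≠ v → ¬ G.Adj u v → ∃ x ∈ X, G.Adj u x ∧ G.Adj x v := by
  constructor
  · intro h u hu v hv huv hadj
    have hdist := h ⟨u, hu⟩ ⟨v, hv⟩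
    obtain ⟨p, hp⟩ := SimpleGraph.exists_walk_of_edist_ne_top
      (ne_top_of_le_ne_top (ENat.natCast_ne_top 2) hdist)
    rw [← hp] at hdist
    rcases walk_eq_of_length_le_two (mt Subtype.ext_iff.1 huv) p (by exact_mod_cast hdist) with
      ⟨h, -⟩ | ⟨x, h, h', -⟩
    · exact absurd h hadj
    · exact ⟨x, x.2, h, h'⟩
  · rintro h ⟨u, hu⟩ ⟨v, hv⟩
    by_cases huv : u = v
    · subst huv
      simp only [SimpleGraph.edist_self, zero_le]
    by_cases hadj : G.Adj u v
    · have hadj' : (G.induce X).Adj ⟨u, hu⟩ ⟨v, hv⟩ := hadj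
      exact (SimpleGraph.edist_le hadj'.toWalk).trans (by simp)
    · obtain ⟨x, hx, hux, hxv⟩ := h u hu v hv huv hadj
      have hux' : (G.induce X).Adj ⟨u, hu⟩ ⟨x, hx⟩ := hux
      have hxv' : (G.induce X).Adj ⟨x, hx⟩ ⟨v, hv⟩ := hxv
      exact (SimpleGraph.edist_le (.cons hux' hxv'.toWalk)).trans (by simp)

/-- The criterion describing `t`-hereditary 2-clubs: nonadjacent vertices have more than `t` common
neighbours. -/
def hereditary (t : ℕ) : Criterion := ⟨t + 1, t + 1, 0⟩

/-- The criterion describing `t`-robust 2-clubs: an edge is one of the `t` required paths. -/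
def robust (t : ℕ) : Criterion := ⟨1, t, 0⟩

/-- The criterion describing `t`-connected 2-clubs among the sets with more than `t` vertices. -/
def connected (t : ℕ) : Criterion := ⟨1, 1, t⟩

theorem isClub_iff_of_cut_eq_zero {κ : Criterion} (h : κ.cut = 0) : IsClub G κ S ↔
    ∀ u ∈ S, ∀ v ∈ S, u ≠ v → κ.threshold ≤ linkCount G κ.edgeWeight S u v := by
  simp only [IsClub, IsBadPair, h, not_separated_zero, or_false, not_lt]

theorem isHereditaryTwoClub_iff_isClub : IsHereditaryTwoClub G t S ↔ IsClub G (hereditary t) S := by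
  classical
  rw [isClub_iff_of_cut_eq_zero rfl]
  constructor
  · intro h u hu v hv huv
    by_cases hadj : G.Adj u v
    · exact le_linkCount_of_adj hadj
    by_contra! hlt
    rw [linkCount_of_not_adj hadj] at hlt
    have hu' : u ∉ ({x ∈ S | G.Adj u x ∧ G.Adj x v} : Finset V) := by simp
    have hv' : v ∉ ({x ∈ S | G.Adj u x ∧ G.Adj x v} : Finset V) := by simp
    obtain ⟨x, ⟨hxS, hx⟩, hux, hxv⟩ := isTwoClub_iff.1
      (h _ ((ssubset_iff_of_subset (filter_subset _ _)).2 ⟨u, hu, hu'⟩) (Nat.le_of_lt_succ hlt))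
      u ⟨hu, hu'⟩ v ⟨hv, hv'⟩ huv hadj
    exact hx (mem_filter.2 ⟨hxS, hux, hxv⟩)
  · intro h U _ hUt
    refine isTwoClub_iff.2 fun u hu v hv huv hadj => ?_
    have hcard := h u hu.1 v hv.1 huv
    rw [linkCount_of_not_adj hadj] at hcard
    obtain ⟨x, hx, hxU⟩ := exists_mem_notMem_of_card_lt_card (hUt.trans_lt hcard)
    rw [mem_filter] at hx
    exact ⟨x, ⟨hx.1, hxU⟩, hx.2⟩

section SecondVertices

variable {p q : G.Walk u v}

/-- The second vertices of the paths of length at most two from `u` to `v`. Such a path is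
determined by its second vertex. -/
def secondVertices (G : SimpleGraph V) (u v : V) : Set V := {x | G.Adj u x ∧ (x = v ∨ G.Adj x v)}

theorem snd_mem_secondVertices (huv : u ≠ v) (hp : p.length ≤ 2) :
    p.snd ∈ secondVertices G u v := by
  rcases walk_eq_of_length_le_two huv p hp with ⟨h, rfl⟩ | ⟨x, h, h', rfl⟩
  · exact ⟨h, .inl rfl⟩
  · exact ⟨h, .inr h'⟩

theorem eq_of_snd_eq (huv : u ≠ v) (hp : p.length ≤ 2) (hq : q.length ≤ 2) (h : p.snd = q.snd) :
    p = q := by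
  rcases walk_eq_of_length_le_two huv p hp with ⟨_, rfl⟩ | ⟨x, _, hxv, rfl⟩ <;>
    rcases walk_eq_of_length_le_two huv q hq with ⟨_, rfl⟩ | ⟨y, _, hyv, rfl⟩
  · rfl
  · exact absurd (h : v = y) hyv.ne'
  · exact absurd (h : x = v) hxv.ne
  · obtain rfl : x = y := h
    rfl

theorem exists_path_snd_eq {x : V} (huv : u ≠ v) (hx : x ∈ secondVertices G u v) :
    ∃ p : G.Path u v, p.1.length ≤ 2 ∧ p.1.snd = x := by
  obtain ⟨hux, rfl | hxv⟩ := hx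
  · exact ⟨.singleton hux, one_le_two, rfl⟩
  · have hpath : (SimpleGraph.Walk.cons hux hxv.toWalk).IsPath := by
      simp [SimpleGraph.Walk.isPath_def, hux.ne, hxv.ne, huv]
    exact ⟨⟨_, hpath⟩, le_rfl, rfl⟩

theorem eq_or_eq_or_eq_snd {x : V} (huv : u ≠ v) (hp : p.length ≤ 2) (hx : x ∈ p.support) :
    x = u ∨ x = v ∨ x = p.snd := by
  rcases walk_eq_of_length_le_two huv p hp with ⟨_, rfl⟩ | ⟨y, _, _, rfl⟩
  · simpa using hx
  · simpa [or_comm] using hx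

theorem exists_disjoint_paths_iff (huv : u ≠ v) :
    (∃ P : Fin t → G.Path u v, Function.Injective P ∧ (∀ i, (P i).1.length ≤ 2) ∧
      ∀ i j, i ≠ j → ∀ x, x ∈ (P i).1.support → x ∈ (P j).1.support → x = u ∨ x = v) ↔
    Nonempty (Fin t ↪ secondVertices G u v) := by
  constructor
  · rintro ⟨P, hinj, hlen, -⟩
    exact ⟨fun i => ⟨(P i).1.snd, snd_mem_secondVertices huv (hlen i)⟩, fun i j h =>
      hinj (Subtype.ext (eq_of_snd_eq huv (hlen i) (hlen j) (Subtype.ext_iff.1 h)))⟩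
  · rintro ⟨f⟩
    choose P hlen hsnd using fun i => exists_path_snd_eq huv (f i).2
    have snd_inj {i j} (h : (P i).1.snd = (P j).1.snd) : i = j :=
      f.injective (Subtype.ext ((hsnd i).symm.trans (h.trans (hsnd j))))
    refine ⟨P, fun i j h => snd_inj (by rw [h]), hlen, fun i j hij x hxi hxj => ?_⟩
    by_contra! hx
    have hxi := ((eq_or_eq_or_eq_snd huv (hlen i) hxi).resolve_left hx.1).resolve_left hx.2
    have hxj := ((eq_or_eq_or_eq_snd huv (hlen j) hxj).resolve_left hx.1).resolve_left hx.2
    exact hij (snd_inj (hxi.symm.trans hxj))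

theorem ncard_secondVertices_induce (u v : (S : Set V)) :
    (secondVertices (G.induce S) u v).ncard = linkCount G 1 S u v := by
  classical
  have himage : Subtype.val '' secondVertices (G.induce S) u v =
      (({x ∈ S | G.Adj u x ∧ G.Adj x v} ∪ {x ∈ S | x = v.1 ∧ G.Adj u v} : Finset V) : Set V) := by
    ext x
    simp only [secondVertices, Set.mem_image, Set.mem_ofPred_eq, SimpleGraph.induce_adj,
      Subtype.exists, exists_and_right, exists_eq_right, coe_union, coe_filter, Set.mem_union,
      Subtype.ext_iff, mem_coe]
    grind
  have hdisj : Disjoint ({x ∈ S | G.Adj u x ∧ G.Adj x v} : Finset V)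
      {x ∈ S | x = v.1 ∧ G.Adj u v} :=
    disjoint_filter.2 fun x _ h h' => h.2.ne h'.1
  rw [← Set.ncard_image_of_injective _ Subtype.val_injective, himage, Set.ncard_coe_finset,
    card_union_of_disjoint hdisj, linkCount]
  congr 1
  split_ifs with hadj
  · refine card_eq_one.2 ⟨v, ext fun x => ?_⟩
    simp only [mem_filter, hadj, and_true, mem_singleton, and_iff_right_iff_imp]
    exact fun hx => hx ▸ v.2
  · simp only [hadj, and_false, filter_false, card_empty]

end SecondVertices

theorem isRobustTwoClub_iff_isClub : IsRobustTwoClub G t S ↔ IsClub G (robust t) S := by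
  have paths_iff {u v : (S : Set V)} (huv : u ≠ v) :
      (∃ P : Fin t → (G.induce (S : Set V)).Path u v, Function.Injective P ∧
        (∀ i, (P i).1.length ≤ 2) ∧ ∀ i j, i ≠ j → ∀ x,
          x ∈ (P i).1.support → x ∈ (P j).1.support → x = u ∨ x = v) ↔
      t ≤ linkCount G 1 S u v := by
    have : Finite (S : Set V) := S.finite_toSet
    have := Fintype.ofFinite (secondVertices (G.induce S) u v)
    rw [exists_disjoint_paths_iff huv, Function.Embedding.nonempty_iff_card_le, Fintype.card_fin,
      ← Nat.card_eq_fintype_card, Nat.card_coe_set_eq, ncard_secondVertices_induce]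
  rw [isClub_iff_of_cut_eq_zero rfl]
  constructor
  · intro h u hu v hv huv
    have huv' : (⟨u, hu⟩ : (S : Set V)) ≠ ⟨v, hv⟩ := mt Subtype.ext_iff.1 huv
    exact (paths_iff huv').1 (h _ _ huv')
  · exact fun h u v huv => (paths_iff huv).2 (h u u.2 v v.2 (mt Subtype.ext huv))

theorem mem_of_reachable {X A : Set V} {u v : X} (hA : ∀ a ∈ A, ∀ b ∈ X, G.Adj a b → b ∈ A)
    (h : (G.induce X).Reachable u v) (hu : u.1 ∈ A) : v.1 ∈ A := by
  obtain ⟨p⟩ := h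
  induction p with
  | nil => exact hu
  | @cons a b _ hab _ ih => exact ih (hA a hu b b.2 hab)

open Classical in
theorem isSeparation_reachable {U : Finset V} (u : ((S : Set V) \ U : Set V)) :
    IsSeparation G S U {x ∈ S | ∃ hx, (G.induce ((S : Set V) \ U)).Reachable u ⟨x, hx⟩} where
  subset := filter_subset _ _
  disjoint := disjoint_left.2 fun x hx =>
    have ⟨hx, _⟩ := (mem_filter.1 hx).2
    hx.2
  mem_or_mem a ha b hb hab := by
    obtain ⟨ha, hr⟩ := (mem_filter.1 ha).2
    refine or_iff_not_imp_right.2 fun hbU => mem_filter.2 ⟨hb, ⟨hb, hbU⟩, hr.trans ?_⟩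
    exact SimpleGraph.Adj.reachable (G := G.induce ((S : Set V) \ U)) hab

theorem forall_connected_iff (hS : t < #S) :
    (∀ U ⊆ S, #U < t → (G.induce ((S : Set V) \ U)).Connected) ↔
      ∀ u ∈ S, ∀ v ∈ S, ¬ Separated G S t u v := by
  classical
  constructor
  · rintro h u hu v hv ⟨U, A, hA, hU, huA, hvA, hvU⟩
    have hreach := (h (U ∩ S) inter_subset_right
      ((card_le_card inter_subset_left).trans_lt hU)).preconnected
      ⟨u, hu, fun hu' => disjoint_left.1 hA.disjoint huA (mem_inter.1 hu').1⟩
      ⟨v, hv, fun hv' => hvU (mem_inter.1 hv').1⟩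
    exact hvA (mem_of_reachable (A := (A : Set V))
      (fun a ha b hb hab => (hA.mem_or_mem a ha b hb.1 hab).resolve_right
        fun hbU => hb.2 (mem_inter.2 ⟨hbU, hb.1⟩)) hreach huA)
  · intro h U _ hUt
    obtain ⟨x, hx, hxU⟩ := exists_mem_notMem_of_card_lt_card (hUt.trans hS)
    have : Nonempty ((S : Set V) \ (U : Set V) : Set V) := ⟨x, hx, hxU⟩
    refine ⟨fun u v => ?_⟩
    by_contra hreach
    refine h u u.2.1 v v.2.1 ⟨U, _, isSeparation_reachable u, hUt,
      mem_filter.2 ⟨u.2.1, u.2, .refl u⟩, fun hv => ?_, v.2.2⟩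
    obtain ⟨_, hv⟩ := (mem_filter.1 hv).2
    exact hreach hv

theorem isTwoClub_iff_one_le_linkCount : IsTwoClub G (S : Set V) ↔
    ∀ u ∈ S, ∀ v ∈ S, u ≠ v → 1 ≤ linkCount G 1 S u v := by
  classical
  refine isTwoClub_iff.trans (forall₅_congr fun u _ v _ _ => ?_)
  by_cases hadj : G.Adj u v
  · simp only [hadj, not_true_eq_false, false_imp_iff, le_linkCount_of_adj]
  · rw [linkCount_of_not_adj hadj, Nat.one_le_iff_ne_zero, card_ne_zero]
    simp only [hadj, not_false_eq_true, forall_const, mem_coe, filter_nonempty_iff]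

theorem isConnectedTwoClub_iff : IsConnectedTwoClub G t S ↔ t < #S ∧ IsClub G (connected t) S := by
  rw [IsConnectedTwoClub, and_left_comm]
  refine and_congr_right fun hS => ?_
  rw [forall_connected_iff hS, isTwoClub_iff_one_le_linkCount]
  simp only [IsClub, IsBadPair, connected, not_or, not_lt]
  constructor
  · exact fun h u hu v hv huv => ⟨h.1 u hu v hv huv, h.2 u hu v hv⟩
  · refine fun h => ⟨fun u hu v hv huv => (h u hu v hv huv).1, fun u hu v hv hsep => ?_⟩
    exact (h u hu v hv hsep.ne).2 hsep

end Models

/-! ### Disjoint paths -/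

section Linkage

variable {V : Type*} [DecidableEq V] {G : SimpleGraph V} {E D R : Finset V} {u v x x' : V}
  {c d : ℕ} {p : V → V}

/-- `p` encodes `c` internally disjoint paths from `u` to `v` with inner vertices in `E`: it maps a
vertex of a path to its predecessor, and `u` and the vertices outside of the paths to themselves.
So the vertices that are no predecessors of others are the last inner vertices of the paths, and
`c + 1` vertices have predecessor `u`. While the paths are being rerouted, `D ⊆ E` is the set of
the vertices whose predecessor is up to date. -/
structure Linkage (G : SimpleGraph V) (E D : Finset V) (u v : V) (p : V → V) (c : ℕ) : Prop where
  maps : ∀ x ∈ E, p x ∈ E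
  edge : ∀ x ∈ E, p x = x ∨ G.Adj (p x) x
  inj : ∀ x ∈ D, ∀ y ∈ D, p x = p y → p x ≠ u → x = y
  count : #{x ∈ D | p x = u} = c + 1
  miss : ∀ y ∈ E, (∀ x ∈ D, p x ≠ y) → G.Adj y v

namespace Linkage

theorem of_forall_eq (hu : u ∈ E) (hp : ∀ x ∈ E, p x = x) : Linkage G E E u v p 0 where
  maps x hx := (hp x hx).symm ▸ hx
  edge x hx := .inl (hp x hx)
  inj x hx y hy h _ := by rwa [hp x hx, hp y hy] at h
  count := by
    rw [filter_congr fun x hx => by rw [hp x hx], filter_eq', if_pos hu, card_singleton]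
  miss y hy h := absurd (hp y hy) (h y hy)

theorem card_filter_mem_erase_le (h : Linkage G E E u v p c) :
    #{x ∈ E | p x ∈ R.erase u} ≤ #(R.erase u) := by
  refine card_le_card_of_injOn p (fun x hx => (mem_filter.1 hx).2) fun x hx y hy hxy => ?_
  have hx := mem_filter.1 hx
  exact h.inj x hx.1 y (mem_filter.1 hy).1 hxy (mem_erase.1 hx.2).1

theorem filter_mem_eq_union (hu : u ∈ R) :
    ({x ∈ E | p x ∈ R} : Finset V) = {x ∈ E | p x = u} ∪ {x ∈ E | p x ∈ R.erase u} := by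
  rw [← filter_or]
  refine filter_congr fun x _ => ?_
  rw [← mem_insert, insert_erase hu]

theorem card_filter_mem (h : Linkage G E E u v p c) (hu : u ∈ R) :
    #{x ∈ E | p x ∈ R} = c + 1 + #{x ∈ E | p x ∈ R.erase u} := by
  have hdisj : Disjoint ({x ∈ E | p x = u} : Finset V) {x ∈ E | p x ∈ R.erase u} :=
    disjoint_filter.2 fun x _ hxu hx => (mem_erase.1 hx).1 hxu
  rw [filter_mem_eq_union hu, card_union_of_disjoint hdisj, h.count]

theorem card_filter_mem_le (h : Linkage G E E u v p c) (hu : u ∈ R) :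
    #{x ∈ E | p x ∈ R} ≤ c + #R := by
  have hle := h.card_filter_mem_erase_le (R := R)
  rw [card_erase_of_mem hu] at hle
  have hpos : 0 < #R := card_pos.2 ⟨u, hu⟩
  rw [h.card_filter_mem hu]
  omega

/-- Counts the edges of the paths that start in the component `A` of `u`: every vertex of `A` other
than `u` has a successor, `u` has `c` successors, and the successors lie in `A` or in the
separator. -/
theorem not_separated (h : Linkage G E E u v p c) : ¬ Separated G (insert v E) c u v := by
  rintro ⟨U, A, hA, hU, huA, hvA, hvU⟩
  have hsucc : ({x ∈ E | p x ∈ A} : Finset V) ⊆ A ∪ U := by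
    intro x hx
    obtain ⟨hx, hpx⟩ := mem_filter.1 hx
    rcases h.edge x hx with e | e
    · exact mem_union_left _ (e ▸ hpx)
    · exact mem_union.2 (hA.mem_or_mem _ hpx x (mem_insert_of_mem hx) e)
  have hsurj : A.erase u ⊆ image p {x ∈ E | p x ∈ A.erase u} := by
    intro y hy
    have hyA := mem_of_mem_erase hy
    have hyE : y ∈ E := mem_of_mem_insert_of_ne (hA.subset hyA) fun e => hvA (e ▸ hyA)
    by_contra hcon
    have hyv : G.Adj y v := h.miss y hyE fun x hx e =>
      hcon (mem_image.2 ⟨x, mem_filter.2 ⟨hx, e.symm ▸ hy⟩, e⟩)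
    exact (hA.mem_or_mem y hyA v (mem_insert_self _ _) hyv).elim hvA hvU
  have hcard := card_le_card hsucc
  rw [h.card_filter_mem huA] at hcard
  have hsurj := (card_le_card hsurj).trans card_image_le
  rw [card_erase_of_mem huA] at hsurj
  have hunion := card_union_le A U
  omega

/-- If the search for an augmenting path ends with the set `R` of scanned vertices, then the
successors of `R` outside of `R` form a separator. -/
theorem separated (h : Linkage G E E u v p c) (hc : c < d) (hv : v ∉ E) (hR : R ⊆ E) (hu : u ∈ R)
    (hself : ∀ y ∈ R, p y ∈ R) (hclosed : ∀ y ∈ R, ∀ x ∈ E, G.Adj y x → p x ∈ R)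
    (hend : ∀ y ∈ R, ¬ G.Adj y v) : Separated G (insert v E) d u v := by
  refine ⟨({x ∈ E | p x ∈ R} : Finset V) \ R, R, ⟨hR.trans (subset_insert _ _), disjoint_sdiff,
    fun a ha b hb hab => or_iff_not_imp_left.2 fun hbR => ?_⟩, ?_, hu, fun hvR => hv (hR hvR),
    fun hvU => hv (mem_filter.1 (mem_sdiff.1 hvU).1).1⟩
  · have hbE : b ∈ E := mem_of_mem_insert_of_ne hb fun e => hend a ha (e ▸ hab)
    exact mem_sdiff.2 ⟨mem_filter.2 ⟨hbE, hclosed a ha b hbE hab⟩, hbR⟩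
  · rw [card_sdiff_of_subset fun y hy => mem_filter.2 ⟨hR hy, hself y hy⟩]
    have hle := h.card_filter_mem_le hu
    omega

/-! An augmentation moves along the alternating path from `v` to `u`: it releases the last vertex
whose predecessor changes, shifts the gap towards `u`, and finally closes it. -/

theorem release (h : Linkage G E E u v p c) (hxu : p x ≠ u) (hx : G.Adj (p x) v) :
    Linkage G E (E.erase x) u v p c where
  maps := h.maps
  edge := h.edge
  inj a ha b hb := h.inj a (mem_of_mem_erase ha) b (mem_of_mem_erase hb)
  count := by
    have hx : x ∉ ({a ∈ E | p a = u} : Finset V) := fun hx => hxu (mem_filter.1 hx).2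
    rw [← h.count, filter_erase, erase_eq_of_notMem hx]
  miss y hy hm := by
    by_cases hyx : p x = y
    · exact hyx ▸ hx
    · exact h.miss y hy fun a ha e => hm a (mem_erase.2 ⟨fun hax => hyx (hax ▸ e), ha⟩) e

theorem shift (h : Linkage G E (E.erase x) u v p c) (hx : x ∈ E) (hx' : x' ∈ E) (hne : x' ≠ x)
    (hu : p x' ≠ u) (he : p x' = x ∨ G.Adj (p x') x) :
    Linkage G E (E.erase x') u v (Function.update p x (p x')) c where
  maps a ha := by
    rw [Function.update_apply]
    split_ifs
    exacts [h.maps x' hx', h.maps a ha]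
  edge a ha := by
    rw [Function.update_apply]
    split_ifs with hax
    · rwa [hax]
    · exact h.edge a ha
  inj a ha b hb := by
    have eq_of_eq {d : V} (hd : d ∈ E.erase x') (hdx : d ≠ x) : p x' ≠ p d := fun e =>
      (mem_erase.1 hd).1 (h.inj x' (mem_erase.2 ⟨hne, hx'⟩) d
        (mem_erase.2 ⟨hdx, mem_of_mem_erase hd⟩) e hu).symm
    simp only [Function.update_apply]
    split_ifs with hax hbx hbx
    · exact fun _ _ => hax.trans hbx.symm
    · exact fun e _ => absurd e (eq_of_eq hb hbx)
    · exact fun e _ => absurd e.symm (eq_of_eq ha hax)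
    · exact h.inj a (mem_erase.2 ⟨hax, mem_of_mem_erase ha⟩) b
        (mem_erase.2 ⟨hbx, mem_of_mem_erase hb⟩)
  count := by
    rw [← h.count]
    congr 1
    ext a
    simp only [mem_filter, mem_erase, Function.update_apply]
    grind
  miss y hy hm := by
    refine h.miss y hy fun a ha e => ?_
    obtain ⟨ha1, ha2⟩ := mem_erase.1 ha
    by_cases hax : a = x'
    · refine hm x (mem_erase.2 ⟨hne.symm, hx⟩) ?_
      rw [Function.update_self, ← hax, e]
    · refine hm a (mem_erase.2 ⟨hax, ha2⟩) ?_
      rw [Function.update_of_ne ha1, e]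

theorem attach (h : Linkage G E (E.erase x) u v p c) (hx : x ∈ E) (hu : u ∈ E)
    (he : u = x ∨ G.Adj u x) : Linkage G E E u v (Function.update p x u) (c + 1) where
  maps a ha := by
    rw [Function.update_apply]
    split_ifs
    exacts [hu, h.maps a ha]
  edge a ha := by
    rw [Function.update_apply]
    split_ifs with hax
    · rwa [hax]
    · exact h.edge a ha
  inj a ha b hb := by
    simp only [Function.update_apply]
    split_ifs with hax hbx hbx
    · exact fun _ _ => hax.trans hbx.symm
    · exact fun _ e => absurd rfl e
    · exact fun e e' => absurd e e'
    · exact h.inj a (mem_erase.2 ⟨hax, ha⟩) b (mem_erase.2 ⟨hbx, hb⟩)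
  count := by
    have hfilter : ({a ∈ E | Function.update p x u a = u} : Finset V) =
        insert x {a ∈ E.erase x | p a = u} := by
      ext a
      simp only [mem_filter, mem_insert, mem_erase, Function.update_apply]
      grind
    rw [hfilter, card_insert_of_notMem (by simp), h.count]
  miss y hy hm := by
    refine h.miss y hy fun a ha e => ?_
    obtain ⟨hax, haE⟩ := mem_erase.1 ha
    refine hm a haE ?_
    rw [Function.update_of_ne hax, e]

end Linkage

end Linkage

/-! ### An imperative language with named variables and arrays -/

/-- The variables of the programs below. The first four are held by the registers of the input. -/
inductive Var
  | n | m | t | k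
  | weight | threshold | cut | answer | arcs | size | budget
  | e | c | a | b | x
  | u | v | sources | bad | badU | badV
  | i | ok | head | tail | exit | y | ptr | z
  | depth | running
  deriving DecidableEq

/-- The arrays of the programs below. -/
inductive Arr
  | src | tgt | next | first | inS | mark | count | pred | visited | parent | via | queue
  | deleted | alternative
  deriving DecidableEq

/-- The register that holds a variable. -/
def Var.idx (X : Var) : ℕ := X.ctorIdx

/-- The residue class of the memory cells that hold an array. -/
def Arr.idx (A : Arr) : ℕ := A.ctorIdx

theorem Var.idx_lt (X : Var) : X.idx < 40 := by cases X <;> decide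

theorem Var.idx_injective : Function.Injective Var.idx := by
  intro X Y h
  rw [← Var.ofNat_ctorIdx X, ← Var.ofNat_ctorIdx Y]
  exact congrArg Var.ofNat h

theorem Arr.idx_lt (A : Arr) : A.idx < 16 := by cases A <;> decide

theorem Arr.idx_injective : Function.Injective Arr.idx := by
  intro A A' h
  rw [← Arr.ofNat_ctorIdx A, ← Arr.ofNat_ctorIdx A']
  exact congrArg Arr.ofNat h

/-- The contents of the variables and of the arrays, and the read-only input. -/
structure Store where
  var : Var → ℕ
  arr : Arr → ℕ → ℕ
  inp : ℕ → ℕ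

namespace Store

/-- Assignment to a variable. -/
def set (s : Store) (X : Var) (a : ℕ) : Store :=
  { s with var := Function.update s.var X a }

/-- Assignment to an array cell. -/
def put (s : Store) (A : Arr) (i a : ℕ) : Store :=
  { s with arr := Function.update s.arr A (Function.update (s.arr A) i a) }

variable (s : Store) (X Y : Var) (A A' : Arr) (i a : ℕ)

@[simp] theorem set_var : (s.set X a).var Y = if Y = X then a else s.var Y := by
  simp [set, Function.update_apply]

@[simp] theorem set_arr : (s.set X a).arr = s.arr := rfl

@[simp] theorem set_inp : (s.set X a).inp = s.inp := rfl

@[simp] theorem put_var : (s.put A i a).var = s.var := rfl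

@[simp] theorem put_inp : (s.put A i a).inp = s.inp := rfl

@[simp] theorem put_arr :
    (s.put A i a).arr A' = if A' = A then Function.update (s.arr A) i a else s.arr A' := by
  by_cases h : A' = A
  · subst h
    simp [put]
  · simp [put, h]

end Store

attribute [simp] ArithOp.eval

/-- Expressions over the variables, the arrays and the input. -/
inductive Expr
  | lit (c : ℕ)
  | var (X : Var)
  | inp (e : Expr)
  | get (A : Arr) (e : Expr)
  | op (o : ArithOp) (e f : Expr)

namespace Expr

@[simp] def eval (s : Store) : Expr → ℕ
  | lit c => c
  | var X => s.var X
  | inp e => s.inp (e.eval s)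
  | get A e => s.arr A (e.eval s)
  | op o e f => o.eval (e.eval s) (f.eval s)

/-- The expression can be evaluated with all intermediate results and array indices at most `B`,
reading only the first `M` cells of the input. -/
@[simp] def Ok (M B : ℕ) (s : Store) : Expr → Prop
  | lit c => c ≤ B
  | var _ => True
  | inp e => e.Ok M B s ∧ e.eval s < M
  | get _ e => e.Ok M B s ∧ e.eval s ≤ B
  | op o e f => e.Ok M B s ∧ f.Ok M B s ∧ o.eval (e.eval s) (f.eval s) ≤ B

instance : Coe Var Expr := ⟨var⟩

instance (c : ℕ) : OfNat Expr c := ⟨lit c⟩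

instance : Add Expr := ⟨op .add⟩

instance : Sub Expr := ⟨op .sub⟩

instance : Mul Expr := ⟨op .mul⟩

@[simp] theorem eval_sub (s : Store) (e f : Expr) : (e - f).eval s = e.eval s - f.eval s := rfl

@[simp] theorem ok_sub {M B : ℕ} {s : Store} {e f : Expr} :
    (e - f).Ok M B s ↔ e.Ok M B s ∧ f.Ok M B s ∧ e.eval s - f.eval s ≤ B := .rfl

/-- The number of machine instructions that the compiled expression takes. -/
def cost : Expr → ℕ
  | lit _ => 1
  | var _ => 2
  | inp e => e.cost + 1
  | get _ e => e.cost + 6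
  | op _ e f => e.cost + f.cost + 1

end Expr

/-- Commands: `ite e f p q` and `loop e f p` test whether `e < f`, as the machine does. -/
inductive Cmd
  | skip
  | set (X : Var) (e : Expr)
  | put (A : Arr) (e f : Expr)
  | seq (p q : Cmd)
  | ite (e f : Expr) (p q : Cmd)
  | loop (e f : Expr) (p : Cmd)

infixr:40 " ;; " => Cmd.seq

infix:50 " ::= " => Cmd.set

/-- Big-step semantics of commands. Every assignment and every test counts as one step. -/
inductive Cmd.Eval (M B : ℕ) : Cmd → Store → ℕ → Store → Prop
  | skip (s : Store) : Eval M B .skip s 1 s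
  | set (s : Store) (X : Var) (e : Expr) (h : e.Ok M B s) :
      Eval M B (.set X e) s 1 (s.set X (e.eval s))
  | put (s : Store) (A : Arr) (e f : Expr) (he : e.Ok M B s) (hf : f.Ok M B s)
      (hB : e.eval s ≤ B) : Eval M B (.put A e f) s 1 (s.put A (e.eval s) (f.eval s))
  | seq {p q : Cmd} {s s' s'' : Store} {a b : ℕ} (hp : Eval M B p s a s')
      (hq : Eval M B q s' b s'') : Eval M B (.seq p q) s (a + b) s''
  | ite_true {e f : Expr} {p q : Cmd} {s s' : Store} {a : ℕ} (he : e.Ok M B s) (hf : f.Ok M B s)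
      (h : e.eval s < f.eval s) (hp : Eval M B p s a s') : Eval M B (.ite e f p q) s (a + 1) s'
  | ite_false {e f : Expr} {p q : Cmd} {s s' : Store} {a : ℕ} (he : e.Ok M B s) (hf : f.Ok M B s)
      (h : ¬ e.eval s < f.eval s) (hq : Eval M B q s a s') :
      Eval M B (.ite e f p q) s (a + 1) s'
  | loop_true {e f : Expr} {p : Cmd} {s s' s'' : Store} {a b : ℕ} (he : e.Ok M B s)
      (hf : f.Ok M B s) (h : e.eval s < f.eval s) (hp : Eval M B p s a s')
      (hl : Eval M B (.loop e f p) s' b s'') : Eval M B (.loop e f p) s (a + b + 1) s''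
  | loop_false {e f : Expr} {p : Cmd} {s : Store} (he : e.Ok M B s) (hf : f.Ok M B s)
      (h : ¬ e.eval s < f.eval s) : Eval M B (.loop e f p) s 1 s

/-! ### Compilation to RAM programs -/

/-- The register that holds the address of the first array cell. -/
def baseReg : ℕ := 40

/-- The machine state `r` represents the store `s`, whose contents are at most `W`. The registers
below `40` hold the variables, the first `M` memory cells hold the input, and the other memory cells
hold the arrays, interleaved with period `16`. -/
structure Repr (M W : ℕ) (s : Store) (r : State) : Prop where
  var : ∀ X : Var, r.reg X.idx = s.var X
  base : r.reg baseReg = M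
  inp : ∀ i < M, r.mem i = s.inp i
  arr : ∀ (A : Arr) (i : ℕ), r.mem (16 * i + A.idx + M) = s.arr A i
  var_le : ∀ X : Var, s.var X ≤ W
  arr_le : ∀ (A : Arr) (i : ℕ), s.arr A i ≤ W
  inp_le : ∀ i < M, s.inp i ≤ W

/-- The program that replaces the number `i` in register `d` by the address of the cell `i` of the
array `A`. -/
def addrProg (A : Arr) (d : ℕ) : Prog :=
  .seq (.const (d + 1) 16) <| .seq (.arith .mul d d (d + 1)) <|
    .seq (.const (d + 1) A.idx) <| .seq (.arith .add d d (d + 1)) (.arith .add d d baseReg)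

/-- The program that evaluates an expression into register `d`, using registers from `d` on only. -/
def Expr.compile : Expr → ℕ → Prog
  | lit c, d => .const d c
  | var X, d => .seq (.const d 0) (.arith .add d X.idx d)
  | inp e, d => .seq (e.compile d) (.load d d)
  | get A e, d => .seq (e.compile d) (.seq (addrProg A d) (.load d d))
  | op o e f, d => .seq (e.compile d) (.seq (f.compile (d + 1)) (.arith o d d (d + 1)))

/-- The program that evaluates two expressions into the registers `41` and `42`. -/
def compilePair (e f : Expr) : Prog := .seq (e.compile 41) (f.compile 42)

/-- The RAM program for a command. -/
def Cmd.compile : Cmd → Prog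
  | skip => .skip
  | set X e => .seq (e.compile 41) (.seq (.const 42 0) (.arith .add X.idx 41 42))
  | put A e f => .seq (compilePair f e) (.seq (addrProg A 42) (.store 42 41))
  | seq p q => .seq p.compile q.compile
  | ite e f p q => .seq (compilePair e f) (.ite 41 42 p.compile q.compile)
  | loop e f p =>
      .seq (compilePair e f) (.loop 41 42 (.seq p.compile (compilePair e f)))

/-- The factor by which compilation slows down a command. -/
def Cmd.size : Cmd → ℕ
  | skip => 1
  | set _ e => e.cost + 2
  | put _ e f => f.cost + e.cost + 6
  | seq p q => p.size + q.size
  | ite e f p q => e.cost + f.cost + 1 + p.size + q.size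
  | loop e f p => e.cost + f.cost + 1 + p.size

@[simp] theorem State.setReg_reg (r : State) (x y a : ℕ) :
    (r.setReg x a).reg y = if y = x then a else r.reg y := by
  simp [State.setReg, Function.update_apply]

@[simp] theorem State.setMem_mem (r : State) (x y a : ℕ) :
    (r.setMem x a).mem y = if y = x then a else r.mem y := by
  simp [State.setMem, Function.update_apply]

/-- The state `r'` differs from `r` in registers from `d` on only. -/
def SameBelow (d : ℕ) (r r' : State) : Prop :=
  r'.mem = r.mem ∧ ∀ x < d, r'.reg x = r.reg x

theorem SameBelow.refl (d : ℕ) (r : State) : SameBelow d r r := ⟨rfl, fun _ _ => rfl⟩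

theorem SameBelow.trans {d d' : ℕ} {r r' r'' : State} (h : SameBelow d r r')
    (h' : SameBelow d' r' r'') (hd : d ≤ d') : SameBelow d r r'' :=
  ⟨h'.1.trans h.1, fun x hx => (h'.2 x (hx.trans_le hd)).trans (h.2 x hx)⟩

theorem SameBelow.setReg {d : ℕ} {r r' : State} (h : SameBelow d r r') {x : ℕ} (hx : d ≤ x)
    (a : ℕ) : SameBelow d r (r'.setReg x a) :=
  ⟨h.1, fun y hy => by rw [State.setReg_reg, if_neg (by omega), h.2 y hy]⟩

/-- Started in state `r`, the program `P` leaves `a` in register `d` after `τ` steps and changes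
registers from `d` on only. -/
def Computes (W : ℕ) (P : Prog) (d : ℕ) (r : State) (τ a : ℕ) : Prop :=
  ∃ r', Exec W P r τ r' ∧ SameBelow d r r' ∧ r'.reg d = a

section

variable {M B W : ℕ}

namespace Repr

variable {s : Store} {r r' : State}

theorem congr (h : Repr M W s r) {d : ℕ} (hs : SameBelow d r r') (hd : 41 ≤ d) :
    Repr M W s r' where
  var X := by rw [hs.2 _ (by have := X.idx_lt; omega), h.var]
  base := by rw [hs.2 _ (by unfold baseReg; omega), h.base]
  inp i hi := by rw [hs.1, h.inp i hi]
  arr A i := by rw [hs.1, h.arr]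
  var_le := h.var_le
  arr_le := h.arr_le
  inp_le := h.inp_le

theorem set (h : Repr M W s r) (X : Var) {a : ℕ} (ha : a ≤ W) :
    Repr M W (s.set X a) (r.setReg X.idx a) where
  var Y := by
    rw [State.setReg_reg, Store.set_var, h.var]
    exact if_congr Var.idx_injective.eq_iff rfl rfl
  base := by
    have hX := X.idx_lt
    rw [State.setReg_reg, if_neg (by unfold baseReg; omega), h.base]
  inp := h.inp
  arr := h.arr
  var_le Y := by
    rw [Store.set_var]
    split_ifs
    exacts [ha, h.var_le Y]
  arr_le := h.arr_le
  inp_le := h.inp_le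

theorem put (h : Repr M W s r) (A : Arr) (i : ℕ) {a : ℕ} (ha : a ≤ W) :
    Repr M W (s.put A i a) (r.setMem (16 * i + A.idx + M) a) where
  var := h.var
  base := h.base
  inp j hj := by rw [State.setMem_mem, if_neg (by omega), Store.put_inp, h.inp j hj]
  arr A' j := by
    have hA := A.idx_lt
    have hA' := A'.idx_lt
    rw [State.setMem_mem, Store.put_arr, h.arr]
    by_cases hAA : A' = A
    · subst hAA
      rw [if_pos rfl, Function.update_apply]
      exact if_congr (by omega) rfl rfl
    · have hne : A'.idx ≠ A.idx := Arr.idx_injective.ne hAA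
      rw [if_neg (by omega), if_neg hAA]
  var_le := h.var_le
  arr_le A' j := by
    rw [Store.put_arr]
    split_ifs
    · rw [Function.update_apply]
      split_ifs
      exacts [ha, h.arr_le A j]
    · exact h.arr_le A' j
  inp_le := h.inp_le

end Repr

theorem computes_addrProg (hW : 16 * B + 16 + M ≤ W) {r : State} {d i : ℕ} (A : Arr)
    (hd : 41 ≤ d) (hbase : r.reg baseReg = M) (hi : r.reg d = i) (hB : i ≤ B) :
    Computes W (addrProg A d) d r 5 (16 * i + A.idx + M) := by
  have hA := A.idx_lt
  subst hi
  have hne : baseReg ≠ d := by unfold baseReg; omega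
  have hne' : baseReg ≠ d + 1 := by unfold baseReg; omega
  refine ⟨_, .seq (.const _ _ _ (by omega)) <| .seq (.arith _ _ _ _ _ ?_) <|
    .seq (.const _ _ _ (by omega)) <| .seq (.arith _ _ _ _ _ ?_) (.arith _ _ _ _ _ ?_),
    (SameBelow.refl d r).setReg (by omega) _ |>.setReg le_rfl _ |>.setReg (by omega) _
      |>.setReg le_rfl _ |>.setReg le_rfl _, ?_⟩ <;>
  simp [hne, hne', hbase] <;> omega

namespace Expr

variable {s : Store}

theorem eval_le (hW : 16 * B + 16 + M ≤ W) {r : State} (hr : Repr M W s r) :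
    ∀ {e : Expr}, e.Ok M B s → e.eval s ≤ W
  | lit c, h => by simp only [Ok, eval] at h ⊢; omega
  | var X, _ => hr.var_le X
  | inp e, h => hr.inp_le _ h.2
  | get A e, _ => hr.arr_le A _
  | op o e f, h => by have := h.2.2; simp only [eval]; omega

theorem computes_compile (hW : 16 * B + 16 + M ≤ W) (e : Expr) (hok : e.Ok M B s) :
    ∀ {r : State} {d : ℕ}, Repr M W s r → 41 ≤ d →
      Computes W (e.compile d) d r e.cost (e.eval s) := by
  induction e with
  | lit c =>
    intro r d hr _
    exact ⟨_, .const _ _ _ (eval_le hW hr hok), (SameBelow.refl d r).setReg le_rfl _, by simp⟩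
  | var X =>
    intro r d hr hd
    have hX : X.idx ≠ d := by have := X.idx_lt; omega
    refine ⟨_, .seq (.const _ _ _ W.zero_le) (.arith _ _ _ _ _ ?_),
      (SameBelow.refl d r).setReg le_rfl _ |>.setReg le_rfl _, ?_⟩
    · simpa [hX, hr.var] using hr.var_le X
    · simp [hX, hr.var]
  | inp e ih =>
    intro r d hr hd
    obtain ⟨r', he, hs, hval⟩ := ih hok.1 hr hd
    exact ⟨_, .seq he (.load _ _ _), hs.setReg le_rfl _, by simp [hval, hs.1, hr.inp _ hok.2]⟩
  | get A e ih =>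
    intro r d hr hd
    obtain ⟨r', he, hs, hval⟩ := ih hok.1 hr hd
    obtain ⟨r'', ha, hs', haddr⟩ := computes_addrProg hW A hd (hr.congr hs hd).base hval hok.2
    exact ⟨_, .seq he (.seq ha (.load _ _ _)), (hs.trans hs' le_rfl).setReg le_rfl _,
      by simp [haddr, hs'.1, hs.1, hr.arr]⟩
  | op o e f ihe ihf =>
    intro r d hr hd
    obtain ⟨r', he, hs, hval⟩ := ihe hok.1 hr hd
    obtain ⟨r'', hf, hs', hval'⟩ := ihf hok.2.1 (hr.congr hs hd) (Nat.le_succ_of_le hd)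
    have hd' : r''.reg d = e.eval s := (hs'.2 d d.lt_succ_self).trans hval
    have harith := Exec.arith (W := W) r'' o d d (d + 1)
      (by rw [hd', hval']; exact eval_le hW hr hok)
    have hexec := he.seq (hf.seq harith)
    rw [← add_assoc] at hexec
    exact ⟨_, hexec, (hs.trans hs' d.le_succ).setReg le_rfl _, by simp [hd', hval']⟩

end Expr

theorem exec_compilePair (hW : 16 * B + 16 + M ≤ W) {s : Store} {e f : Expr} (he : e.Ok M B s)
    (hf : f.Ok M B s) {r : State} (hr : Repr M W s r) :
    ∃ r', Exec W (compilePair e f) r (e.cost + f.cost) r' ∧ Repr M W s r' ∧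
      r'.reg 41 = e.eval s ∧ r'.reg 42 = f.eval s := by
  obtain ⟨r', hexec, hs, hval⟩ := e.computes_compile hW he hr le_rfl
  have hr' := hr.congr hs le_rfl
  obtain ⟨r'', hexec', hs', hval'⟩ := f.computes_compile hW hf hr' (by omega : 41 ≤ 42)
  exact ⟨r'', .seq hexec hexec', hr'.congr hs' (by omega), by rw [hs'.2 41 (by omega), hval],
    hval'⟩

namespace Cmd

variable {s : Store} {r : State}

theorem exec_compile_set (hW : 16 * B + 16 + M ≤ W) (X : Var) {e : Expr} (he : e.Ok M B s)
    (hr : Repr M W s r) : ∃ r', Exec W (X ::= e).compile r (X ::= e).size r' ∧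
      Repr M W (s.set X (e.eval s)) r' := by
  obtain ⟨r', hexec, hs, hval⟩ := e.computes_compile hW he hr le_rfl
  have hle := Expr.eval_le hW hr he
  have hr' := (hr.congr hs le_rfl).congr ((SameBelow.refl 42 r').setReg le_rfl 0) (by omega)
  refine ⟨_, .seq hexec (.seq (.const _ _ _ W.zero_le) (.arith _ _ _ _ _ ?_)), ?_⟩
  · simpa [hval] using hle
  · simpa [hval] using hr'.set X hle

theorem exec_compile_put (hW : 16 * B + 16 + M ≤ W) (A : Arr) {e f : Expr} (he : e.Ok M B s)
    (hf : f.Ok M B s) (hB : e.eval s ≤ B) (hr : Repr M W s r) :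
    ∃ r', Exec W (put A e f).compile r (put A e f).size r' ∧
      Repr M W (s.put A (e.eval s) (f.eval s)) r' := by
  obtain ⟨r', hpair, hr', hf', he'⟩ := exec_compilePair hW hf he hr
  obtain ⟨r'', haddr, hs, hcell⟩ := computes_addrProg hW A (by omega : 41 ≤ 42) hr'.base he' hB
  refine ⟨_, .seq hpair (.seq haddr (.store _ _ _)), ?_⟩
  rw [hcell, hs.2 41 (by omega), hf']
  exact (hr'.congr hs (by omega)).put A _ (Expr.eval_le hW hr hf)

theorem exec_compile (hW : 16 * B + 16 + M ≤ W) {c : Cmd} {s s' : Store} {τ : ℕ}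
    (h : c.Eval M B s τ s') : ∀ {r : State}, Repr M W s r →
      ∃ τ' r', Exec W c.compile r τ' r' ∧ τ' ≤ c.size * τ ∧ Repr M W s' r' := by
  induction h with
  | skip s => exact fun {r} hr => ⟨_, _, .skip _, by simp [size], hr⟩
  | set s X e he =>
    intro r hr
    obtain ⟨r', hexec, hr'⟩ := exec_compile_set hW X he hr
    exact ⟨_, r', hexec, (mul_one _).ge, hr'⟩
  | put s A e f he hf hB =>
    intro r hr
    obtain ⟨r', hexec, hr'⟩ := exec_compile_put hW A he hf hB hr
    exact ⟨_, r', hexec, (mul_one _).ge, hr'⟩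
  | seq _ _ ihp ihq =>
    intro r hr
    obtain ⟨τp, r', hexec, hτ, hr'⟩ := ihp hr
    obtain ⟨τq, r'', hexec', hτ', hr''⟩ := ihq hr'
    exact ⟨_, r'', .seq hexec hexec', by simp only [size]; nlinarith, hr''⟩
  | ite_true he hf h _ ih =>
    intro r hr
    obtain ⟨r', hpair, hr', he', hf'⟩ := exec_compilePair hW he hf hr
    obtain ⟨τp, r'', hexec, hτ, hr''⟩ := ih hr'
    exact ⟨_, r'', .seq hpair (.ite_true (by rwa [he', hf']) hexec),
      by simp only [size]; nlinarith, hr''⟩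
  | ite_false he hf h _ ih =>
    intro r hr
    obtain ⟨r', hpair, hr', he', hf'⟩ := exec_compilePair hW he hf hr
    obtain ⟨τq, r'', hexec, hτ, hr''⟩ := ih hr'
    exact ⟨_, r'', .seq hpair (.ite_false (by rwa [he', hf']) hexec),
      by simp only [size]; nlinarith, hr''⟩
  | loop_true he hf h _ _ ihp ihl =>
    intro r hr
    obtain ⟨r', hpair, hr', he', hf'⟩ := exec_compilePair hW he hf hr
    obtain ⟨τp, r₁, hexec, hτ, hr₁⟩ := ihp hr'
    obtain ⟨τl, r₂, hloop, hτ', hr₂⟩ := ihl hr₁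
    simp only [compile] at hloop
    cases hloop with
    | seq hpair' hrest =>
      refine ⟨_, r₂, .seq hpair (.loop_true (by rwa [he', hf']) (.seq hexec hpair') hrest), ?_, hr₂⟩
      simp only [size] at hτ' ⊢
      nlinarith
  | loop_false he hf h =>
    intro r hr
    obtain ⟨r', hpair, hr', he', hf'⟩ := exec_compilePair hW he hf hr
    exact ⟨_, r', .seq hpair (.loop_false (by rwa [he', hf'])), by simp only [size]; omega, hr'⟩

end Cmd

end

/-! ### Reasoning about commands -/

/-- The variables that a command may change. -/
def Cmd.vars : Cmd → List Var
  | skip => []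
  | set X _ => [X]
  | put _ _ _ => []
  | seq p q => p.vars ++ q.vars
  | ite _ _ p q => p.vars ++ q.vars
  | loop _ _ p => p.vars

/-- The arrays that a command may change. -/
def Cmd.arrs : Cmd → List Arr
  | skip => []
  | set _ _ => []
  | put A _ _ => [A]
  | seq p q => p.arrs ++ q.arrs
  | ite _ _ p q => p.arrs ++ q.arrs
  | loop _ _ p => p.arrs

/-- The store `s'` arises from `s` by changing only what the command `c` may change. -/
structure Frame (c : Cmd) (s s' : Store) : Prop where
  var : ∀ X, X ∉ c.vars → s'.var X = s.var X
  arr : ∀ A, A ∉ c.arrs → s'.arr A = s.arr A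
  inp : s'.inp = s.inp

namespace Frame

variable {c c' : Cmd} {s s' s'' : Store}

theorem refl (c : Cmd) (s : Store) : Frame c s s := ⟨fun _ _ => rfl, fun _ _ => rfl, rfl⟩

theorem trans (h : Frame c s s') (h' : Frame c s' s'') : Frame c s s'' :=
  ⟨fun X hX => (h'.var X hX).trans (h.var X hX), fun A hA => (h'.arr A hA).trans (h.arr A hA),
    h'.inp.trans h.inp⟩

theorem mono (h : Frame c s s') (hv : c.vars ⊆ c'.vars) (ha : c.arrs ⊆ c'.arrs) :
    Frame c' s s' :=
  ⟨fun X hX => h.var X fun hX' => hX (hv hX'), fun A hA => h.arr A fun hA' => hA (ha hA'), h.inp⟩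

theorem set (s : Store) {X : Var} (hX : X ∈ c.vars) (a : ℕ) : Frame c s (s.set X a) :=
  ⟨fun Y hY => by rw [Store.set_var, if_neg (by rintro rfl; exact hY hX)], fun _ _ => rfl, rfl⟩

theorem put (s : Store) {A : Arr} (hA : A ∈ c.arrs) (i a : ℕ) : Frame c s (s.put A i a) :=
  ⟨fun _ _ => rfl, fun A' hA' => by rw [Store.put_arr, if_neg (by rintro rfl; exact hA' hA)], rfl⟩

end Frame

section

variable {M B : ℕ}

theorem Cmd.Eval.frame {c : Cmd} {s s' : Store} {τ : ℕ} (h : c.Eval M B s τ s') :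
    Frame c s s' := by
  induction h with
  | skip s => exact .refl _ _
  | set s X e => exact .set _ (List.mem_singleton_self _) _
  | put s A e f => exact .put _ (List.mem_singleton_self _) _ _
  | seq _ _ ihp ihq =>
    exact (ihp.mono (List.subset_append_left ..) (List.subset_append_left ..)).trans
      (ihq.mono (List.subset_append_right ..) (List.subset_append_right ..))
  | ite_true _ _ _ _ ih => exact ih.mono (List.subset_append_left ..) (List.subset_append_left ..)
  | ite_false _ _ _ _ ih =>
    exact ih.mono (List.subset_append_right ..) (List.subset_append_right ..)
  | loop_true _ _ _ _ _ ihp ihl => exact .trans ⟨ihp.var, ihp.arr, ihp.inp⟩ ihl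
  | loop_false => exact .refl _ _

/-- Started in `s`, the command `c` halts after some number `τ` of steps in some state `s'` with
`Q τ s'`. -/
def Runs (M B : ℕ) (c : Cmd) (s : Store) (Q : ℕ → Store → Prop) : Prop :=
  ∃ τ s', c.Eval M B s τ s' ∧ Q τ s'

theorem Runs.mono {c : Cmd} {s : Store} {P Q : ℕ → Store → Prop} (h : Runs M B c s P)
    (hPQ : ∀ τ s', Frame c s s' → P τ s' → Q τ s') : Runs M B c s Q := by
  obtain ⟨τ, s', hc, hP⟩ := h
  exact ⟨τ, s', hc, hPQ τ s' hc.frame hP⟩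

section

variable {s : Store} {Q : ℕ → Store → Prop} {e f : Expr} {p q : Cmd}

@[simp] theorem runs_skip : Runs M B .skip s Q ↔ Q 1 s := by
  constructor
  · rintro ⟨_, _, ⟨⟩, hQ⟩
    exact hQ
  · exact fun hQ => ⟨_, _, .skip _, hQ⟩

@[simp] theorem runs_set {X : Var} :
    Runs M B (X ::= e) s Q ↔ e.Ok M B s ∧ Q 1 (s.set X (e.eval s)) := by
  constructor
  · rintro ⟨_, _, hc, hQ⟩
    cases hc with
    | set _ _ _ he => exact ⟨he, hQ⟩
  · rintro ⟨he, hQ⟩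
    exact ⟨_, _, .set _ _ _ he, hQ⟩

@[simp] theorem runs_put {A : Arr} :
    Runs M B (.put A e f) s Q ↔
      (e.Ok M B s ∧ f.Ok M B s ∧ e.eval s ≤ B) ∧ Q 1 (s.put A (e.eval s) (f.eval s)) := by
  constructor
  · rintro ⟨_, _, hc, hQ⟩
    cases hc with
    | put _ _ _ _ he hf hB => exact ⟨⟨he, hf, hB⟩, hQ⟩
  · rintro ⟨⟨he, hf, hB⟩, hQ⟩
    exact ⟨_, _, .put _ _ _ _ he hf hB, hQ⟩

@[simp] theorem runs_seq :
    Runs M B (p ;; q) s Q ↔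
      Runs M B p s fun τ s' => Runs M B q s' fun τ' s'' => Q (τ + τ') s'' := by
  constructor
  · rintro ⟨_, _, hc, hQ⟩
    cases hc with
    | seq hp hq => exact ⟨_, _, hp, _, _, hq, hQ⟩
  · rintro ⟨_, _, hp, _, _, hq, hQ⟩
    exact ⟨_, _, .seq hp hq, hQ⟩

@[simp] theorem runs_ite :
    Runs M B (.ite e f p q) s Q ↔ (e.Ok M B s ∧ f.Ok M B s) ∧
      (e.eval s < f.eval s → Runs M B p s fun τ s' => Q (τ + 1) s') ∧
      (¬ e.eval s < f.eval s → Runs M B q s fun τ s' => Q (τ + 1) s') := by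
  constructor
  · rintro ⟨_, _, hc, hQ⟩
    cases hc with
    | ite_true he hf hlt hp => exact ⟨⟨he, hf⟩, fun _ => ⟨_, _, hp, hQ⟩, fun hge => absurd hlt hge⟩
    | ite_false he hf hge hq => exact ⟨⟨he, hf⟩, fun hlt => absurd hlt hge, fun _ => ⟨_, _, hq, hQ⟩⟩
  · rintro ⟨⟨he, hf⟩, hp, hq⟩
    by_cases hlt : e.eval s < f.eval s
    · obtain ⟨_, _, hc, hQ⟩ := hp hlt
      exact ⟨_, _, .ite_true he hf hlt hc, hQ⟩
    · obtain ⟨_, _, hc, hQ⟩ := hq hlt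
      exact ⟨_, _, .ite_false he hf hlt hc, hQ⟩

-- In the invariant `I N`, the number `N` pays for the remaining rounds.
theorem Runs.loop_of_budget (I : ℕ → Store → Prop) {N : ℕ} (hI₀ : I N s)
    (hok : ∀ N' s', I N' s' → Frame p s s' → e.Ok M B s' ∧ f.Ok M B s')
    (hstep : ∀ N' s', I N' s' → Frame p s s' → e.eval s' < f.eval s' →
      Runs M B p s' fun τ s'' => ∃ N'', I N'' s'' ∧ τ + 1 + N'' ≤ N') :
    Runs M B (.loop e f p) s fun τ s' =>
      ∃ N', I N' s' ∧ ¬ e.eval s' < f.eval s' ∧ τ + N' ≤ N + 1 := by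
  suffices h : ∀ N' s', I N' s' → Frame p s s' → ∃ τ s'',
      (Cmd.loop e f p).Eval M B s' τ s'' ∧
        ∃ N'', I N'' s'' ∧ ¬ e.eval s'' < f.eval s'' ∧ τ + N'' ≤ N' + 1 from
    h N s hI₀ (.refl _ _)
  intro N'
  induction N' using Nat.strong_induction_on with
  | _ N' ih =>
    intro s' hI hF
    obtain ⟨he, hf⟩ := hok N' s' hI hF
    by_cases hlt : e.eval s' < f.eval s'
    · obtain ⟨τ, s₁, hp, N₁, hI₁, hN₁⟩ := hstep N' s' hI hF hlt
      obtain ⟨τ', s₂, hl, N₂, hI₂, hge, hN₂⟩ := ih N₁ (by omega) s₁ hI₁ (hF.trans hp.frame)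
      exact ⟨_, _, .loop_true he hf hlt hp hl, N₂, hI₂, hge, by omega⟩
    · exact ⟨_, _, .loop_false he hf hlt, N', hI, hlt, by omega⟩

-- `I` is an invariant, and the potential `Φ` pays for every round.
theorem Runs.loop (I : Store → Prop) (Φ : Store → ℕ) (hI₀ : I s)
    (hok : ∀ s', I s' → Frame p s s' → e.Ok M B s' ∧ f.Ok M B s')
    (hstep : ∀ s', I s' → Frame p s s' → e.eval s' < f.eval s' →
      Runs M B p s' fun τ s'' => I s'' ∧ τ + 1 + Φ s'' ≤ Φ s') :
    Runs M B (.loop e f p) s fun τ s' =>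
      I s' ∧ ¬ e.eval s' < f.eval s' ∧ τ + Φ s' ≤ Φ s + 1 := by
  refine (Runs.loop_of_budget (fun N s' => I s' ∧ Φ s' = N) ⟨hI₀, rfl⟩
    (fun _ s' h => hok s' h.1) ?_).mono ?_
  · rintro _ s' ⟨hI, rfl⟩ hF hlt
    refine (hstep s' hI hF hlt).mono ?_
    rintro τ s'' - ⟨hI', hτ⟩
    exact ⟨_, ⟨hI', rfl⟩, hτ⟩
  · rintro τ s' - ⟨_, ⟨hI, rfl⟩, hge, hτ⟩
    exact ⟨hI, hge, hτ⟩

end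

/-- The command `for X in 0, …, Y - 1 do p`, where `p` must not change `X` and `Y`. -/
def Cmd.for (X Y : Var) (p : Cmd) : Cmd := X ::= 0 ;; .loop X Y (p ;; X ::= X + 1)

section

variable {X Y : Var} {p : Cmd} {s : Store}

theorem Frame.for_init : Frame (.for X Y p) s (s.set X 0) := .set s (by simp [Cmd.for, Cmd.vars]) 0

-- A round takes at most `T` steps that are not paid for by the potential `Φ`.
theorem Runs.for_potential (I : ℕ → Store → Prop) (Φ : Store → ℕ) (T : ℕ)
    (hX : X ∉ p.vars) (hY : Y ∉ p.vars) (hYX : Y ≠ X) (hYB : s.var Y ≤ B) (hB : 1 ≤ B)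
    (hI₀ : I 0 (s.set X 0))
    (hstep : ∀ j s', j < s.var Y → s'.var X = j → Frame (.for X Y p) s s' → I j s' →
      Runs M B p s' fun τ s'' => τ + Φ (s''.set X (j + 1)) ≤ T + Φ s' ∧
        I (j + 1) (s''.set X (j + 1))) :
    Runs M B (.for X Y p) s fun τ s' => I (s.var Y) s' ∧
      τ + Φ s' ≤ (T + 2) * s.var Y + 2 + Φ (s.set X 0) := by
  rw [Cmd.for, runs_seq, runs_set]
  refine ⟨B.zero_le, ?_⟩
  refine (Runs.loop (fun s' => s'.var X ≤ s.var Y ∧ I (s'.var X) s' ∧ s'.var Y = s.var Y)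
    (fun s' => (T + 2) * (s.var Y - s'.var X) + Φ s') ?_ ?_ ?_).mono ?_
  · exact ⟨by simp, by simpa using hI₀, by simp [hYX]⟩
  · exact fun _ _ _ => ⟨trivial, trivial⟩
  · rintro s' ⟨-, hI, hYs⟩ hF hlt
    simp only [Expr.eval, hYs] at hlt
    have hFs := Frame.for_init.trans (hF.mono (c' := .for X Y p)
      (by simp [Cmd.for, Cmd.vars]) (by simp [Cmd.for, Cmd.arrs]))
    rw [runs_seq]
    refine (hstep _ s' hlt rfl hFs hI).mono ?_
    rintro τ s'' hF' ⟨hτ, hI'⟩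
    have hX' := hF'.var X hX
    have hY' := hF'.var Y hY
    rw [runs_set]
    simp only [Expr.Ok, Expr.eval, ArithOp.eval, hX', Store.set_var, if_true, if_neg hYX, hY']
    refine ⟨⟨trivial, hB, by omega⟩, ⟨by omega, hI', hYs⟩, ?_⟩
    have hsub : s.var Y - s'.var X = s.var Y - (s'.var X + 1) + 1 := by omega
    rw [hsub]
    nlinarith
  · rintro τ s' - ⟨⟨hle, hI, hYs⟩, hge, hτ⟩
    simp only [Expr.eval, hYs] at hge
    have hXY : s'.var X = s.var Y := by omega
    refine ⟨hXY ▸ hI, ?_⟩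
    simp only [Store.set_var, if_true, Expr.eval, Nat.sub_zero] at hτ
    omega

theorem Runs.for (I : ℕ → Store → Prop) (T : ℕ)
    (hX : X ∉ p.vars) (hY : Y ∉ p.vars) (hYX : Y ≠ X) (hYB : s.var Y ≤ B) (hB : 1 ≤ B)
    (hI₀ : I 0 (s.set X 0))
    (hstep : ∀ j s', j < s.var Y → s'.var X = j → Frame (.for X Y p) s s' → I j s' →
      Runs M B p s' fun τ s'' => τ ≤ T ∧ I (j + 1) (s''.set X (j + 1))) :
    Runs M B (.for X Y p) s fun τ s' => I (s.var Y) s' ∧ τ ≤ (T + 2) * s.var Y + 2 :=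
  Runs.for_potential I (fun _ => 0) T hX hY hYX hYB hB hI₀ hstep

end

end

open WellConnectedClub.Expr (inp get)

/-- The expression `|X - Y|`, which serves as a test for `X ≠ Y`. -/
def Expr.dist (X Y : Var) : Expr := (X - Y) + (Y - X)

section

variable {M B : ℕ} {s : Store} {X Y : Var}

theorem Expr.ok_dist (hX : s.var X ≤ B) (hY : s.var Y ≤ B) : (dist X Y).Ok M B s :=
  ⟨⟨trivial, trivial, tsub_le_self.trans hX⟩, ⟨trivial, trivial, tsub_le_self.trans hY⟩,
    show (s.var X - s.var Y) + (s.var Y - s.var X) ≤ B by omega⟩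

@[simp] theorem Expr.eval_dist_pos : 0 < (dist X Y).eval s ↔ s.var X ≠ s.var Y := by
  change 0 < (s.var X - s.var Y) + (s.var Y - s.var X) ↔ _
  omega

end

/-! ### Adjacency lists -/

/-- The last index below `i` with value `y` under `σ`, plus one, and `0` if there is none. -/
def lastArc (σ : ℕ → ℕ) : ℕ → ℕ → ℕ
  | 0, _ => 0
  | i + 1, y => if σ i = y then i + 1 else lastArc σ i y

theorem lastArc_le (σ : ℕ → ℕ) (i y : ℕ) : lastArc σ i y ≤ i := by
  induction i with
  | zero => exact le_rfl
  | succ i ih =>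
    simp only [lastArc]
    split_ifs <;> omega

theorem ne_of_lastArc_le {σ : ℕ → ℕ} {i y c : ℕ} (h : lastArc σ i y ≤ c) (hc : c < i) :
    σ c ≠ y := by
  induction i with
  | zero => omega
  | succ i ih =>
    simp only [lastArc] at h
    split_ifs at h with hi
    · omega
    · rcases Nat.lt_succ_iff_lt_or_eq.1 hc with hc | rfl
      exacts [ih h hc, hi]

theorem eq_of_lastArc_eq_succ {σ : ℕ → ℕ} {i y c : ℕ} (h : lastArc σ i y = c + 1) : σ c = y := by
  induction i with
  | zero => simp [lastArc] at h
  | succ i ih =>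
    simp only [lastArc] at h
    split_ifs at h with hi
    · obtain rfl : i = c := by omega
      exact hi
    · exact ih h

/-- The number of indices below `i` with value `y` under `σ`. -/
def outArcs (σ : ℕ → ℕ) (i y : ℕ) : ℕ := #{c ∈ range i | σ c = y}

theorem outArcs_mono (σ : ℕ → ℕ) {i j : ℕ} (h : i ≤ j) (y : ℕ) : outArcs σ i y ≤ outArcs σ j y :=
  card_le_card (filter_subset_filter _ (range_mono h))

theorem outArcs_succ (σ : ℕ → ℕ) (i : ℕ) : outArcs σ (i + 1) (σ i) = outArcs σ i (σ i) + 1 := by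
  rw [outArcs, range_add_one, filter_insert, if_pos rfl, card_insert_of_notMem (by simp), outArcs]

theorem outArcs_lastArc_lt {σ : ℕ → ℕ} {c y : ℕ} (h : σ c = y) :
    outArcs σ (lastArc σ c y) y < outArcs σ (c + 1) y := by
  rw [← h, outArcs_succ]
  exact Nat.lt_succ_of_le (outArcs_mono _ (lastArc_le ..) _)

theorem sum_outArcs {σ : ℕ → ℕ} {n M : ℕ} (h : ∀ c < M, σ c < n) :
    ∑ y ∈ range n, outArcs σ M y = M := by
  have hfib := card_eq_sum_card_fiberwise (s := range M) (t := range n) (f := σ)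
    fun c hc => by simpa using h c (by simpa using hc)
  rw [card_range] at hfib
  exact hfib.symm

/-- The arrays contain the linked lists of the arcs with numbers below `i` and the same tail, where
`σ` and `τ` are the tails and heads of the arcs. Pointers are arc numbers plus one. -/
structure ArcLists (σ τ : ℕ → ℕ) (i : ℕ) (s : Store) : Prop where
  src : ∀ c < i, s.arr .src c = σ c
  tgt : ∀ c < i, s.arr .tgt c = τ c
  next : ∀ c < i, s.arr .next c = lastArc σ c (σ c)
  first : ∀ y, s.arr .first y = lastArc σ i y

theorem ArcLists.congr {σ τ : ℕ → ℕ} {i : ℕ} {s s' : Store} (h : ArcLists σ τ i s)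
    (ha : ∀ A ∈ [Arr.src, .tgt, .next, .first], s'.arr A = s.arr A) : ArcLists σ τ i s' where
  src := by rw [ha _ (by decide)]; exact h.src
  tgt := by rw [ha _ (by decide)]; exact h.tgt
  next := by rw [ha _ (by decide)]; exact h.next
  first := by rw [ha _ (by decide)]; exact h.first

/-- The array `inS` is the indicator function of `F`. -/
def Holds (F : Finset ℕ) (s : Store) : Prop := ∀ x, s.arr .inS x = if x ∈ F then 1 else 0

namespace Holds

variable {F : Finset ℕ} {s s' : Store}

theorem congr (h : Holds F s) (ha : s'.arr .inS = s.arr .inS) : Holds F s' := fun x => by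
  rw [ha, h x]

theorem insert (h : Holds F s) {a : ℕ} (ha : s'.arr .inS = Function.update (s.arr .inS) a 1) :
    Holds (insert a F) s' := fun x => by
  rw [ha, Function.update_apply, h x]
  by_cases hx : x = a <;> simp [hx]

theorem erase (h : Holds F s) {a : ℕ} (ha : s'.arr .inS = Function.update (s.arr .inS) a 0) :
    Holds (F.erase a) s' := fun x => by
  rw [ha, Function.update_apply, h x]
  by_cases hx : x = a <;> simp [hx]

theorem pos_iff (h : Holds F s) {x : ℕ} : 0 < s.arr .inS x ↔ x ∈ F := by
  rw [h x]
  split_ifs with hx <;> simp [hx]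

end Holds

/-- Append the arc with number `c` from `a` to `b` to the lists. -/
def linkArc : Cmd :=
  .put .src Var.c Var.a ;; .put .tgt Var.c Var.b ;; .put .next Var.c (get .first Var.a) ;;
  .put .first Var.a (Var.c + 1)

/-- Add the vertex `a` to the set in the array `inS`, and keep track of the size of this set. -/
def addVertex : Cmd :=
  .ite 0 (get .inS Var.a) .skip (.size ::= Var.size + 1 ;; .put .inS Var.a 1)

/-- Handle the arc with number `c` from `a` to `b`. -/
def pushArc : Cmd := linkArc ;; addVertex

/-- Build the adjacency lists, and put the vertices that are not isolated into the array `inS`. -/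
def readEdges : Cmd :=
  .for .e .m
    (.c ::= 2 * Var.e ;; .a ::= inp Var.c ;; .b ::= inp (Var.c + 1) ;; pushArc ;;
      .x ::= Var.a ;; .a ::= Var.b ;; .b ::= Var.x ;; .c ::= Var.c + 1 ;; pushArc)

section

variable {M B : ℕ} {s : Store}

theorem runs_linkArc {σ τ : ℕ → ℕ} {i : ℕ} (h : ArcLists σ τ i s) (hc : s.var .c = i)
    (ha : s.var .a = σ i) (hb : s.var .b = τ i) (hσ : σ i ≤ B) (hi : i + 1 ≤ B) :
    Runs M B linkArc s fun T s' => T = 4 ∧ ArcLists σ τ (i + 1) s' := by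
  have hi' : i ≤ B := by omega
  have hB : 1 ≤ B := by omega
  simp only [linkArc, runs_seq, runs_put]
  simp only [Expr.Ok, Expr.eval, hc, hi', and_self, ha, Store.put_var, hb, hσ, hB, ArithOp.eval,
    Store.put_arr, reduceCtorEq, ↓reduceIte, hi, true_and]
  constructor
  · intro c hc
    by_cases hci : c = i
    · simp [hci]
    · simp [hci, h.src c (by omega)]
  · intro c hc
    by_cases hci : c = i
    · simp [hci]
    · simp [hci, h.tgt c (by omega)]
  · intro c hc
    by_cases hci : c = i
    · simp [hci, h.first]
    · simp [hci, h.next c (by omega)]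
  · intro y
    by_cases hy : y = σ i
    · simp [hy, lastArc]
    · simp [hy, Ne.symm hy, lastArc, h.first]

theorem runs_addVertex {F : Finset ℕ} (h : Holds F s) (hsize : s.var .size = #F)
    (hF : #F + 1 ≤ B) (ha : s.var .a ≤ B) :
    Runs M B addVertex s fun T s' => T ≤ 3 ∧ Holds (insert (s.var .a) F) s' ∧
      s'.var .size = #(insert (s.var .a) F) := by
  have hB : 1 ≤ B := by omega
  simp only [addVertex, runs_ite, runs_seq, runs_put, runs_set, runs_skip]
  simp only [Expr.Ok, zero_le, Expr.eval, ha, and_self, h.pos_iff, Nat.reduceAdd, Nat.reduceLeDiff,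
    hsize, true_and, hB, ArithOp.eval, hF, Store.set_var, reduceCtorEq, ↓reduceIte, Std.le_refl,
    Store.put_var]
  constructor
  · intro hmem
    rw [insert_eq_of_mem hmem]
    exact ⟨h, rfl⟩
  · intro hmem
    exact ⟨h.insert (by simp), (card_insert_of_notMem hmem).symm⟩

/-- The other endpoint of the edge of an arc, where `σ` lists the endpoints of the edges. -/
def arcHead (σ : ℕ → ℕ) (c : ℕ) : ℕ := if c % 2 = 0 then σ (c + 1) else σ (c - 1)

theorem arcHead_two_mul (σ : ℕ → ℕ) (j : ℕ) : arcHead σ (2 * j) = σ (2 * j + 1) := by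
  simp [arcHead]

theorem arcHead_two_mul_add_one (σ : ℕ → ℕ) (j : ℕ) :
    arcHead σ (2 * j + 1) = σ (2 * j) := by
  rw [arcHead, if_neg (by omega), Nat.add_sub_cancel]

/-- The data structures after the arcs with numbers below `i` have been read. -/
structure ArcsRead (σ τ : ℕ → ℕ) (i : ℕ) (s : Store) : Prop where
  lists : ArcLists σ τ i s
  holds : Holds ((range i).image σ) s
  size : s.var .size = #((range i).image σ)

theorem ArcsRead.congr {σ τ : ℕ → ℕ} {i : ℕ} {s' : Store} (h : ArcsRead σ τ i s)
    (ha : s'.arr = s.arr) (hn : s'.var .size = s.var .size) : ArcsRead σ τ i s' :=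
  ⟨h.lists.congr fun _ _ => by rw [ha], h.holds.congr (by rw [ha]), hn.trans h.size⟩

theorem runs_pushArc {σ τ : ℕ → ℕ} {i : ℕ} (h : ArcsRead σ τ i s) (hc : s.var .c = i)
    (ha : s.var .a = σ i) (hb : s.var .b = τ i) (hσ : σ i ≤ B) (hi : i + 1 ≤ B) :
    Runs M B pushArc s fun T s' => T ≤ 7 ∧ ArcsRead σ τ (i + 1) s' := by
  have hcard : #((range i).image σ) ≤ i := by
    simpa using card_image_le (s := range i) (f := σ)
  rw [pushArc, runs_seq]
  refine (runs_linkArc h.lists hc ha hb hσ hi).mono ?_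
  rintro T₁ s₁ hF₁ ⟨rfl, hlists⟩
  have ha₁ : s₁.var .a = σ i := (hF₁.var .a (by decide)).trans ha
  refine (runs_addVertex (h.holds.congr (hF₁.arr .inS (by decide)))
    ((hF₁.var .size (by decide)).trans h.size) (by omega) (ha₁ ▸ hσ)).mono ?_
  rintro T₂ s₂ hF₂ ⟨hT₂, hholds, hsize⟩
  rw [ha₁, ← image_insert, ← range_add_one] at hholds hsize
  refine ⟨by omega, hlists.congr fun A hA => hF₂.arr A ?_, hholds, hsize⟩
  fin_cases hA <;> decide

theorem runs_readEdges (hM : M = 2 * s.var .m) (hinp : ∀ c < M, s.inp c ≤ B)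
    (hB : M + 1 ≤ B) (ha : ∀ A i, s.arr A i = 0) (hsize : s.var .size = 0) :
    Runs M B readEdges s fun T s' =>
      T ≤ 30 * M + 2 ∧ ArcsRead s.inp (arcHead s.inp) M s' := by
  refine (Runs.for (fun j s' => ArcsRead s.inp (arcHead s.inp) (2 * j) s') 40 (by decide)
    (by decide) (by decide) (by omega) (by omega) ?_ ?_).mono ?_
  · exact ⟨⟨by simp, by simp, by simp, by simp [ha, lastArc]⟩, by simp [Holds, ha],
      by simp [hsize]⟩
  · intro j s' hj hje hF hI
    have hread := hinp (2 * j) (by omega)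
    have hread' := hinp (2 * j + 1) (by omega)
    simp only [runs_seq, runs_set, Expr.Ok, ArithOp.eval, Expr.eval, Order.add_one_le_iff, true_and,
      Store.set_var, reduceCtorEq, ↓reduceIte, Store.set_inp, hje, hF.inp]
    refine ⟨⟨by omega, by omega⟩, by omega, ⟨⟨by omega, by omega⟩, by omega⟩, ?_⟩
    refine Runs.mono (runs_pushArc (hI.congr rfl (by simp)) (by simp) (by simp)
      (by simp [arcHead_two_mul]) hread (by omega)) ?_
    rintro T₁ s₁ hF₁ ⟨hT₁, hI₁⟩
    have ha₁ := hF₁.var .a (by decide)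
    have hb₁ := hF₁.var .b (by decide)
    have hc₁ := hF₁.var .c (by decide)
    simp only [hc₁, Store.set_var, reduceCtorEq, ↓reduceIte, ha₁, hb₁]
    refine ⟨⟨by omega, by omega⟩, ?_⟩
    refine Runs.mono (runs_pushArc (hI₁.congr rfl (by simp)) (by simp) (by simp)
      (by simp [arcHead_two_mul_add_one]) hread' (by omega)) ?_
    rintro T₂ s₂ _ ⟨hT₂, hI₂⟩
    exact ⟨by omega, hI₂.congr rfl (by simp)⟩
  · rintro T s' _ ⟨hI, hT⟩
    rw [hM]
    exact ⟨by omega, hI⟩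

end

/-- A graph given by the tails and heads of its arcs, where every edge consists of two arcs, and
the parameters of the search. The numbers in the programs are at most `B`. -/
structure Inst where
  G : SimpleGraph ℕ
  n : ℕ
  M : ℕ
  B : ℕ
  κ : Criterion
  tail : ℕ → ℕ
  head : ℕ → ℕ
  tail_lt : ∀ c < M, tail c < n
  head_lt : ∀ c < M, head c < n
  adj : ∀ c < M, G.Adj (tail c) (head c)
  exists_arc : ∀ x y, G.Adj x y → ∃ c < M, tail c = x ∧ head c = y
  arc_inj : ∀ c < M, ∀ d < M, tail c = tail d → head c = head d → c = d
  le_B : n + M + κ.edgeWeight + κ.cut + 2 ≤ B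

/-- The store contains the parameters and the adjacency lists of the instance `P`. -/
structure Ready (P : Inst) (s : Store) : Prop where
  n : s.var .n = P.n
  arcs : s.var .arcs = P.M
  weight : s.var .weight = P.κ.edgeWeight
  threshold : s.var .threshold = P.κ.threshold
  cut : s.var .cut = P.κ.cut
  lists : ArcLists P.tail P.head P.M s

namespace Ready

variable {P : Inst} {s s' : Store}

theorem congr (h : Ready P s)
    (hv : ∀ X ∈ [Var.n, .arcs, .weight, .threshold, .cut], s'.var X = s.var X)
    (ha : ∀ A ∈ [Arr.src, .tgt, .next, .first], s'.arr A = s.arr A) : Ready P s' where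
  n := by rw [hv _ (by decide), h.n]
  arcs := by rw [hv _ (by decide), h.arcs]
  weight := by rw [hv _ (by decide), h.weight]
  threshold := by rw [hv _ (by decide), h.threshold]
  cut := by rw [hv _ (by decide), h.cut]
  lists := h.lists.congr ha

theorem frame {c : Cmd} (h : Ready P s) (hF : Frame c s s')
    (hv : ∀ X ∈ [Var.n, .arcs, .weight, .threshold, .cut], X ∉ c.vars)
    (ha : ∀ A ∈ [Arr.src, .tgt, .next, .first], A ∉ c.arrs) : Ready P s' :=
  h.congr (fun X hX => hF.var X (hv X hX)) fun A hA => hF.arr A (ha A hA)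

end Ready

/-- The store is ready for the instance `P`, and the set `F` is stored in the array `inS`. -/
structure Loaded (P : Inst) (F : Finset ℕ) (s : Store) : Prop extends Ready P s where
  subset : F ⊆ range P.n
  holds : Holds F s

namespace Loaded

variable {P : Inst} {F : Finset ℕ} {s s' : Store}

theorem lt {x : ℕ} (h : Loaded P F s) (hx : x ∈ F) : x < P.n := mem_range.1 (h.subset hx)

theorem congr (h : Loaded P F s)
    (hv : ∀ X ∈ [Var.n, .arcs, .weight, .threshold, .cut], s'.var X = s.var X)
    (ha : ∀ A ∈ [Arr.src, .tgt, .next, .first, .inS], s'.arr A = s.arr A) : Loaded P F s' := by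
  refine ⟨h.toReady.congr hv fun A hA => ha A ?_, h.subset, h.holds.congr (ha _ (by decide))⟩
  fin_cases hA <;> decide

theorem frame {c : Cmd} (h : Loaded P F s) (hF : Frame c s s')
    (hv : ∀ X ∈ [Var.n, .arcs, .weight, .threshold, .cut], X ∉ c.vars)
    (ha : ∀ A ∈ [Arr.src, .tgt, .next, .first, .inS], A ∉ c.arrs) : Loaded P F s' :=
  h.congr (fun X hX => hF.var X (hv X hX)) fun A hA => hF.arr A (ha A hA)

end Loaded

/-- The store asks for a separation of the distinct nonadjacent vertices `u` and `v` of `F`. -/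
structure Query (P : Inst) (F : Finset ℕ) (u v : ℕ) (s : Store) : Prop extends Loaded P F s where
  source : s.var .u = u
  target : s.var .v = v
  source_mem : u ∈ F
  target_mem : v ∈ F
  ne : u ≠ v
  not_adj : ¬ P.G.Adj u v

namespace Query

variable {P : Inst} {F : Finset ℕ} {u v : ℕ} {s s' : Store}

theorem congr (h : Query P F u v s)
    (hv : ∀ X ∈ [Var.n, .arcs, .weight, .threshold, .cut, .u, .v], s'.var X = s.var X)
    (ha : ∀ A ∈ [Arr.src, .tgt, .next, .first, .inS], s'.arr A = s.arr A) :
    Query P F u v s' := by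
  refine ⟨h.toLoaded.congr (fun X hX => hv X ?_) ha, (hv .u (by decide)).trans h.source,
    (hv .v (by decide)).trans h.target, h.source_mem, h.target_mem, h.ne, h.not_adj⟩
  fin_cases hX <;> decide

theorem frame {c : Cmd} (h : Query P F u v s) (hF : Frame c s s')
    (hv : ∀ X ∈ [Var.n, .arcs, .weight, .threshold, .cut, .u, .v], X ∉ c.vars)
    (ha : ∀ A ∈ [Arr.src, .tgt, .next, .first, .inS], A ∉ c.arrs) : Query P F u v s' :=
  h.congr (fun X hX => hF.var X (hv X hX)) fun A hA => hF.arr A (ha A hA)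

end Query

/-! ### Searching for an augmenting path -/

/-- The first `l` entries of `q` form the queue of a search from `u`. Every later entry `z` is the
predecessor `p x` of the vertex `x = via z`, and was found at its parent, an earlier entry which
is `x` itself or adjacent to `x`. -/
structure SearchTree (G : SimpleGraph ℕ) (E : Finset ℕ) (u : ℕ) (p q : ℕ → ℕ) (l : ℕ)
    (parent via : ℕ → ℕ) : Prop where
  pos : 0 < l
  root : q 0 = u
  inj : ∀ i < l, ∀ j < l, q i = q j → i = j
  mem : ∀ i < l, q i ∈ E
  via_mem : ∀ i < l, 0 < i → via (q i) ∈ E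
  pred_via : ∀ i < l, 0 < i → p (via (q i)) = q i
  parent : ∀ i < l, 0 < i → ∃ j < i, parent (q i) = q j ∧
    (q j = via (q i) ∨ G.Adj (q j) (via (q i)))

namespace SearchTree

variable {G : SimpleGraph ℕ} {E : Finset ℕ} {u l : ℕ} {p q parent via : ℕ → ℕ}

theorem single (hu : u ∈ E) (hq : q 0 = u) : SearchTree G E u p q 1 parent via where
  pos := one_pos
  root := hq
  inj := by omega
  mem i hi := by rwa [Nat.lt_one_iff.1 hi, hq]
  via_mem := by omega
  pred_via := by omega
  parent := by omega

theorem notMem_image (h : SearchTree G E u p q l parent via) {i : ℕ} (hi : i < l) :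
    q i ∉ (range i).image q := by
  rw [mem_image]
  rintro ⟨j, hj, heq⟩
  rw [mem_range] at hj
  exact hj.ne (h.inj j (hj.trans hi) i hi heq)

theorem push {j x : ℕ} (h : SearchTree G E u p q l parent via) (hx : x ∈ E) (hpx : p x ∈ E)
    (hnew : ∀ i < l, q i ≠ p x) (hj : j < l) (hjx : q j = x ∨ G.Adj (q j) x) :
    SearchTree G E u p (Function.update q l (p x)) (l + 1)
      (Function.update parent (p x) (q j)) (Function.update via (p x) x) := by
  have hold : ∀ i < l, Function.update q l (p x) i = q i := fun i hi =>
    Function.update_of_ne hi.ne _ _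
  have hlast : Function.update q l (p x) l = p x := Function.update_self ..
  have hcases : ∀ {C : ℕ → Prop}, (∀ i < l, C i) → C l → ∀ i < l + 1, C i :=
    fun hlt heq i hi => (Nat.lt_succ_iff_lt_or_eq.1 hi).elim (hlt i) fun h => h ▸ heq
  refine ⟨Nat.succ_pos l, (hold 0 h.pos).trans h.root, ?_, ?_, ?_, ?_, ?_⟩
  · refine hcases (fun i hi => hcases (fun j hj => ?_) ?_) (hcases (fun j hj => ?_) fun _ => rfl)
    · rw [hold i hi, hold j hj]
      exact h.inj i hi j hj
    · rw [hold i hi, hlast]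
      exact fun heq => absurd heq (hnew i hi)
    · rw [hold j hj, hlast]
      exact fun heq => absurd heq.symm (hnew j hj)
  · refine hcases (fun i hi => ?_) (hlast.symm ▸ hpx)
    rw [hold i hi]
    exact h.mem i hi
  · refine hcases (fun i hi hpos => ?_) fun _ => ?_
    · rw [hold i hi, Function.update_of_ne (hnew i hi)]
      exact h.via_mem i hi hpos
    · rwa [hlast, Function.update_self]
  · refine hcases (fun i hi hpos => ?_) fun _ => ?_
    · rw [hold i hi, Function.update_of_ne (hnew i hi)]
      exact h.pred_via i hi hpos
    · rw [hlast, Function.update_self]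
  · refine hcases (fun i hi hpos => ?_) fun _ => ⟨j, hj, ?_⟩
    · obtain ⟨k, hk, hpar⟩ := h.parent i hi hpos
      refine ⟨k, hk, ?_⟩
      rwa [hold i hi, hold k (hk.trans hi), Function.update_of_ne (hnew i hi),
        Function.update_of_ne (hnew i hi)]
    · rw [hlast, hold j hj, Function.update_self, Function.update_self]
      exact ⟨rfl, hjx⟩

end SearchTree

/-- The vertices in the queue. -/
def reached (s : Store) : Finset ℕ := (range (s.var .tail)).image (s.arr .queue)

theorem mem_reached {s : Store} {x : ℕ} :
    x ∈ reached s ↔ ∃ i < s.var .tail, s.arr .queue i = x := by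
  simp [reached]

@[simp] theorem reached_set {s : Store} {X : Var} {a : ℕ} (hX : Var.tail ≠ X) :
    reached (s.set X a) = reached s := by
  simp [reached, hX]

/-- The search for an augmenting path from `u` to `v` inside `F` is under way. The variable `exit`
holds a reached vertex that is adjacent to `v`, plus one, if such a vertex has been found. -/
structure Searching (P : Inst) (F : Finset ℕ) (u v : ℕ) (s : Store) : Prop extends
    Loaded P F s where
  mem : v ∈ F
  target : s.var .v = v
  pred_mem : ∀ x ∈ F.erase v, s.arr .pred x ∈ F.erase v
  tree : SearchTree P.G (F.erase v) u (s.arr .pred) (s.arr .queue) (s.var .tail) (s.arr .parent)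
    (s.arr .via)
  visited : ∀ x < P.n, s.arr .visited x = if x ∈ reached s then 1 else 0
  exit : s.var .exit ≠ 0 → s.var .exit - 1 ∈ reached s ∧ P.G.Adj (s.var .exit - 1) v

/-- The search has advanced from `s` to `s'`. -/
structure Advance (s s' : Store) : Prop where
  tail : s.var .tail ≤ s'.var .tail
  queue : ∀ i < s.var .tail, s'.arr .queue i = s.arr .queue i
  exit : s.var .exit ≠ 0 → s'.var .exit ≠ 0
  pred : s'.arr .pred = s.arr .pred

namespace Advance

variable {s s' s'' : Store}

theorem trans (h : Advance s s') (h' : Advance s' s'') : Advance s s'' :=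
  ⟨h.tail.trans h'.tail, fun i hi => (h'.queue i (hi.trans_le h.tail)).trans (h.queue i hi),
    fun he => h'.exit (h.exit he), h'.pred.trans h.pred⟩

theorem reached (h : Advance s s') : reached s ⊆ reached s' := by
  intro x hx
  obtain ⟨i, hi, rfl⟩ := mem_reached.1 hx
  exact mem_reached.2 ⟨i, hi.trans_le h.tail, h.queue i hi⟩

theorem image_queue {i : ℕ} (h : Advance s s') (hi : i ≤ s.var .tail) :
    (range i).image (s'.arr .queue) = (range i).image (s.arr .queue) :=
  image_congr fun _ hj => h.queue _ ((mem_range.1 hj).trans_le hi)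

theorem of_eq (hv : ∀ X ∈ [Var.tail, .exit], s'.var X = s.var X)
    (ha : ∀ A ∈ [Arr.queue, .pred], s'.arr A = s.arr A) : Advance s s' where
  tail := (hv .tail (by decide)).ge
  queue _ _ := by rw [ha .queue (by decide)]
  exit he := by rwa [hv .exit (by decide)]
  pred := ha .pred (by decide)

end Advance

namespace Searching

variable {P : Inst} {F : Finset ℕ} {u v : ℕ} {s s' : Store}

theorem congr (h : Searching P F u v s)
    (hv : ∀ X ∈ [Var.n, .arcs, .weight, .threshold, .cut, .v, .tail, .exit], s'.var X = s.var X)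
    (ha : ∀ A ∈ [Arr.src, .tgt, .next, .first, .inS, .pred, .queue, .visited, .parent, .via],
      s'.arr A = s.arr A) : Searching P F u v s' := by
  have hreached : reached s' = reached s := by
    rw [reached, hv .tail (by decide), ha .queue (by decide), reached]
  refine ⟨h.toLoaded.congr (fun X hX => hv X ?_) fun A hA => ha A ?_, h.mem,
    (hv .v (by decide)).trans h.target, ?_, ?_, ?_, ?_⟩
  · fin_cases hX <;> decide
  · fin_cases hA <;> decide
  · rw [ha .pred (by decide)]
    exact h.pred_mem
  · rw [ha .pred (by decide), ha .queue (by decide), ha .parent (by decide), ha .via (by decide),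
      hv .tail (by decide)]
    exact h.tree
  · rw [ha .visited (by decide), hreached]
    exact h.visited
  · rw [hv .exit (by decide), hreached]
    exact h.exit

theorem lt_of_mem_erase (h : Searching P F u v s) {x : ℕ} (hx : x ∈ F.erase v) : x < P.n :=
  h.lt (mem_of_mem_erase hx)

theorem reached_subset (h : Searching P F u v s) : reached s ⊆ F.erase v := by
  intro x hx
  obtain ⟨i, hi, rfl⟩ := mem_reached.1 hx
  exact h.tree.mem i hi

theorem tail_le (h : Searching P F u v s) : s.var .tail ≤ P.n := by
  have hcard : #(reached s) = s.var .tail := by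
    rw [reached, card_image_of_injOn, card_range]
    intro i hi j hj
    exact h.tree.inj i (by simpa using hi) j (by simpa using hj)
  rw [← hcard, ← card_range P.n]
  exact card_le_card fun x hx => mem_range.2 (h.lt_of_mem_erase (h.reached_subset hx))

theorem push (h : Searching P F u v s) {x y : ℕ} (hx : x ∈ F.erase v) (hy : y ∈ reached s)
    (hyx : y = x ∨ P.G.Adj y x) (hnew : s.arr .pred x ∉ reached s) :
    Searching P F u v (((((s.put .visited (s.arr .pred x) 1).put .parent (s.arr .pred x) y).put
      .via (s.arr .pred x) x).put .queue (s.var .tail) (s.arr .pred x)).set .tail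
        (s.var .tail + 1)) := by
  obtain ⟨j, hj, rfl⟩ := mem_reached.1 hy
  set s' := ((((s.put .visited (s.arr .pred x) 1).put .parent (s.arr .pred x) _).put
    .via (s.arr .pred x) x).put .queue (s.var .tail) (s.arr .pred x)).set .tail
        (s.var .tail + 1) with hs'
  have hreached : reached s' = insert (s.arr .pred x) (reached s) := by
    rw [reached, hs', Store.set_var, if_pos rfl, range_add_one, image_insert, reached]
    congr 1
    · simp
    · refine image_congr fun i hi => ?_
      have hi : i < s.var .tail := by simpa using hi
      simp [hi.ne]
  have htree := h.tree.push hx (h.pred_mem x hx)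
    (fun i hi heq => hnew (mem_reached.2 ⟨i, hi, heq⟩)) hj hyx
  refine ⟨h.toLoaded.congr (by simp [hs']) (by simp [hs']), h.mem,
    by simp [hs', h.target], by simpa [hs'] using h.pred_mem,
    by simpa [hs'] using htree, fun z hz => ?_, fun he => ?_⟩
  · rw [hreached]
    simp only [hs', Store.set_arr, Store.put_arr]
    by_cases hzx : z = s.arr .pred x <;> simp [hzx, h.visited z hz]
  · rw [hreached]
    obtain ⟨hmem, hadj⟩ := h.exit (by simpa [hs'] using he)
    exact ⟨mem_insert_of_mem (by simpa [hs'] using hmem), by simpa [hs'] using hadj⟩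

end Searching

/-- Visit the predecessor of `x`, coming from `y`. -/
def visit : Cmd :=
  .z ::= get .pred Var.x ;;
  .ite (get .visited Var.z) 1
    (.put .visited Var.z 1 ;; .put .parent Var.z Var.y ;; .put .via Var.z Var.x ;;
      .put .queue Var.tail Var.z ;; .tail ::= Var.tail + 1)
    .skip

/-- Handle the neighbour `x` of `y`. -/
def visitNeighbour : Cmd :=
  .ite 0 (get .inS Var.x) (.ite 0 (.dist .x .v) visit (.exit ::= Var.y + 1)) .skip

/-- Handle the neighbour of `y` that `ptr` points to, and advance `ptr`. -/
def visitNext : Cmd :=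
  .c ::= Var.ptr - 1 ;; .x ::= get .tgt Var.c ;; visitNeighbour ;; .ptr ::= get .next Var.c

/-- Handle the neighbours of `y`. -/
def visitNeighbours : Cmd := .ptr ::= get .first Var.y ;; .loop 0 Var.ptr visitNext

/-- Set the array `A` to zero. -/
def clear (A : Arr) : Cmd := .for .x .n (.put A Var.x 0)

/-- Start a search from `u`. -/
def startSearch : Cmd :=
  clear .visited ;; .put .visited Var.u 1 ;; .put .queue 0 Var.u ;; .head ::= 0 ;; .tail ::= 1 ;;
    .exit ::= 0

/-- Handle the next vertex in the queue. -/
def searchStep : Cmd :=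
  .y ::= get .queue Var.head ;; .head ::= Var.head + 1 ;; .x ::= Var.y ;; visit ;; visitNeighbours

/-- Search from `u` for a vertex adjacent to `v` along alternating paths. -/
def search : Cmd := startSearch ;; .loop Var.head Var.tail searchStep

section

variable {P : Inst} {F : Finset ℕ} {u v : ℕ} {s s' : Store}

theorem runs_visit (h : Searching P F u v s) (hx : s.var .x ∈ F.erase v)
    (hy : s.var .y ∈ reached s)
    (hyx : s.var .y = s.var .x ∨ P.G.Adj (s.var .y) (s.var .x)) :
    Runs P.M P.B visit s fun T s' => T ≤ 7 ∧ Searching P F u v s' ∧ Advance s s' ∧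
      s.arr .pred (s.var .x) ∈ reached s' := by
  have hB := P.le_B
  have hxn := h.lt_of_mem_erase hx
  have hzn := h.lt_of_mem_erase (h.pred_mem _ hx)
  have htail := h.tail_le
  have h₀ : Searching P F u v (s.set .z (s.arr .pred (s.var .x))) :=
    h.congr (by simp) (by simp)
  simp only [visit, runs_seq, runs_ite, Expr.Ok, Expr.eval, true_and, Order.lt_one_iff, runs_set,
    ArithOp.eval, Order.add_one_le_iff, runs_put, Store.put_var, Nat.reduceAdd, and_self_left,
    Nat.reduceLeDiff, runs_skip, Store.set_var, ↓reduceIte, Store.set_arr, h.visited _ hzn,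
    ite_eq_right_iff, one_ne_zero, imp_false, reduceCtorEq, Std.le_refl, Decidable.not_not,
    Nat.one_le_ofNat, ne_eq, not_false_eq_true, reached_set]
  refine ⟨by omega, ⟨by omega, by omega⟩, fun hnew => ?_, fun hmem => ?_⟩
  · refine ⟨⟨by omega, by omega⟩, by omega, by omega, ⟨by omega, by omega⟩, ?_, ?_, ?_⟩
    · exact h₀.push hx hy hyx hnew
    · refine ⟨by simp, fun i hi => ?_, by simp, by simp⟩
      simp [hi.ne]
    · exact mem_reached.2 ⟨s.var .tail, by simp, by simp⟩
  · exact ⟨h₀, .of_eq (by simp) (by simp), hmem⟩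

/-- The neighbour `x` of a processed vertex has been taken care of. -/
def Handled (v : ℕ) (s : Store) (x : ℕ) : Prop :=
  (x = v → s.var .exit ≠ 0) ∧ (x ≠ v → s.arr .pred x ∈ reached s)

theorem Handled.advance {x : ℕ} (h : Handled v s x) (hA : Advance s s') : Handled v s' x :=
  ⟨fun heq => hA.exit (h.1 heq), fun hne => hA.pred ▸ hA.reached (h.2 hne)⟩

theorem runs_visitNeighbour (h : Searching P F u v s) (hx : s.var .x < P.n)
    (hy : s.var .y ∈ reached s) (hyx : P.G.Adj (s.var .y) (s.var .x)) :
    Runs P.M P.B visitNeighbour s fun T s' => T ≤ 9 ∧ Searching P F u v s' ∧ Advance s s' ∧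
      (s.var .x ∈ F → Handled v s' (s.var .x)) := by
  have hB := P.le_B
  have hyn := h.lt_of_mem_erase (h.reached_subset hy)
  have hvn := mem_range.1 (h.subset h.mem)
  have hdist : (Expr.dist .x .v).Ok P.M P.B s := Expr.ok_dist (by omega) (by rw [h.target]; omega)
  simp only [visitNeighbour, runs_ite, Expr.Ok, zero_le, Expr.eval, true_and, h.holds.pos_iff,
    Order.add_one_le_iff, hdist, and_self, Expr.eval_dist_pos, h.target, ne_eq, Decidable.not_not,
    runs_set, ArithOp.eval, Nat.reduceAdd, Nat.reduceLT, runs_skip, Nat.one_lt_ofNat]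
  refine ⟨by omega, fun hxF => ⟨fun hne => ?_, fun heq => ?_⟩, fun hxF => ?_⟩
  · refine (runs_visit h (mem_erase.2 ⟨hne, hxF⟩) hy (.inr hyx)).mono ?_
    rintro T s' _ ⟨hT, h', hA, hmem⟩
    exact ⟨by omega, h', hA, fun _ => ⟨fun heq => absurd heq hne, fun _ => hA.pred ▸ hmem⟩⟩
  · refine ⟨by omega, ?_, ⟨by simp, by simp, by simp, by simp⟩, fun _ =>
      ⟨fun _ => by simp, fun hne => absurd heq hne⟩⟩
    exact ⟨h.toLoaded.congr (by simp) (by simp), h.mem, h.target, h.pred_mem,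
      h.tree, h.visited, fun _ => ⟨hy, heq ▸ hyx⟩⟩
  · exact ⟨h, .of_eq (by simp) (by simp), fun hmem => absurd hmem hxF⟩

/-- The arcs of `y` with numbers `i` and above have been processed. -/
def Scanned (P : Inst) (F : Finset ℕ) (v y i : ℕ) (s : Store) : Prop :=
  ∀ c < P.M, i ≤ c → P.tail c = y → P.head c ∈ F → Handled v s (P.head c)

namespace Scanned

variable {y i c : ℕ}

theorem step (h : Scanned P F v y i s) (hc : lastArc P.tail i y = c + 1) (hA : Advance s s')
    (hhead : P.head c ∈ F → Handled v s' (P.head c)) : Scanned P F v y c s' := by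
  intro d hd hcd hdy hdF
  rcases hcd.eq_or_lt with rfl | hcd
  · exact hhead hdF
  · have hid : i ≤ d := not_lt.1 fun hdi => ne_of_lastArc_le (by omega) hdi hdy
    exact (h d hd hid hdy hdF).advance hA

theorem handled (h : Scanned P F v y i s) (hi : lastArc P.tail i y = 0) {x : ℕ} (hx : x ∈ F)
    (hyx : P.G.Adj y x) : Handled v s x := by
  obtain ⟨c, hc, hcy, rfl⟩ := P.exists_arc y x hyx
  exact h c hc (not_lt.1 fun hci => ne_of_lastArc_le (by omega) hci hcy) hcy hx

end Scanned

theorem runs_visitNext {c : ℕ} (h : Searching P F u v s) (hy : s.var .y ∈ reached s)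
    (hc : c < P.M) (hcy : P.tail c = s.var .y) (hptr : s.var .ptr = c + 1) :
    Runs P.M P.B visitNext s fun T s' => T ≤ 12 ∧ Searching P F u v s' ∧ Advance s s' ∧
      s'.var .ptr = lastArc P.tail c (s.var .y) ∧ (P.head c ∈ F → Handled v s' (P.head c)) := by
  have hB := P.le_B
  have hhead := P.head_lt c hc
  simp only [visitNext, hptr, runs_seq, runs_set, Expr.Ok, Expr.eval, true_and, Store.set_var,
    ↓reduceIte, Expr.ok_sub, add_tsub_cancel_right, Expr.eval_sub, Store.set_arr, h.lists.tgt c hc]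
  refine ⟨⟨by omega, by omega⟩, by omega, ?_⟩
  refine Runs.mono (runs_visitNeighbour (h.congr (by simp) (by simp)) (by simpa using hhead)
    (by simpa using hy) (by simpa [← hcy] using P.adj c hc)) ?_
  rintro T s' hF ⟨hT, h', hA, hhandled⟩
  have hc' := hF.var .c (by decide)
  simp only [Store.set_var, reduceCtorEq, ↓reduceIte] at hc' hhandled
  have hnext : s'.arr .next c = lastArc P.tail c (s.var .y) := by
    rw [h'.lists.next c hc, hcy]
  simp only [hc', hnext]
  exact ⟨by omega, by omega, h'.congr (by simp) (by simp),
    (Advance.of_eq (by simp) (by simp)).trans (hA.trans (.of_eq (by simp) (by simp))), trivial,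
    fun hcF => (hhandled hcF).advance (.of_eq (by simp) (by simp))⟩

theorem runs_visitNeighbours (h : Searching P F u v s) (hy : s.var .y ∈ reached s) :
    Runs P.M P.B visitNeighbours s fun T s' => T ≤ 20 * outArcs P.tail P.M (s.var .y) + 2 ∧
      Searching P F u v s' ∧ Advance s s' ∧
      ∀ x ∈ F, P.G.Adj (s.var .y) x → Handled v s' x := by
  have hB := P.le_B
  have hyn := h.lt_of_mem_erase (h.reached_subset hy)
  have hptr : s.arr .first (s.var .y) = lastArc P.tail P.M (s.var .y) := h.lists.first _
  have h₀ : Searching P F u v (s.set .ptr (s.arr .first (s.var .y))) := h.congr (by simp) (by simp)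
  rw [visitNeighbours, runs_seq, runs_set]
  refine ⟨⟨trivial, show s.var .y ≤ P.B by omega⟩, ?_⟩
  refine (Runs.loop (fun s' => Searching P F u v s' ∧ Advance s s' ∧ ∃ i ≤ P.M,
      s'.var .ptr = lastArc P.tail i (s.var .y) ∧ Scanned P F v (s.var .y) i s')
    (fun s' => 20 * outArcs P.tail (s'.var .ptr) (s.var .y))
    ⟨h₀, .of_eq (by simp) (by simp), P.M, le_rfl, by simpa using hptr,
      fun c hc hMc => absurd hc hMc.not_gt⟩ (by simp) ?_).mono ?_
  · rintro s' ⟨h', hA, i, hi, hptr', hscan⟩ hF hpos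
    obtain ⟨c, hc : s'.var .ptr = c + 1⟩ := Nat.exists_eq_add_one.2 hpos
    have hy' : s'.var .y = s.var .y := by simpa using hF.var .y (by decide)
    have hci := lastArc_le P.tail i (s.var .y)
    have hcM : c < P.M := by omega
    have hcy : P.tail c = s.var .y := eq_of_lastArc_eq_succ (hptr'.symm.trans hc)
    refine (runs_visitNext h' (hy'.symm ▸ hA.reached hy) hcM (hcy.trans hy'.symm) hc).mono ?_
    rintro T s'' - ⟨hT, h'', hA', hnext, hhandled⟩
    rw [hy'] at hnext
    refine ⟨⟨h'', hA.trans hA', c, hcM.le, hnext,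
      hscan.step (hptr'.symm.trans hc) hA' hhandled⟩, ?_⟩
    have hlt := outArcs_lastArc_lt hcy
    rw [hc, hnext]
    omega
  · rintro T s' - ⟨⟨h', hA, i, -, hptr', hscan⟩, hdone, hT⟩
    simp only [Expr.eval, not_lt, Nat.le_zero, Store.set_var, ↓reduceIte, hptr] at hdone hT
    refine ⟨?_, h', hA, fun x hx hyx => hscan.handled (hptr'.symm.trans hdone) hx hyx⟩
    have hle := outArcs_mono P.tail (lastArc_le P.tail P.M (s.var .y)) (s.var .y)
    omega

theorem runs_clear {A : Arr} (hn : s.var .n ≤ P.B) (hB : 1 ≤ P.B) :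
    Runs P.M P.B (clear A) s fun T s' =>
      T ≤ 3 * s.var .n + 2 ∧ ∀ x < s.var .n, s'.arr A x = 0 := by
  refine (Runs.for (fun j s' => ∀ x < j, s'.arr A x = 0) 1 (by simp [Cmd.vars])
    (by simp [Cmd.vars]) (by decide) hn hB (by simp) ?_).mono ?_
  · intro j s' hj hje _ hI
    simp only [Order.lt_add_one_iff, Store.set_arr, runs_put, Expr.Ok, zero_le, Expr.eval, hje,
      true_and, Std.le_refl, Store.put_arr, ↓reduceIte]
    refine ⟨by omega, fun x hx => ?_⟩
    rw [Function.update_apply]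
    split_ifs
    exacts [rfl, hI x (by omega)]
  · rintro T s' _ ⟨hzero, hT⟩
    exact ⟨hT, hzero⟩

theorem runs_startSearch (h : Query P F u v s)
    (hp : ∀ x ∈ F.erase v, s.arr .pred x ∈ F.erase v) :
    Runs P.M P.B startSearch s fun T s' => T ≤ 3 * P.n + 7 ∧ Searching P F u v s' ∧
      s'.var .head = 0 := by
  have hB := P.le_B
  have hun := h.lt h.source_mem
  have hn := h.n
  rw [startSearch, runs_seq]
  refine (runs_clear (by omega) (by omega)).mono ?_
  rintro T s₁ hF₁ ⟨hT, hclear⟩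
  have hu₁ := hF₁.var .u (by decide)
  simp only [runs_seq, runs_set, Expr.Ok, zero_le, Expr.eval, Store.set_var, reduceCtorEq,
    ↓reduceIte, true_and, Nat.reduceAdd, and_true, runs_put, and_self, hu₁, h.source,
    add_le_add_iff_right, Store.put_var]
  refine ⟨⟨by omega, by omega⟩, by omega, by omega, ?_⟩
  set s' := ((((s₁.put .visited u 1).put .queue 0 u).set .head 0).set .tail 1).set .exit 0
    with hs'
  have hreached : reached s' = {u} := by simp [reached, hs']
  refine ⟨(h.toLoaded.frame hF₁ (by decide) (by decide)).congr (by simp [hs']) (by simp [hs']),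
    h.target_mem, by simp [hs', hF₁.var .v (by decide), h.target],
    by simpa [hs', hF₁.arr .pred (by decide)] using hp, ?_, fun x hx => ?_, by simp [hs']⟩
  · exact .single (mem_erase.2 ⟨h.ne, h.source_mem⟩) (by simp [hs'])
  · rw [hreached]
    by_cases hxu : x = u <;> simp [hs', hxu, hclear x (by omega)]

/-- The vertex `y` and its neighbours have been taken care of. -/
def Processed (P : Inst) (F : Finset ℕ) (v : ℕ) (s : Store) (y : ℕ) : Prop :=
  s.arr .pred y ∈ reached s ∧ ∀ x ∈ F, P.G.Adj y x → Handled v s x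

theorem Processed.advance {y : ℕ} (h : Processed P F v s y) (hA : Advance s s') :
    Processed P F v s' y :=
  ⟨hA.pred ▸ hA.reached h.1, fun x hx hyx => (h.2 x hx hyx).advance hA⟩

theorem runs_searchStep (h : Searching P F u v s) (hhead : s.var .head < s.var .tail) :
    Runs P.M P.B searchStep s fun T s' =>
      T ≤ 20 * outArcs P.tail P.M (s.arr .queue (s.var .head)) + 20 ∧ Searching P F u v s' ∧
      Advance s s' ∧ s'.var .head = s.var .head + 1 ∧
      Processed P F v s' (s.arr .queue (s.var .head)) := by
  have hB := P.le_B
  have htail := h.tail_le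
  have hy : s.arr .queue (s.var .head) ∈ reached s := mem_reached.2 ⟨_, hhead, rfl⟩
  simp only [searchStep, runs_seq, runs_set]
  simp only [Expr.Ok, Expr.eval, true_and, ArithOp.eval, Store.set_var, reduceCtorEq, ↓reduceIte,
    Order.add_one_le_iff]
  refine ⟨by omega, ⟨by omega, by omega⟩, ?_⟩
  refine Runs.mono (runs_visit (h.congr (by simp) (by simp))
    (by simpa using h.reached_subset hy) (by simpa using hy) (by simp)) ?_
  rintro T₁ s₁ hF₁ ⟨hT₁, h₁, hA₁, hpred⟩
  have hy₁ := hF₁.var .y (by decide)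
  have hhead₁ := hF₁.var .head (by decide)
  replace hA₁ : Advance s s₁ := (Advance.of_eq (by simp) (by simp)).trans hA₁
  simp only [Store.set_var, reduceCtorEq, ↓reduceIte, Store.set_arr] at hy₁ hhead₁ hpred
  refine (runs_visitNeighbours h₁ (by rw [hy₁]; exact hA₁.reached hy)).mono ?_
  rintro T₂ s₂ hF₂ ⟨hT₂, h₂, hA₂, hH⟩
  rw [hy₁] at hT₂ hH
  exact ⟨by omega, h₂, hA₁.trans hA₂, (hF₂.var .head (by decide)).trans hhead₁,
    hA₂.pred ▸ hA₁.pred ▸ hA₂.reached hpred, hH⟩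

theorem runs_search (h : Query P F u v s)
    (hp : ∀ x ∈ F.erase v, s.arr .pred x ∈ F.erase v) :
    Runs P.M P.B search s fun T s' => T ≤ 20 * P.M + 33 * P.n + 10 ∧
      Searching P F u v s' ∧ ∀ y ∈ reached s', Processed P F v s' y := by
  rw [search, runs_seq]
  refine (runs_startSearch h hp).mono ?_
  rintro T₁ s₁ _ ⟨hT₁, h₁, hhead₁⟩
  refine (Runs.loop (fun s => Searching P F u v s ∧
      ∀ i < s.var .head, Processed P F v s (s.arr .queue i))
    (fun s => ∑ y ∈ range P.n \ (range (s.var .head)).image (s.arr .queue),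
      (20 * outArcs P.tail P.M y + 30))
    ⟨h₁, by simp [hhead₁]⟩ (by simp) ?_).mono ?_
  · rintro s ⟨h, hproc⟩ _ hlt
    simp only [Expr.eval] at hlt
    refine (runs_searchStep h hlt).mono ?_
    rintro T s' _ ⟨hT, h', hA, hhead, hy⟩
    have hqueue : ∀ i < s.var .head + 1, s'.arr .queue i = s.arr .queue i := fun i hi =>
      hA.queue i (by omega)
    have himage : (range (s'.var .head)).image (s'.arr .queue) =
        insert (s.arr .queue (s.var .head)) ((range (s.var .head)).image (s.arr .queue)) := by
      rw [hhead, hA.image_queue hlt, range_add_one, image_insert]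
    refine ⟨⟨h', fun i hi => ?_⟩, ?_⟩
    · rw [hhead] at hi
      rw [hqueue i hi]
      rcases Nat.lt_succ_iff_lt_or_eq.1 hi with hi | rfl
      exacts [(hproc i hi).advance hA, hy]
    · have hmem := mem_sdiff.2
        ⟨mem_range.2 (h.lt_of_mem_erase (h.tree.mem _ hlt)), h.tree.notMem_image hlt⟩
      have hsum := add_sum_erase _ (fun y => 20 * outArcs P.tail P.M y + 30) hmem
      rw [himage, sdiff_insert]
      omega
  · rintro T s' _ ⟨⟨h, hproc⟩, hge, hT⟩
    simp only [Expr.eval, not_lt] at hge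
    have hsum : ∑ y ∈ range P.n, (20 * outArcs P.tail P.M y + 30) = 20 * P.M + 30 * P.n := by
      rw [sum_add_distrib, ← mul_sum, sum_outArcs P.tail_lt]
      simp [mul_comm]
    simp only [hhead₁, range_zero, image_empty, sdiff_empty, hsum] at hT
    refine ⟨by omega, h, fun y hy => ?_⟩
    obtain ⟨i, hi, rfl⟩ := mem_reached.1 hy
    exact hproc i (by omega)

end

/-- The linkage `p` is being augmented: the alternating path from `u` to `v` has been followed back
to the vertex `q i`. -/
structure Augmenting (G : SimpleGraph ℕ) (E : Finset ℕ) (u v c : ℕ) (q via p : ℕ → ℕ) (i : ℕ) :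
    Prop where
  complete : i = 0 → Linkage G E E u v p (c + 1)
  partial_linkage : 0 < i → Linkage G E (E.erase (via (q i))) u v p c
  pred_via : ∀ j, 0 < j → j ≤ i → p (via (q j)) = q j

namespace SearchTree

variable {G : SimpleGraph ℕ} {E : Finset ℕ} {u v l c i : ℕ} {p₀ p q parent via : ℕ → ℕ}

theorem ne_root (h : SearchTree G E u p₀ q l parent via) (hi : i < l) (hpos : 0 < i) : q i ≠ u :=
  fun heq => hpos.ne' (h.inj i hi 0 h.pos (heq.trans h.root.symm))

theorem exists_index (h : SearchTree G E u p₀ q l parent via) :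
    ∃ index : ℕ → ℕ, ∀ i < l, index (q i) = i := by
  refine ⟨Function.invFunOn q {i | i < l}, fun i hi => ?_⟩
  have hex : ∃ j ∈ {i | i < l}, q j = q i := ⟨i, hi, rfl⟩
  exact h.inj _ (Function.invFunOn_mem hex) i hi (Function.invFunOn_eq hex)

theorem augmenting (h : SearchTree G E u p₀ q l parent via) (hL : Linkage G E E u v p₀ c)
    (hi : i < l) (hpos : 0 < i) (hv : G.Adj (q i) v) : Augmenting G E u v c q via p₀ i where
  complete hzero := absurd hzero hpos.ne'
  partial_linkage _ := by
    have hpred := h.pred_via i hi hpos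
    exact hL.release (by rw [hpred]; exact h.ne_root hi hpos) (by rwa [hpred])
  pred_via j hj hji := h.pred_via j (hji.trans_lt hi) hj

theorem augmenting_step (h : SearchTree G E u p₀ q l parent via)
    (hA : Augmenting G E u v c q via p i) (hi : i < l) (hpos : 0 < i) :
    ∃ j < i, parent (q i) = q j ∧
      Augmenting G E u v c q via (Function.update p (via (q i)) (q j)) j := by
  obtain ⟨j, hj, hpar, hedge⟩ := h.parent i hi hpos
  have hvia := h.via_mem i hi hpos
  have hL := hA.partial_linkage hpos
  have hne : ∀ k, 0 < k → k ≤ j → via (q k) ≠ via (q i) := fun k hk hkj heq => by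
    have hpk := hA.pred_via k hk (by omega)
    rw [heq, hA.pred_via i hpos le_rfl] at hpk
    have := h.inj i hi k (by omega) hpk
    omega
  refine ⟨j, hj, hpar, ?_, fun hj₀ => ?_, fun k hk hkj => ?_⟩
  · rintro rfl
    rw [h.root] at hedge ⊢
    exact hL.attach hvia (h.root ▸ h.mem 0 h.pos) hedge
  · have hpj := hA.pred_via j hj₀ hj.le
    have hshift := hL.shift hvia (h.via_mem j (hj.trans hi) hj₀) (hne j hj₀ le_rfl)
      (hpj.symm ▸ h.ne_root (hj.trans hi) hj₀) (hpj.symm ▸ hedge)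
    rwa [hpj] at hshift
  · rw [Function.update_of_ne (hne k hk hkj), hA.pred_via k hk (by omega)]

end SearchTree

/-- Reroute the path that enters at the vertex before `y`, and continue with the parent of `y`. -/
def retrace : Cmd := .x ::= get .via Var.y ;; .y ::= get .parent Var.y ;; .put .pred Var.x Var.y

/-- Augment the linkage along the alternating path found by the search. -/
def augment : Cmd := .y ::= Var.exit - 1 ;; .loop 0 (.dist .y .u) retrace

/-- Search for an augmenting path and augment along it. If there is none, clear `ok`. -/
def augmentOnce : Cmd := search ;; .ite 0 Var.exit augment (.ok ::= 0)

/-- Start with the linkage without paths. -/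
def startLinkage : Cmd := .for .x .n (.put .pred Var.x Var.x)

/-- Set `ok` to a positive number if `u` and `v` are not separated by fewer than `cut` vertices, and
to `0` otherwise. -/
def testSeparated : Cmd :=
  startLinkage ;; .ok ::= 1 ;; .for .i .cut (.ite 0 Var.ok augmentOnce .skip)

section

variable {P : Inst} {F : Finset ℕ} {u v c : ℕ} {s : Store}

theorem runs_retrace {E : Finset ℕ} {p q parent via : ℕ → ℕ} {i l : ℕ}
    (h : SearchTree P.G E u p q l parent via) (hE : E ⊆ range P.n)
    (hA : Augmenting P.G E u v c q via (s.arr .pred) i) (hi : i < l) (hpos : 0 < i)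
    (hy : s.var .y = q i) (hparent : s.arr .parent = parent) (hvia : s.arr .via = via) :
    Runs P.M P.B retrace s fun T s' => T = 3 ∧ ∃ j < i, s'.var .y = q j ∧
      Augmenting P.G E u v c q via (s'.arr .pred) j := by
  have hB := P.le_B
  obtain ⟨j, hj, hpar, hA'⟩ := h.augmenting_step hA hi hpos
  have hyn := mem_range.1 (hE (h.mem i hi))
  have hvian := mem_range.1 (hE (h.via_mem i hi hpos))
  simp only [retrace, runs_seq, runs_put, Expr.Ok, Expr.eval, true_and, Store.put_var,
    Store.put_arr, ↓reduceIte, runs_set, Store.set_var, reduceCtorEq, Nat.reduceAdd,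
    Nat.reduceEqDiff, Store.set_arr, hy, hvia, hparent, hpar, and_self_left]
  exact ⟨by omega, by omega, j, hj, rfl, hA'⟩

theorem runs_augment (h : Searching P F u v s)
    (hL : Linkage P.G (F.erase v) (F.erase v) u v (s.arr .pred) c) (hu : s.var .u = u)
    (huv : ¬ P.G.Adj u v) (hexit : s.var .exit ≠ 0) :
    Runs P.M P.B augment s fun T s' => T ≤ 4 * P.n + 2 ∧
      Linkage P.G (F.erase v) (F.erase v) u v (s'.arr .pred) (c + 1) := by
  have hB := P.le_B
  have htail := h.tail_le
  have hE : F.erase v ⊆ range P.n := fun x hx => mem_range.2 (h.lt_of_mem_erase hx)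
  have hlt : ∀ i < s.var .tail, s.arr .queue i < P.n := fun i hi =>
    h.lt_of_mem_erase (h.tree.mem i hi)
  have hun : u < P.n := h.tree.root ▸ hlt 0 h.tree.pos
  obtain ⟨index, hindex⟩ := h.tree.exists_index
  obtain ⟨hy, hyv⟩ := h.exit hexit
  obtain ⟨i₀, hi₀, hq₀⟩ := mem_reached.1 hy
  rw [← hq₀] at hyv
  have hi₀pos : 0 < i₀ := Nat.pos_of_ne_zero fun hzero => huv (h.tree.root ▸ hzero ▸ hyv)
  have hy₀ := hlt i₀ hi₀
  rw [augment, runs_seq, runs_set]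
  refine ⟨⟨trivial, show 1 ≤ P.B by omega, show s.var .exit - 1 ≤ P.B by omega⟩, ?_⟩
  refine Runs.mono (Runs.loop (fun s' => ∃ i < s.var .tail, s'.var .y = s.arr .queue i ∧
      Augmenting P.G (F.erase v) u v c (s.arr .queue) (s.arr .via) (s'.arr .pred) i)
    (fun s' => 4 * index (s'.var .y))
    ⟨i₀, hi₀, hq₀.symm, h.tree.augmenting hL hi₀ hi₀pos hyv⟩ ?_ ?_) ?_
  · rintro s' ⟨i, hi, hy', -⟩ hF
    have hu' : s'.var .u = u := (hF.var .u (by decide)).trans hu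
    have hyn := hlt i hi
    exact ⟨Nat.zero_le _, Expr.ok_dist (by omega) (by omega)⟩
  · rintro s' ⟨i, hi, hy', hA⟩ hF hpos
    have hu' : s'.var .u = u := (hF.var .u (by decide)).trans hu
    replace hpos : s.arr .queue i ≠ u := hy' ▸ hu' ▸ Expr.eval_dist_pos.1 hpos
    have hipos : 0 < i := Nat.pos_of_ne_zero fun hzero => hpos (hzero ▸ h.tree.root)
    refine (runs_retrace h.tree hE hA hi hipos hy' (hF.arr .parent (by decide))
      (hF.arr .via (by decide))).mono ?_
    rintro T s'' - ⟨rfl, j, hj, hy'', hA'⟩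
    refine ⟨⟨j, hj.trans hi, hy'', hA'⟩, ?_⟩
    rw [hy', hy'', hindex i hi, hindex j (hj.trans hi)]
    omega
  · rintro T s' hF ⟨⟨i, hi, hy', hA⟩, hle, hT⟩
    have hu' : s'.var .u = u := (hF.var .u (by decide)).trans hu
    replace hle : s.arr .queue i = u := hy' ▸ hu' ▸ not_ne_iff.1 (mt Expr.eval_dist_pos.2 hle)
    have hi₀' : index ((s.set .y (s.var .exit - 1)).var .y) = i₀ := hq₀ ▸ hindex i₀ hi₀
    have hT : T + 4 * index (s'.var .y) ≤ 4 * i₀ + 1 := hi₀' ▸ hT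
    exact ⟨by omega, hA.complete (by_contra fun hne =>
      h.tree.ne_root hi (Nat.pos_of_ne_zero hne) hle)⟩

theorem Searching.separated {d : ℕ} (h : Searching P F u v s)
    (hL : Linkage P.G (F.erase v) (F.erase v) u v (s.arr .pred) c) (hcd : c < d)
    (hproc : ∀ y ∈ reached s, Processed P F v s y) (hexit : s.var .exit = 0) :
    Separated P.G F d u v := by
  rw [← insert_erase h.mem]
  refine hL.separated hcd (notMem_erase v F) h.reached_subset
    (mem_reached.2 ⟨0, h.tree.pos, h.tree.root⟩) (fun y hy => (hproc y hy).1) ?_ ?_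
  · intro y hy x hx hyx
    exact ((hproc y hy).2 x (mem_of_mem_erase hx) hyx).2 (ne_of_mem_erase hx)
  · intro y hy hyv
    exact ((hproc y hy).2 v h.mem hyv).1 rfl hexit

theorem runs_augmentOnce {d : ℕ} (h : Query P F u v s) (hok : s.var .ok ≠ 0) (hcd : c < d)
    (hL : Linkage P.G (F.erase v) (F.erase v) u v (s.arr .pred) c) :
    Runs P.M P.B augmentOnce s fun T s' => T ≤ 20 * P.M + 37 * P.n + 13 ∧
      (s'.var .ok ≠ 0 → Linkage P.G (F.erase v) (F.erase v) u v (s'.arr .pred) (c + 1)) ∧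
      (s'.var .ok = 0 → Separated P.G F d u v) := by
  rw [augmentOnce, runs_seq]
  refine (runs_search h hL.maps).mono ?_
  rintro T s₁ hF₁ ⟨hT, h₁, hproc⟩
  rw [← hF₁.arr .pred (by decide)] at hL
  simp only [ne_eq, runs_ite, Expr.Ok, zero_le, and_self, Expr.eval, not_lt, nonpos_iff_eq_zero,
    runs_set, Nat.reduceAdd, add_le_add_iff_right, Store.set_var, ↓reduceIte, not_true_eq_false,
    Store.set_arr, IsEmpty.forall_iff, forall_const, true_and]
  refine ⟨fun hexit => ?_, fun hexit => ⟨by omega, h₁.separated hL hcd hproc hexit⟩⟩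
  refine (runs_augment h₁ hL (by rw [hF₁.var .u (by decide), h.source]) h.not_adj hexit.ne').mono ?_
  rintro T' s₂ hF₂ ⟨hT', hL'⟩
  have hok' : s₂.var .ok = s.var .ok := by rw [hF₂.var .ok (by decide), hF₁.var .ok (by decide)]
  exact ⟨by omega, fun _ => hL', fun hzero => absurd (hok'.symm.trans hzero) hok⟩

theorem runs_startLinkage (hn : s.var .n ≤ P.B) (hB : 1 ≤ P.B) :
    Runs P.M P.B startLinkage s fun T s' =>
      T ≤ 3 * s.var .n + 2 ∧ ∀ x < s.var .n, s'.arr .pred x = x := by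
  refine (Runs.for (fun j s' => ∀ x < j, s'.arr .pred x = x) 1 (by decide) (by decide) (by decide)
    hn hB (by simp) ?_).mono ?_
  · intro j s' hj hje _ hI
    simp only [Order.lt_add_one_iff, Store.set_arr, runs_put, Expr.Ok, Expr.eval, hje, true_and,
      Std.le_refl, Store.put_arr, ↓reduceIte]
    refine ⟨by omega, fun x hx => ?_⟩
    rw [Function.update_apply]
    split_ifs with hxj
    exacts [hxj.symm, hI x (by omega)]
  · rintro T s' _ ⟨hpred, hT⟩
    exact ⟨hT, hpred⟩

theorem runs_testSeparated (h : Query P F u v s) :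
    Runs P.M P.B testSeparated s fun T s' =>
      T ≤ (20 * P.M + 37 * P.n + 20) * P.κ.cut + 3 * P.n + 5 ∧
      (s'.var .ok = 0 ↔ Separated P.G F P.κ.cut u v) := by
  have hB := P.le_B
  have hn := h.n
  rw [testSeparated, runs_seq]
  refine (runs_startLinkage (by omega) (by omega)).mono ?_
  rintro T₀ s₀ hF₀ ⟨hT₀, hpred⟩
  have h₀ : Query P F u v (s₀.set .ok 1) :=
    (h.frame hF₀ (by decide) (by decide)).congr (by simp) (by simp)
  have hcut := h₀.cut
  rw [runs_seq, runs_set]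
  refine ⟨show 1 ≤ P.B by omega, ?_⟩
  refine (Runs.for (fun j s' =>
      (s'.var .ok ≠ 0 → Linkage P.G (F.erase v) (F.erase v) u v (s'.arr .pred) j) ∧
      (s'.var .ok = 0 → Separated P.G F P.κ.cut u v)) (20 * P.M + 37 * P.n + 18) (by decide)
    (by decide) (by decide) (hcut.trans_le (by omega)) (by omega) ?_ ?_).mono ?_
  · have hinit : Linkage P.G (F.erase v) (F.erase v) u v (s₀.arr .pred) 0 :=
      .of_forall_eq (mem_erase.2 ⟨h.ne, h.source_mem⟩) fun x hx => hpred x <|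
        hn ▸ mem_range.1 (h.subset (mem_of_mem_erase hx))
    exact ⟨fun _ => hinit, fun hzero => absurd hzero one_ne_zero⟩
  · rintro j s₁ hj - hF₁ ⟨hlink, hsep⟩
    have h₁ : Query P F u v s₁ := h₀.frame hF₁ (by decide) (by decide)
    simp only [Store.set_var, reduceCtorEq, ↓reduceIte, ne_eq, Store.set_arr, runs_ite, Expr.Ok,
      zero_le, and_self, Expr.eval, add_le_add_iff_right, not_lt, nonpos_iff_eq_zero, runs_skip,
      le_add_iff_nonneg_left, true_and]
    refine ⟨fun hok => ?_, fun hok => ⟨fun hne => absurd hok hne, hsep⟩⟩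
    refine (runs_augmentOnce h₁ hok.ne' (hcut ▸ hj) (hlink hok.ne')).mono ?_
    rintro T s₂ - ⟨hT, hlink', hsep'⟩
    exact ⟨by omega, hlink', hsep'⟩
  · rintro T s' - ⟨⟨hlink, hsep⟩, (hT : T ≤ (20 * P.M + 37 * P.n + 20) * _ + 2)⟩
    rw [hcut] at hlink hT
    refine ⟨by omega, hsep, fun hsep' => by_contra fun hok => ?_⟩
    have hnot := (hlink hok).not_separated
    rw [insert_erase h.target_mem] at hnot
    exact hnot hsep'

end

/-! ### Searching for a bad pair -/

/-- Mark the neighbours of `u` in the current set. -/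
def markNeighbours : Cmd :=
  clear .mark ;;
  .for .e .arcs
    (.a ::= get .src Var.e ;; .b ::= get .tgt Var.e ;;
      .ite 0 (.dist .a .u) .skip (.put .mark Var.b (get .inS Var.b)))

/-- Count the marked neighbours of each vertex. -/
def countMarked : Cmd :=
  clear .count ;;
  .for .e .arcs
    (.a ::= get .src Var.e ;; .b ::= get .tgt Var.e ;;
      .put .count Var.b (get .count Var.b + get .mark Var.a))

/-- Count the common neighbours of `u` and every other vertex in the current set. -/
def countCommon : Cmd := markNeighbours ;; countMarked

/-- Record that `u` and `v` form a bad pair. -/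
def report : Cmd := .bad ::= 1 ;; .badU ::= Var.u ;; .badV ::= Var.v

/-- Report the nonadjacent vertices `u` and `v` if they are separated. Only the first `cut` sources
`u` are tested. -/
def testCut : Cmd :=
  .ite Var.sources Var.cut (testSeparated ;; .ite Var.ok 1 report .skip) .skip

/-- Report `u` and `v` if they form a bad pair. -/
def testPair : Cmd :=
  .ite (get .count Var.v + Var.weight * get .mark Var.v) Var.threshold report
    (.ite (get .mark Var.v) 1 testCut .skip)

/-- Test all pairs that contain `u`. -/
def testPairs : Cmd :=
  .for .v .n (.ite 0 (get .inS Var.v) (.ite 0 (.dist .v .u) testPair .skip) .skip)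

/-- Handle the source `u`. -/
def testSource : Cmd :=
  countCommon ;; testPairs ;;
    .ite Var.sources Var.cut (.sources ::= Var.sources + 1) .skip

/-- Search for a bad pair in the current set. -/
def findBad : Cmd :=
  .bad ::= 0 ;; .sources ::= 0 ;; .for .u .n (.ite 0 (get .inS Var.u) testSource .skip)

section

variable {P : Inst} {F : Finset ℕ} {u v i : ℕ} {s s' : Store}

open Classical in
/-- The array `mark` is the indicator function of the neighbours of `u` in `F`. -/
def Marked (P : Inst) (F : Finset ℕ) (u : ℕ) (s : Store) : Prop :=
  ∀ x < P.n, s.arr .mark x = if x ∈ F ∧ P.G.Adj u x then 1 else 0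

theorem runs_markNeighbours (h : Loaded P F s) (hu : s.var .u = u) (hun : u < P.n) :
    Runs P.M P.B markNeighbours s fun T s' => T ≤ 6 * P.M + 3 * P.n + 4 ∧ Marked P F u s' := by
  classical
  have hB := P.le_B
  have hn := h.n
  rw [markNeighbours, runs_seq]
  refine (runs_clear (by omega) (by omega)).mono ?_
  rintro T₀ s₀ hF₀ ⟨hT₀, hzero⟩
  have h₀ := h.frame hF₀ (by decide) (by decide)
  have hu₀ : s₀.var .u = u := (hF₀.var .u (by decide)).trans hu
  have harcs := h₀.arcs
  refine (Runs.for (fun j s' => ∀ x < P.n, s'.arr .mark x =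
    if x ∈ F ∧ ∃ c < j, P.tail c = u ∧ P.head c = x then 1 else 0) 4 (by decide) (by decide)
    (by decide) (by omega) (by omega) (by simpa [← hn] using hzero) ?_).mono ?_
  · intro j s₁ hj hje hF₁ hmark
    have h₁ := h₀.frame hF₁ (by decide) (by decide)
    have hu₁ : s₁.var .u = u := (hF₁.var .u (by decide)).trans hu₀
    have hjM : j < P.M := harcs ▸ hj
    have htail := P.tail_lt j hjM
    have hhead := P.head_lt j hjM
    have hdist : (Expr.dist .a .u).Ok P.M P.B
        ((s₁.set .a (P.tail j)).set .b (P.head j)) := Expr.ok_dist (by simp; omega) (by simp; omega)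
    simp only [Nat.exists_lt_succ_right]
    simp only [Store.set_arr, runs_seq, runs_ite, Expr.Ok, zero_le, true_and, Expr.eval,
      Expr.eval_dist_pos, ne_eq, runs_skip, Nat.reduceAdd, Decidable.not_not, runs_put, and_self,
      Store.put_arr, ↓reduceIte, runs_set, Store.set_var, reduceCtorEq, Nat.reduceLeDiff, hje,
      h₁.lists.src j hjM, h₁.lists.tgt j hjM, hdist, hu₁, Std.le_refl, h₁.holds (P.head j),
      and_self_left]
    refine ⟨by omega, fun hne x hx => ?_, fun heq => ⟨by omega, fun x hx => ?_⟩⟩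
    · simp [hmark x hx, hne]
    · by_cases hxj : x = P.head j
      · simp [hxj, heq]
      · simp [hxj, hmark x hx, Ne.symm hxj]
  · rintro T s' _ ⟨hmark, hT⟩
    rw [harcs] at hmark hT
    refine ⟨by omega, fun x hx => ?_⟩
    rw [hmark x hx]
    congr 1
    refine propext (and_congr_right fun _ => ⟨?_, P.exists_arc u x⟩)
    rintro ⟨c, hc, rfl, rfl⟩
    exact P.adj c hc

open Classical in
theorem Inst.card_arcs_eq_linkCount (x : ℕ) :
    #{c ∈ range P.M | P.head c = x ∧ P.tail c ∈ F ∧ P.G.Adj u (P.tail c)} =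
      linkCount P.G 0 F u x := by
  simp only [linkCount, ite_self, add_zero]
  refine card_bij (fun c _ => P.tail c) ?_ ?_ ?_
  · intro c hc
    simp only [mem_filter, mem_range] at hc ⊢
    exact ⟨hc.2.2.1, hc.2.2.2, hc.2.1 ▸ P.adj c hc.1⟩
  · intro c hc d hd heq
    simp only [mem_filter, mem_range] at hc hd
    exact P.arc_inj c hc.1 d hd.1 heq (hc.2.1.trans hd.2.1.symm)
  · intro y hy
    obtain ⟨hyF, huy, hyx⟩ := mem_filter.1 hy
    obtain ⟨c, hc, rfl, rfl⟩ := P.exists_arc y x hyx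
    exact ⟨c, by simpa using ⟨hc, hyF, huy⟩, rfl⟩

theorem runs_countMarked (h : Ready P s) (hmark : Marked P F u s) :
    Runs P.M P.B countMarked s fun T s' => T ≤ 5 * P.M + 3 * P.n + 4 ∧
      ∀ x < P.n, s'.arr .count x = linkCount P.G 0 F u x := by
  classical
  have hB := P.le_B
  have hn := h.n
  rw [countMarked, runs_seq]
  refine (runs_clear (by omega) (by omega)).mono ?_
  rintro T₀ s₀ hF₀ ⟨hT₀, hzero⟩
  have h₀ := h.frame hF₀ (by decide) (by decide)
  have hmark₀ := hF₀.arr .mark (by decide)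
  have harcs := h₀.arcs
  refine (Runs.for (fun j s' => ∀ x < P.n, s'.arr .count x =
      #{c ∈ range j | P.head c = x ∧ P.tail c ∈ F ∧ P.G.Adj u (P.tail c)}) 3
    (by decide) (by decide) (by decide) (by omega) (by omega) (by simpa [← hn] using hzero)
    ?_).mono ?_
  · intro j s₁ hj hje hF₁ hcount
    have h₁ := h₀.frame hF₁ (by decide) (by decide)
    have hmark₁ : s₁.arr .mark = s.arr .mark := (hF₁.arr .mark (by decide)).trans hmark₀
    have hjM : j < P.M := harcs ▸ hj
    have htail := P.tail_lt j hjM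
    have hhead := P.head_lt j hjM
    have hle : #{c ∈ range j | P.head c = P.head j ∧ P.tail c ∈ F ∧ P.G.Adj u (P.tail c)} ≤ j := by
      simpa using card_filter_le (range j) _
    have hmark_le : (if P.tail j ∈ F ∧ P.G.Adj u (P.tail j) then 1 else 0) ≤ 1 := by
      split_ifs <;> omega
    simp only [Store.set_arr, runs_seq, runs_put, Expr.Ok, Expr.eval, true_and, ArithOp.eval,
      Store.put_arr, ↓reduceIte, runs_set, Store.set_var, reduceCtorEq, Nat.reduceAdd,
      Nat.reduceLeDiff, hje, h₁.lists.src j hjM, h₁.lists.tgt j hjM, hcount _ hhead, hmark₁, hmark _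
      htail, Std.le_refl, and_self_left]
    refine ⟨by omega, ⟨⟨by omega, by omega, by omega⟩, by omega⟩, fun x hx => ?_⟩
    rw [range_add_one, filter_insert, Function.update_apply]
    by_cases hxj : x = P.head j
    · simp only [hxj, true_and]
      split_ifs <;> simp
    · simp [hxj, Ne.symm hxj, hcount x hx]
  · rintro T s' _ ⟨hcount, hT⟩
    rw [harcs] at hcount hT
    exact ⟨by omega, fun x hx => (hcount x hx).trans (P.card_arcs_eq_linkCount x)⟩

/-- The neighbours of `u` in `F` have been marked, and their neighbours have been counted. -/
structure Counted (P : Inst) (F : Finset ℕ) (u : ℕ) (s : Store) : Prop extends Loaded P F s where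
  source : s.var .u = u
  source_mem : u ∈ F
  marked : Marked P F u s
  count : ∀ x < P.n, s.arr .count x = linkCount P.G 0 F u x

namespace Counted

theorem frame {c : Cmd} (h : Counted P F u s) (hF : Frame c s s')
    (hv : ∀ X ∈ [Var.n, .arcs, .weight, .threshold, .cut, .u], X ∉ c.vars)
    (ha : ∀ A ∈ [Arr.src, .tgt, .next, .first, .inS, .mark, .count], A ∉ c.arrs) :
    Counted P F u s' := by
  refine ⟨h.toLoaded.frame hF (fun X hX => hv X ?_) fun A hA => ha A ?_,
    (hF.var .u (hv _ (by decide))).trans h.source, h.source_mem, ?_, ?_⟩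
  · fin_cases hX <;> decide
  · fin_cases hA <;> decide
  · rw [Marked, hF.arr .mark (ha _ (by decide))]
    exact h.marked
  · rw [hF.arr .count (ha _ (by decide))]
    exact h.count

theorem mark_eq_zero_iff (h : Counted P F u s) (hv : v ∈ F) :
    s.arr .mark v = 0 ↔ ¬ P.G.Adj u v := by
  simp [h.marked v (h.lt hv), hv]

theorem mark_le_one (h : Counted P F u s) (hv : v ∈ F) : s.arr .mark v ≤ 1 := by
  rw [h.marked v (h.lt hv)]
  split_ifs <;> omega

theorem count_le (h : Counted P F u s) (hv : v ∈ F) : s.arr .count v ≤ P.n := by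
  classical
  simp only [h.count v (h.lt hv), linkCount, ite_self, add_zero]
  exact (card_le_card ((filter_subset ..).trans h.subset)).trans_eq (card_range _)

theorem count_add (h : Counted P F u s) (hv : v ∈ F) :
    s.arr .count v + P.κ.edgeWeight * s.arr .mark v = linkCount P.G P.κ.edgeWeight F u v := by
  by_cases hadj : P.G.Adj u v <;>
    simp [h.count v (h.lt hv), h.marked v (h.lt hv), hv, linkCount, hadj]

end Counted

theorem runs_countCommon (h : Loaded P F s) (hu : s.var .u = u) (huF : u ∈ F) :
    Runs P.M P.B countCommon s fun T s' => T ≤ 11 * P.M + 6 * P.n + 8 ∧ Counted P F u s' := by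
  rw [countCommon, runs_seq]
  refine (runs_markNeighbours h hu (h.lt huF)).mono ?_
  rintro T₁ s₁ hF₁ ⟨hT₁, hmark⟩
  have h₁ := h.frame hF₁ (by decide) (by decide)
  refine (runs_countMarked h₁.toReady hmark).mono ?_
  rintro T₂ s₂ hF₂ ⟨hT₂, hcount⟩
  refine ⟨by omega, h₁.frame hF₂ (by decide) (by decide), ?_, huF, ?_, hcount⟩
  · rw [hF₂.var .u (by decide), hF₁.var .u (by decide), hu]
  · rwa [Marked, hF₂.arr .mark (by decide)]

/-- A reported pair is a bad pair. -/
def Reported (P : Inst) (F : Finset ℕ) (s : Store) : Prop :=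
  s.var .bad ≠ 0 → s.var .badU ∈ F ∧ s.var .badV ∈ F ∧ s.var .badU ≠ s.var .badV ∧
    IsBadPair P.G P.κ F (s.var .badU) (s.var .badV)

theorem Reported.congr (h : Reported P F s)
    (hv : ∀ X ∈ [Var.bad, .badU, .badV], s'.var X = s.var X) : Reported P F s' := by
  rw [Reported, hv _ (by decide), hv .badU (by decide), hv .badV (by decide)]
  exact h

theorem runs_report (hB : 1 ≤ P.B) (hu : s.var .u ∈ F) (hv : s.var .v ∈ F)
    (hne : s.var .u ≠ s.var .v) (hbad : IsBadPair P.G P.κ F (s.var .u) (s.var .v)) :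
    Runs P.M P.B report s fun T s' => T = 3 ∧ Reported P F s' ∧ s'.var .bad ≠ 0 := by
  simp only [report, ne_eq, runs_seq, runs_set, Expr.Ok, Expr.eval, Store.set_var, reduceCtorEq,
    ↓reduceIte, true_and, Nat.reduceAdd, Nat.reduceEqDiff, hB, one_ne_zero, not_false_eq_true,
    and_true]
  exact fun _ => by simpa using ⟨hu, hv, hne, hbad⟩

/-- A bound on the running time of `testSeparated`. -/
def separationTime (P : Inst) : ℕ := (20 * P.M + 37 * P.n + 20) * P.κ.cut + 3 * P.n + 5

/-- A bound on the running time of `testSeparated`, which is skipped for the source with number `i`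
if `cut ≤ i`. -/
def sourceTime (P : Inst) (i : ℕ) : ℕ := if i < P.κ.cut then separationTime P else 0

theorem runs_testCut (h : Query P F u v s) (hr : Reported P F s) :
    Runs P.M P.B testCut s fun T s' =>
      T ≤ 5 + sourceTime P (s.var .sources) ∧ Reported P F s' ∧ (s'.var .bad = 0 →
        s.var .bad = 0 ∧ (s.var .sources < P.κ.cut → ¬ Separated P.G F P.κ.cut u v)) := by
  have hB := P.le_B
  rw [testCut]
  simp only [sourceTime, runs_ite, Expr.Ok, and_self, Expr.eval, h.cut, Order.add_one_le_iff,
    runs_seq, true_and, Order.lt_one_iff, runs_skip, Nat.reduceAdd, not_lt]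
  refine ⟨fun hlt => ?_, fun hge => ⟨by omega, hr, fun hbad => ⟨hbad, fun hlt => by omega⟩⟩⟩
  refine (runs_testSeparated h).mono ?_
  rintro T s₁ hF₁ ⟨(hT : T ≤ separationTime P), hok⟩
  have h₁ := h.frame hF₁ (by decide) (by decide)
  simp only [hlt, if_true]
  refine ⟨by omega, fun hzero => ?_, fun hone => ⟨by omega, hr.congr fun X hX => hF₁.var X ?_, ?_⟩⟩
  · refine (runs_report (F := F) (by omega) (h₁.source ▸ h₁.source_mem) (h₁.target ▸ h₁.target_mem)
      (by rw [h₁.source, h₁.target]; exact h.ne) ?_).mono ?_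
    · rw [h₁.source, h₁.target]
      exact .inr (hok.1 hzero)
    · rintro T' s₂ - ⟨rfl, hr₂, hbad⟩
      exact ⟨by omega, hr₂, fun hzero => absurd hzero hbad⟩
  · fin_cases hX <;> decide
  · rw [hF₁.var .bad (by decide)]
    exact fun hbad => ⟨hbad, fun _ => mt hok.2 hone⟩

/-- The pair of `u` and `v` has passed the tests of `testPair` for the source `u` with
number `i`. -/
def Passes (P : Inst) (F : Finset ℕ) (i u v : ℕ) : Prop :=
  P.κ.threshold ≤ linkCount P.G P.κ.edgeWeight F u v ∧
    (i < P.κ.cut → ¬ Separated P.G F P.κ.cut u v)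

theorem runs_testPair (h : Counted P F u s) (hv : s.var .v = v) (hvF : v ∈ F) (hne : u ≠ v)
    (hr : Reported P F s) :
    Runs P.M P.B testPair s fun T s' =>
      T ≤ 10 + sourceTime P (s.var .sources) ∧ Reported P F s' ∧
        (s'.var .bad = 0 → s.var .bad = 0 ∧ Passes P F (s.var .sources) u v) := by
  have hB := P.le_B
  have hvn := h.lt hvF
  have hcount := h.count_le hvF
  have hmark := h.mark_le_one hvF
  have hweight := Nat.mul_le_mul_left P.κ.edgeWeight hmark
  have hlink := h.count_add hvF
  rw [testPair]
  simp only [runs_ite]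
  simp only [Expr.Ok, Expr.eval, hv, true_and, ArithOp.eval, h.weight, hlink, and_true, h.threshold,
    Order.add_one_le_iff, not_lt, Order.lt_one_iff, h.mark_eq_zero_iff hvF, not_not, runs_skip,
    Nat.reduceAdd]
  refine ⟨by omega, fun hlt => ?_, fun hge => ⟨by omega, fun hadj => ?_, fun hadj => ?_⟩⟩
  · refine (runs_report (F := F) (by omega) (h.source ▸ h.source_mem) (hv ▸ hvF)
      (by rwa [h.source, hv]) (.inl (by rwa [h.source, hv]))).mono ?_
    rintro T s' - ⟨rfl, hr', hbad⟩
    exact ⟨by omega, hr', fun hzero => absurd hzero hbad⟩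
  · refine (runs_testCut ⟨h.toLoaded, h.source, hv, h.source_mem, hvF, hne, hadj⟩ hr).mono ?_
    rintro T s' - ⟨hT, hr', hbad⟩
    exact ⟨by omega, hr', fun hzero => ⟨(hbad hzero).1, hge, (hbad hzero).2⟩⟩
  · exact ⟨by omega, hr, fun hbad => ⟨hbad, hge, fun _ => not_separated_of_adj hvF hadj⟩⟩

theorem runs_testPairs (h : Counted P F u s) (hr : Reported P F s) :
    Runs P.M P.B testPairs s fun T s' =>
      T ≤ (14 + sourceTime P (s.var .sources)) * P.n + 2 ∧ Reported P F s' ∧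
        (s'.var .bad = 0 → s.var .bad = 0 ∧
          ∀ v ∈ F, v ≠ u → Passes P F (s.var .sources) u v) := by
  have hB := P.le_B
  have hn := h.n
  have hun := h.lt h.source_mem
  refine (Runs.for (fun j s' => Reported P F s' ∧ (s'.var .bad = 0 → s.var .bad = 0 ∧
      ∀ v ∈ F, v < j → v ≠ u → Passes P F (s.var .sources) u v))
    (12 + sourceTime P (s.var .sources)) (by decide) (by decide) (by decide) (by omega) (by omega)
    ⟨hr.congr (by simp), by simp⟩ ?_).mono ?_
  · rintro j s₁ hj hjv hF₁ ⟨hr₁, hbad₁⟩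
    have h₁ := h.frame hF₁ (by decide) (by decide)
    have hsources := hF₁.var .sources (by decide)
    have hdist : (Expr.dist .v .u).Ok P.M P.B s₁ :=
      Expr.ok_dist (by omega) (by rw [h₁.source]; omega)
    simp only [runs_ite]
    simp only [Expr.Ok, zero_le, Expr.eval, hjv, true_and, h₁.holds.pos_iff, hdist, and_self,
      Expr.eval_dist_pos, h₁.source, ne_eq, Order.add_one_le_iff, Store.set_var, reduceCtorEq,
      ↓reduceIte, Order.lt_add_one_iff, Decidable.not_not, runs_skip, Nat.reduceAdd]
    refine ⟨by omega, fun hjF => ⟨fun hne => ?_, fun heq => ?_⟩, fun hjF => ?_⟩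
    · refine (runs_testPair h₁ hjv hjF (Ne.symm hne) hr₁).mono ?_
      rintro T s₂ _ ⟨hT, hr₂, hbad₂⟩
      rw [hsources] at hT hbad₂
      refine ⟨by omega, hr₂.congr (by simp), fun hzero => ?_⟩
      obtain ⟨hzero₁, hpass⟩ := hbad₂ hzero
      refine ⟨(hbad₁ hzero₁).1, fun v hvF hvj hvu => ?_⟩
      rcases hvj.eq_or_lt with rfl | hvj
      exacts [hpass, (hbad₁ hzero₁).2 v hvF hvj hvu]
    · refine ⟨by omega, hr₁.congr (by simp), fun hzero => ⟨(hbad₁ hzero).1, ?_⟩⟩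
      intro v hvF hvj hvu
      exact (hbad₁ hzero).2 v hvF (hvj.lt_of_ne (heq ▸ hvu)) hvu
    · refine ⟨by omega, hr₁.congr (by simp), fun hzero => ⟨(hbad₁ hzero).1, ?_⟩⟩
      intro v hvF hvj hvu
      exact (hbad₁ hzero).2 v hvF (hvj.lt_of_ne fun heq => hjF (heq ▸ hvF)) hvu
  · rintro T s' _ ⟨⟨hr', hbad⟩, hT⟩
    rw [hn] at hbad hT
    rw [show 12 + sourceTime P (s.var .sources) + 2 = 14 + sourceTime P (s.var .sources) by omega]
      at hT
    exact ⟨hT, hr', fun hzero => ⟨(hbad hzero).1, fun v hvF => (hbad hzero).2 v hvF (h.lt hvF)⟩⟩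

theorem exists_subset_count_lt {c : ℕ} (hc : c ≤ #F) :
    ∃ A ⊆ F, c ≤ #A ∧ ∀ x ∈ A, Nat.count (· ∈ F) x < c := by
  have hlt (i) (hi : i < c) (hF : (Set.ofPred (· ∈ F)).Finite) : i < #hF.toFinset := by
    have hcard : hF.toFinset = F := by
      ext x
      exact hF.mem_toFinset
    rw [hcard]
    omega
  refine ⟨(range c).image (Nat.nth (· ∈ F)), ?_, ?_, ?_⟩
  · simp only [image_subset_iff, mem_range]
    exact fun i hi => Nat.nth_mem i (hlt i hi)
  · rw [card_image_of_injOn, card_range]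
    intro i hi j hj hij
    rw [← Nat.count_nth (hlt i (mem_range.1 hi)), hij, Nat.count_nth (hlt j (mem_range.1 hj))]
  · simp only [mem_image, mem_range, forall_exists_index, and_imp, forall_apply_eq_imp_iff₂]
    exact fun i hi => (Nat.count_nth (hlt i hi)).trans_lt hi

/-- The sources in `F` below `j` have been processed. -/
structure Tested (P : Inst) (F : Finset ℕ) (j : ℕ) (s : Store) : Prop where
  reported : Reported P F s
  sources : s.var .sources = min P.κ.cut (Nat.count (· ∈ F) j)
  passes : s.var .bad = 0 → ∀ u ∈ F, u < j → ∀ v ∈ F, v ≠ u →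
    Passes P F (Nat.count (· ∈ F) u) u v

theorem Tested.succ_of_notMem {j : ℕ} (h : Tested P F j s) (hj : j ∉ F) : Tested P F (j + 1) s where
  reported := h.reported
  sources := by simp [h.sources, Nat.count_succ, hj]
  passes hbad u hu huj := h.passes hbad u hu
    ((Nat.lt_succ_iff.1 huj).lt_of_ne fun heq => hj (heq ▸ hu))

theorem Tested.congr {j : ℕ} (h : Tested P F j s)
    (hv : ∀ X ∈ [Var.bad, .badU, .badV, .sources], s'.var X = s.var X) : Tested P F j s' := by
  refine ⟨h.reported.congr fun X hX => hv X ?_, ?_, ?_⟩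
  · fin_cases hX <;> decide
  · rw [hv _ (by decide), h.sources]
  · rw [hv _ (by decide)]
    exact h.passes

theorem Tested.isClub (h : Tested P F P.n s) (hF : F ⊆ range P.n) (hcut : P.κ.cut ≤ #F)
    (hbad : s.var .bad = 0) : IsClub P.G P.κ F := by
  have hpasses (u) (hu : u ∈ F) := h.passes hbad u hu (mem_range.1 (hF hu))
  obtain ⟨A, hAF, hA, hcount⟩ := exists_subset_count_lt hcut
  rintro u hu v hv huv (hlink | hsep)
  · exact absurd (hpasses u hu v hv huv.symm).1 hlink.not_ge
  · refine not_separated_of_sources hAF hA (fun a ha b hb hab => ?_) hu hv hsep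
    exact (hpasses a (hAF ha) b hb hab.ne.symm).2 (hcount a ha) hab

theorem runs_testSource {j : ℕ} (h : Loaded P F s) (hj : s.var .u = j) (hjF : j ∈ F)
    (ht : Tested P F j s) :
    Runs P.M P.B testSource s fun T s' => Tested P F (j + 1) s' ∧
      T + (P.κ.cut - s'.var .sources) * (separationTime P * P.n) ≤
        11 * P.M + 20 * P.n + 12 + (P.κ.cut - s.var .sources) * (separationTime P * P.n) := by
  have hB := P.le_B
  rw [testSource, runs_seq]
  refine (runs_countCommon h hj hjF).mono ?_
  rintro T₁ s₁ hF₁ ⟨hT₁, hcounted⟩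
  have hsources₁ := hF₁.var .sources (by decide)
  rw [runs_seq]
  refine (runs_testPairs hcounted (ht.reported.congr fun X hX => hF₁.var X ?_)).mono ?_
  · fin_cases hX <;> decide
  rintro T₂ s₂ hF₂ ⟨hT₂, hreported, hbad⟩
  have hsources₂ := hF₂.var .sources (by decide)
  have hsources := ht.sources
  rw [hF₁.var .bad (by decide), hsources₁] at hbad
  rw [hsources₁] at hT₂
  have hcut : s₂.var .cut = P.κ.cut := (hF₂.var .cut (by decide)).trans hcounted.cut
  have hpasses (hzero : s₂.var .bad = 0) : ∀ u ∈ F, u < j + 1 → ∀ v ∈ F, v ≠ u →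
      Passes P F (Nat.count (· ∈ F) u) u v := by
    intro u hu huj v hv hvu
    obtain ⟨hzero', hpass⟩ := hbad hzero
    rcases (Nat.lt_succ_iff.1 huj).lt_or_eq with huj | rfl
    · exact ht.passes hzero' u hu huj v hv hvu
    · exact ⟨(hpass v hv hvu).1, fun hlt => (hpass v hv hvu).2 (by omega)⟩
  simp only [runs_ite, Expr.Ok, and_self, Expr.eval, hsources₂, hsources₁, hcut, runs_set,
    ArithOp.eval, Order.add_one_le_iff, true_and, Nat.reduceAdd, Store.set_var, ↓reduceIte, not_lt,
    runs_skip, add_le_add_iff_right]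
  refine ⟨fun hlt => ⟨by omega, ?_, ?_⟩, fun hge => ⟨⟨hreported, ?_, hpasses⟩, ?_⟩⟩
  · refine ⟨hreported.congr (by simp), ?_, by simpa using hpasses⟩
    simp only [Store.set_var, ↓reduceIte, Nat.count_succ, hjF]
    omega
  · rw [sourceTime, if_pos hlt] at hT₂
    obtain ⟨r, hr⟩ : ∃ r, P.κ.cut - s.var .sources = r + 1 := Nat.exists_eq_add_one.2 (by omega)
    rw [hr, show P.κ.cut - (s.var .sources + 1) = r by omega]
    linarith
  · simp only [Nat.count_succ, hjF, ↓reduceIte]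
    omega
  · rw [sourceTime, if_neg (by omega)] at hT₂
    omega

/-- A bound on the running time of `findBad`. -/
def findBadTime (P : Inst) : ℕ :=
  (11 * P.M + 20 * P.n + 20) * P.n + 4 + P.κ.cut * (separationTime P * P.n)

theorem runs_findBad (h : Loaded P F s) (hcut : P.κ.cut ≤ #F) :
    Runs P.M P.B findBad s fun T s' => T ≤ findBadTime P ∧ Reported P F s' ∧
      (s'.var .bad = 0 → IsClub P.G P.κ F) := by
  have hB := P.le_B
  have hn := h.n
  rw [findBad, runs_seq, runs_set, runs_seq, runs_set]
  simp only [Expr.Ok, zero_le, Expr.eval, true_and]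
  refine (Runs.for_potential (Tested P F)
    (fun s' => (P.κ.cut - s'.var .sources) * (separationTime P * P.n)) (11 * P.M + 20 * P.n + 15)
    (by decide) (by decide) (by decide) (by simp; omega) (by omega) ?_ ?_).mono ?_
  · exact ⟨by simp [Reported], by simp, by simp⟩
  · intro j s₁ hj hju hF₁ ht
    have h₁ : Loaded P F s₁ := (h.congr (by simp) (by simp)).frame hF₁ (by decide) (by decide)
    simp only [Store.set_var, reduceCtorEq, if_false] at hj
    simp only [Store.set_var, reduceCtorEq, ↓reduceIte, runs_ite, Expr.Ok, zero_le, Expr.eval, hju,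
      true_and, h₁.holds.pos_iff, runs_skip, Nat.reduceAdd, add_le_add_iff_right,
      le_add_iff_nonneg_left]
    refine ⟨by omega, fun hjF => ?_, fun hjF => (ht.succ_of_notMem hjF).congr (by simp)⟩
    refine (runs_testSource h₁ hju hjF ht).mono ?_
    rintro T s₂ - ⟨ht₂, hT⟩
    exact ⟨by omega, ht₂.congr (by simp)⟩
  · rintro T s' - ⟨ht, hT⟩
    simp [hn] at ht hT
    refine ⟨?_, ht.reported, ht.isClub h.subset hcut⟩
    rw [findBadTime]
    linarith [Nat.zero_le ((P.κ.cut - s'.var .sources) * (separationTime P * P.n))]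

end

/-! ### The search tree -/

/-- A path from the root of the search tree, the last vertex first. A pair `(a, b)` stands for the
deletion of the vertex `a`, where `b` is the vertex that remains to be deleted instead, if any. -/
abbrev Trail := List (ℕ × Option ℕ)

/-- The set at the end of a path from the root `F`. -/
def node (F : Finset ℕ) : Trail → Finset ℕ
  | [] => F
  | (a, _) :: t => (node F t).erase a

/-- All deleted vertices and their alternatives belong to the sets that they are deleted from. -/
def IsTrail (F : Finset ℕ) : Trail → Prop
  | [] => True
  | (a, b) :: t => a ∈ node F t ∧ (∀ x ∈ b, x ∈ node F t) ∧ IsTrail F t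

/-- An unexplored vertex of the search tree contains a club. -/
def Pending (G : SimpleGraph ℕ) (κ : Criterion) (k : ℕ) (F : Finset ℕ) : Trail → Prop
  | [] => False
  | (_, b) :: t => Pending G κ k F t ∨ ∃ x ∈ b, HasClub G κ k ((node F t).erase x)

/-- The number of vertices of complete binary trees that fill a search tree of depth `l` below its
unexplored vertices. -/
def pendingCount (l : ℕ) : Trail → ℕ
  | [] => 0
  | (_, b) :: t => pendingCount l t + if b.isSome then 2 ^ (l - t.length) - 1 else 0

section Trail

variable {F : Finset ℕ}

theorem node_subset (F : Finset ℕ) : ∀ t, node F t ⊆ F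
  | [] => Subset.rfl
  | (_, _) :: t => (erase_subset _ _).trans (node_subset F t)

theorem IsTrail.card_add_length : ∀ {t : Trail}, IsTrail F t → #(node F t) + t.length = #F
  | [], _ => rfl
  | (a, _) :: t, h => by
    have hcard : #((node F t).erase a) + 1 = #(node F t) := card_erase_add_one h.1
    have ih := h.2.2.card_add_length
    rw [node, List.length_cons]
    omega

end Trail

/-- The arrays `deleted` and `alternative` contain a path. The entry `0` of `alternative` means that
there is no alternative, and `x + 1` stands for the vertex `x`. -/
def Stored (s : Store) : Trail → Prop
  | [] => s.arr .alternative 0 = 1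
  | (a, b) :: t => s.arr .deleted (t.length + 1) = a ∧
    s.arr .alternative (t.length + 1) = b.elim 0 (· + 1) ∧ Stored s t

section

variable {P : Inst} {F : Finset ℕ} {k : ℕ} {s s' : Store}

theorem Stored.congr : ∀ {t : Trail}, Stored s t →
    (∀ i ≤ t.length, s'.arr .deleted i = s.arr .deleted i) →
    (∀ i ≤ t.length, s'.arr .alternative i = s.arr .alternative i) → Stored s' t
  | [], h, _, halt => (halt 0 le_rfl).trans h
  | (_, _) :: t, ⟨ha, hb, h⟩, hdel, halt =>
    ⟨(hdel _ le_rfl).trans ha, (halt _ le_rfl).trans hb,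
      h.congr (fun i hi => hdel i (hi.trans t.length.le_succ))
        fun i hi => halt i (hi.trans t.length.le_succ)⟩

/-- The search for a club with at least `k` vertices in the set `F` is at the end of the
path `t`. -/
structure OnTrail (P : Inst) (k : ℕ) (F : Finset ℕ) (t : Trail) (s : Store) : Prop
    extends Loaded P (node F t) s where
  root_subset : F ⊆ range P.n
  isTrail : IsTrail F t
  stored : Stored s t
  length_le : t.length ≤ #F - k
  depth : s.var .depth = t.length
  budget : s.var .budget = #F - k
  answer : s.var .answer = 0
  running : s.var .running = 1

namespace OnTrail

variable {t : Trail}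

theorem budget_le (h : OnTrail P k F t s) : #F - k ≤ P.n :=
  (Nat.sub_le _ _).trans ((card_le_card h.root_subset).trans_eq (card_range _))

theorem congr (h : OnTrail P k F t s)
    (hv : ∀ X ∈ [Var.n, .arcs, .weight, .threshold, .cut, .depth, .budget, .answer, .running],
      s'.var X = s.var X)
    (ha : ∀ A ∈ [Arr.src, .tgt, .next, .first, .inS, .deleted, .alternative],
      s'.arr A = s.arr A) : OnTrail P k F t s' := by
  refine ⟨h.toLoaded.congr (fun X hX => hv X ?_) fun A hA => ha A ?_, h.root_subset, h.isTrail,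
    h.stored.congr (fun i _ => congrFun (ha _ (by decide)) i)
      fun i _ => congrFun (ha _ (by decide)) i,
    h.length_le, (hv _ (by decide)).trans h.depth, (hv _ (by decide)).trans h.budget,
    (hv _ (by decide)).trans h.answer, (hv _ (by decide)).trans h.running⟩
  · fin_cases hX <;> decide
  · fin_cases hA <;> decide

theorem frame {c : Cmd} (h : OnTrail P k F t s) (hF : Frame c s s')
    (hv : ∀ X ∈ [Var.n, .arcs, .weight, .threshold, .cut, .depth, .budget, .answer, .running],
      X ∉ c.vars)
    (ha : ∀ A ∈ [Arr.src, .tgt, .next, .first, .inS, .deleted, .alternative], A ∉ c.arrs) :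
    OnTrail P k F t s' :=
  h.congr (fun X hX => hF.var X (hv X hX)) fun A hA => hF.arr A (ha A hA)

end OnTrail

/-- Return to the predecessor in the search tree. -/
def ascend : Cmd := .put .inS (get .deleted Var.depth) 1 ;; .depth ::= Var.depth - 1

/-- Delete the vertex `a`, and remember the alternative `b`. -/
def descend : Cmd :=
  .depth ::= Var.depth + 1 ;; .put .deleted Var.depth Var.a ;; .put .alternative Var.depth Var.b ;;
  .put .inS Var.a 0

/-- Return to the last vertex of the search tree with an unexplored child. -/
def climb : Cmd := .loop (get .alternative Var.depth) 1 ascend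

/-- Go to the unexplored sibling. -/
def switch : Cmd := .a ::= get .alternative Var.depth - 1 ;; .b ::= 0 ;; ascend ;; descend

/-- Go to the last unexplored vertex of the search tree, or halt if there is none. -/
def backtrack : Cmd := climb ;; .ite Var.depth 1 (.running ::= 0) switch

/-- Delete the first vertex of the bad pair, and remember the second one. -/
def branch : Cmd := .a ::= Var.badU ;; .b ::= Var.badV + 1 ;; descend

/-- Handle a vertex of the search tree. -/
def exploreNode : Cmd :=
  findBad ;;
  .ite Var.bad 1 (.answer ::= 1 ;; .running ::= 0) (.ite Var.depth Var.budget branch backtrack)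

/-- Explore the search tree of depth `budget`. -/
def explore : Cmd :=
  .answer ::= 0 ;; .depth ::= 0 ;; .put .alternative 0 1 ;; .running ::= 1 ;;
  .loop 0 Var.running exploreNode

variable {t : Trail} {a : ℕ} {b : Option ℕ}

theorem runs_ascend (h : OnTrail P k F ((a, b) :: t) s) :
    Runs P.M P.B ascend s fun T s' => T ≤ 2 ∧ OnTrail P k F t s' := by
  have hB := P.le_B
  have hl := h.budget_le
  have hlen := h.length_le
  obtain ⟨ha, -, htrail⟩ := h.isTrail
  obtain ⟨hdel, halt, hstored⟩ := h.stored
  have haF := mem_range.1 (h.root_subset (node_subset F t ha))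
  have hdepth : s.var .depth = t.length + 1 := h.depth
  rw [List.length_cons] at hlen
  simp only [ascend, runs_seq, runs_set, Expr.ok_sub, Expr.Ok, Expr.eval, tsub_le_iff_right,
    true_and, Order.add_one_le_iff, Order.lt_two_iff, Expr.eval_sub, runs_put, hdepth, hdel,
    Store.put_var, add_le_add_iff_right, Std.le_refl, add_tsub_cancel_right]
  refine ⟨by omega, by omega, ?_⟩
  refine ⟨⟨h.toReady.congr (by simp) (by simp), (node_subset F t).trans h.root_subset, ?_⟩,
    h.root_subset, htrail, hstored.congr (by simp) (by simp), by omega, by simp,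
    by simp [h.budget], by simp [h.answer], by simp [h.running]⟩
  rw [← insert_erase ha]
  exact h.holds.insert (by simp)

theorem runs_descend (h : OnTrail P k F t s) (ha : s.var .a = a) (haF : a ∈ node F t)
    (hb : s.var .b = b.elim 0 (· + 1)) (hbF : ∀ x ∈ b, x ∈ node F t) (hlen : t.length < #F - k) :
    Runs P.M P.B descend s fun T s' => T ≤ 4 ∧ OnTrail P k F ((a, b) :: t) s' := by
  have hB := P.le_B
  have hl := h.budget_le
  have han := h.lt haF
  simp only [descend, runs_seq, runs_put, Expr.Ok, zero_le, Expr.eval, true_and, Store.put_var,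
    Nat.reduceAdd, Nat.reduceLeDiff, and_self_left, runs_set, ArithOp.eval, h.depth,
    Order.add_one_le_iff, Store.set_var, ↓reduceIte, reduceCtorEq, ha, Std.le_refl, hb]
  refine ⟨by omega, by omega, by omega, ?_⟩
  refine ⟨⟨h.toReady.congr (by simp) (by simp), (node_subset F _).trans h.root_subset,
      h.holds.erase (by simp)⟩,
    h.root_subset, ⟨haF, hbF, h.isTrail⟩, ⟨by simp, by simp, h.stored.congr ?_ ?_⟩, hlen, by simp,
    by simp [h.budget], by simp [h.answer], by simp [h.running]⟩
  · intro i hi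
    simp [show i ≠ t.length + 1 by omega]
  · intro i hi
    simp [show i ≠ t.length + 1 by omega]

theorem runs_climb (h : OnTrail P k F t s) :
    Runs P.M P.B climb s fun T s' => T ≤ 3 * P.n + 1 ∧ ∃ t', OnTrail P k F t' s' ∧
      (Pending P.G P.κ k F t' ↔ Pending P.G P.κ k F t) ∧
      pendingCount (#F - k) t' = pendingCount (#F - k) t ∧
      (t' = [] ∨ ∃ a x t'', t' = (a, some x) :: t'') := by
  have hB := P.le_B
  have hl := h.budget_le
  have hlen := h.length_le
  refine (Runs.loop_of_budget (fun N s' => ∃ t', OnTrail P k F t' s' ∧ N = 3 * t'.length ∧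
    (Pending P.G P.κ k F t' ↔ Pending P.G P.κ k F t) ∧
    pendingCount (#F - k) t' = pendingCount (#F - k) t) ⟨t, h, rfl, .rfl, rfl⟩ ?_ ?_).mono ?_
  · rintro _ s' ⟨t', h', -⟩ -
    have hlen' := h'.length_le
    simp only [Expr.Ok, Expr.eval, h'.depth, true_and]
    omega
  · rintro _ s' ⟨t', h', rfl, hpending, hcount⟩ - hlt
    have hstored := h'.stored
    rcases t' with _ | ⟨⟨a, _ | x⟩, t'⟩
    · simp [h'.depth, show s'.arr .alternative 0 = 1 from hstored] at hlt
    · refine (runs_ascend h').mono ?_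
      rintro T s'' - ⟨hT, h''⟩
      refine ⟨_, ⟨t', h'', rfl, ?_, ?_⟩, by simp; omega⟩
      · simp [← hpending, Pending]
      · simp [← hcount, pendingCount]
    · simp [h'.depth, hstored.2.1] at hlt
  · rintro T s' - ⟨_, ⟨t', h', rfl, hpending, hcount⟩, hge, hT⟩
    refine ⟨by omega, t', h', hpending, hcount, ?_⟩
    have hstored := h'.stored
    rcases t' with _ | ⟨⟨a, _ | x⟩, t'⟩
    · exact .inl rfl
    · simp [h'.depth, hstored.2.1] at hge
    · exact .inr ⟨a, x, t', rfl⟩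

theorem runs_switch {x : ℕ} (h : OnTrail P k F ((a, some x) :: t) s) :
    Runs P.M P.B switch s fun T s' => T ≤ 8 ∧ OnTrail P k F ((x, none) :: t) s' := by
  have hB := P.le_B
  have hl := h.budget_le
  have hlen := h.length_le
  have hx := h.isTrail.2.1 x rfl
  have hxF := mem_range.1 (h.root_subset (node_subset F t hx))
  have hdepth : s.var .depth = t.length + 1 := h.depth
  have halt : s.arr .alternative (t.length + 1) = x + 1 := h.stored.2.1
  rw [List.length_cons] at hlen
  simp only [switch, runs_seq, runs_set, Expr.Ok, zero_le, Expr.eval, true_and, Expr.ok_sub, hdepth,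
    Order.add_one_le_iff, halt, add_tsub_cancel_right, Expr.eval_sub]
  refine ⟨by omega, ?_⟩
  have h₀ : OnTrail P k F _ ((s.set .a x).set .b 0) := h.congr (by simp) (by simp)
  refine (runs_ascend h₀).mono ?_
  rintro T s₁ hF₁ ⟨hT, h₁⟩
  refine (runs_descend h₁ (a := x) (b := none) ?_ hx ?_ (by simp) hlen).mono ?_
  · rw [hF₁.var .a (by decide)]
    simp
  · rw [hF₁.var .b (by decide)]
    simp
  · rintro T' s₂ - ⟨hT', h₂⟩
    exact ⟨by omega, h₂⟩

theorem runs_branch {u v : ℕ} (h : OnTrail P k F t s) (hu : s.var .badU = u) (hv : s.var .badV = v)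
    (huF : u ∈ node F t) (hvF : v ∈ node F t) (hlen : t.length < #F - k) :
    Runs P.M P.B branch s fun T s' => T ≤ 6 ∧ OnTrail P k F ((u, some v) :: t) s' := by
  have hB := P.le_B
  have hun := h.lt huF
  have hvn := h.lt hvF
  simp only [branch, runs_seq, runs_set, Expr.Ok, ArithOp.eval, Expr.eval, Order.add_one_le_iff,
    true_and, hu, Store.set_var, reduceCtorEq, ↓reduceIte, hv]
  refine ⟨by omega, ?_⟩
  have h₀ : OnTrail P k F t ((s.set .a u).set .b (v + 1)) := h.congr (by simp) (by simp)
  refine (runs_descend h₀ (by simp) huF (b := some v) (by simp) (by simpa using hvF) hlen).mono ?_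
  rintro T s' - ⟨hT, h'⟩
  exact ⟨by omega, h'⟩

/-- The answer is correct. -/
def Answered (P : Inst) (k : ℕ) (F : Finset ℕ) (s : Store) : Prop :=
  (s.var .answer = 1 ∧ HasClub P.G P.κ k F) ∨ (s.var .answer = 0 ∧ ¬ HasClub P.G P.κ k F)

/-- The number of vertices of complete binary trees that fill a search tree of depth `l` below the
end of the path and below its unexplored vertices. -/
def remaining (l : ℕ) (t : Trail) : ℕ := 2 ^ (l - t.length + 1) - 1 + pendingCount l t

/-- The search continues at the end of a path, and at most `N` further vertices of the search tree
will be explored. -/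
def Exploring (P : Inst) (k : ℕ) (F : Finset ℕ) (N : ℕ) (s : Store) : Prop :=
  ∃ t, OnTrail P k F t s ∧ remaining (#F - k) t = N ∧ (HasClub P.G P.κ k F ↔
    HasClub P.G P.κ k (node F t) ∨ Pending P.G P.κ k F t)

/-- The search has been completed, or at most `N` further vertices of the search tree will be
explored. -/
def Explored (P : Inst) (k : ℕ) (F : Finset ℕ) (N : ℕ) (s : Store) : Prop :=
  (s.var .running = 0 ∧ Answered P k F s) ∨ Exploring P k F N s

theorem runs_backtrack (h : OnTrail P k F t s)
    (hiff : HasClub P.G P.κ k F ↔ Pending P.G P.κ k F t) :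
    Runs P.M P.B backtrack s fun T s' => T ≤ 3 * P.n + 10 ∧
      ((s'.var .running = 0 ∧ Answered P k F s') ∨
        ∃ t', OnTrail P k F t' s' ∧ remaining (#F - k) t' = pendingCount (#F - k) t ∧
          (HasClub P.G P.κ k F ↔ HasClub P.G P.κ k (node F t') ∨ Pending P.G P.κ k F t')) := by
  have hB := P.le_B
  rw [backtrack, runs_seq]
  refine (runs_climb h).mono ?_
  rintro T s₁ - ⟨hT, t₁, h₁, hpending, hcount, rfl | ⟨a, x, t₂, rfl⟩⟩
  · simp only [runs_ite, Expr.Ok, true_and, Expr.eval, h₁.depth, List.length_nil, Order.lt_one_iff,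
      runs_set, zero_le, Nat.reduceAdd, add_le_add_iff_right, Store.set_var, ↓reduceIte,
      forall_const, not_true_eq_false, IsEmpty.forall_iff, and_true]
    exact ⟨by omega, by omega, .inl (.inr ⟨h₁.answer, by rw [hiff, ← hpending]; exact id⟩)⟩
  · simp only [runs_ite, Expr.Ok, true_and, Expr.eval, h₁.depth, List.length_cons, Order.lt_one_iff,
      Nat.add_eq_zero_iff, List.length_eq_zero_iff, one_ne_zero, and_false, runs_set, zero_le,
      Nat.reduceAdd, add_le_add_iff_right, Store.set_var, ↓reduceIte, IsEmpty.forall_iff,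
      not_false_eq_true, forall_const]
    refine ⟨by omega, (runs_switch h₁).mono ?_⟩
    rintro T' s₂ - ⟨hT', h₂⟩
    have hlen := h₂.length_le
    rw [List.length_cons] at hlen
    refine ⟨by omega, .inr ⟨_, h₂, ?_, ?_⟩⟩
    · have hsub : #F - k - (t₂.length + 1) + 1 = #F - k - t₂.length := by omega
      simp [remaining, ← hcount, pendingCount, hsub, add_comm]
    · rw [hiff, ← hpending]
      simp [Pending, node, or_comm]

theorem remaining_cons_some_add_one {l x : ℕ} (hlen : t.length < l) :
    remaining l ((a, some x) :: t) + 1 = remaining l t := by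
  have hsub : l - (t.length + 1) + 1 = l - t.length := by omega
  have hpos := Nat.one_le_two_pow (n := l - t.length)
  simp only [remaining, List.length_cons, hsub, pendingCount, Option.isSome_some, ↓reduceIte,
    pow_succ]
  omega

/-- A bound on the running time of `exploreNode`. -/
def nodeTime (P : Inst) : ℕ := findBadTime P + 3 * P.n + 15

theorem runs_exploreNode {N : ℕ} (h : Exploring P k F N s) (hk : k ≤ #F) (hcut : P.κ.cut ≤ k) :
    Runs P.M P.B exploreNode s fun T s' => T + 1 ≤ nodeTime P ∧
      ∃ N' < N, Explored P k F N' s' := by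
  have hB := P.le_B
  obtain ⟨t, ht, rfl, hiff⟩ := h
  have hlen := ht.length_le
  have hcard := ht.isTrail.card_add_length
  have hpos : pendingCount (#F - k) t < remaining (#F - k) t := by
    have := Nat.one_lt_two_pow (n := #F - k - t.length + 1) (by omega)
    rw [remaining]
    omega
  rw [exploreNode, runs_seq, nodeTime]
  refine (runs_findBad ht.toLoaded (by omega)).mono ?_
  rintro T s₁ hF₁ ⟨hT, hreported, hclub⟩
  have h₁ : OnTrail P k F t s₁ := ht.frame hF₁ (by decide) (by decide)
  simp only [add_le_add_iff_right, runs_ite, Expr.Ok, true_and, Expr.eval, Order.lt_one_iff,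
    runs_seq, runs_set, zero_le, Nat.reduceAdd, and_self, h₁.depth, h₁.budget, not_lt,
    tsub_le_iff_right]
  refine ⟨by omega, fun hbad =>
    ⟨by omega, by omega, 0, by omega, .inl ⟨by simp, .inl ⟨by simp, ?_⟩⟩⟩, fun hbad => ?_⟩
  · exact ⟨_, node_subset F t, by omega, hclub hbad⟩
  obtain ⟨huF, hvF, huv, hpair⟩ := hreported hbad
  refine ⟨fun hlt => ?_, fun hge => ?_⟩
  · refine (runs_branch h₁ rfl rfl huF hvF hlt).mono ?_
    rintro T' s₂ - ⟨hT', h₂⟩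
    refine ⟨by omega, _, ?_, .inr ⟨_, h₂, rfl, ?_⟩⟩
    · exact Nat.lt_of_succ_le (remaining_cons_some_add_one hlt).le
    · rw [hiff, hpair.hasClub_iff huv]
      simp [Pending, node, or_comm, or_left_comm]
  · have hsmall : ∀ x ∈ node F t, ¬ HasClub P.G P.κ k ((node F t).erase x) := by
      intro x hx hclub
      have hle := hclub.le_card
      have herase := card_erase_add_one hx
      omega
    have hno : ¬ HasClub P.G P.κ k (node F t) :=
      (hpair.hasClub_iff huv).not.2 (not_or.2 ⟨hsmall _ huF, hsmall _ hvF⟩)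
    refine (runs_backtrack h₁ (hiff.trans (or_iff_right hno))).mono ?_
    rintro T' s₂ - ⟨hT', hend | ⟨t', h₂, hN, hiff₂⟩⟩
    · exact ⟨by omega, 0, by omega, .inl hend⟩
    · exact ⟨by omega, _, hN ▸ hpos, .inr ⟨t', h₂, rfl, hiff₂⟩⟩

theorem runs_explore (h : Loaded P F s) (hk : k ≤ #F) (hbudget : s.var .budget = #F - k)
    (hcut : P.κ.cut ≤ k) :
    Runs P.M P.B explore s fun T s' =>
      T ≤ nodeTime P * 2 ^ (#F - k + 1) + 5 ∧ Answered P k F s' := by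
  have hB := P.le_B
  simp only [explore, runs_seq, runs_set, Expr.Ok, Expr.eval, runs_put, zero_le, and_true, true_and,
    and_self_left]
  refine ⟨by omega, (Runs.loop_of_budget (fun N s' => ∃ N', N = nodeTime P * N' ∧
    Explored P k F N' s') ⟨2 ^ (#F - k + 1) - 1, rfl, .inr ⟨[], ?_, ?_, ?_⟩⟩ ?_ ?_).mono ?_⟩
  · exact ⟨⟨h.toReady.congr (by simp) (by simp), h.subset, h.holds.congr (by simp)⟩, h.subset,
      trivial, by simp [Stored], by simp, by simp, by simp [hbudget], by simp, by simp⟩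
  · simp [remaining, pendingCount]
  · simp [Pending, node]
  · simp
  · rintro _ s' ⟨N', rfl, ⟨hend, -⟩ | hexploring⟩ - hlt
    · simp [hend] at hlt
    · refine (runs_exploreNode hexploring hk hcut).mono ?_
      rintro T s'' - ⟨hT, N'', hN'', hexplored⟩
      refine ⟨_, ⟨N'', rfl, hexplored⟩, ?_⟩
      calc T + 1 + nodeTime P * N'' ≤ nodeTime P * (N'' + 1) := by rw [Nat.mul_succ]; omega
        _ ≤ nodeTime P * N' := Nat.mul_le_mul_left _ hN''
  · rintro T s' - ⟨_, ⟨N', rfl, ⟨-, hanswered⟩ | ⟨t, ht, -⟩⟩, hge, hT⟩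
    · have hle : nodeTime P * (2 ^ (#F - k + 1) - 1) ≤ nodeTime P * 2 ^ (#F - k + 1) :=
        Nat.mul_le_mul_left _ (Nat.sub_le _ _)
      exact ⟨by omega, hanswered⟩
    · simp [ht.running] at hge

end

/-! ### The search program -/

/-- Load the graph and the set of all vertices that are not isolated. -/
def loadSupport : Cmd := .arcs ::= 2 * Var.m ;; readEdges

/-- Explore the search tree whose root is the set of all vertices that are not isolated. -/
def searchSupport : Cmd :=
  loadSupport ;;
  .ite Var.size Var.k (.answer ::= 0) (.budget ::= Var.size - Var.k ;; explore)

/-- Find out whether there is a club with at least `k` vertices. -/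
def findClub : Cmd :=
  .ite Var.n Var.k (.answer ::= 0)
    (.ite Var.k 2 (.answer ::= 1)
      (.ite Var.threshold 1 (.answer ::= 1)
        (.ite Var.m 1 (.answer ::= 0) searchSupport)))

/-- The vertices that are not isolated. -/
def Inst.support (P : Inst) : Finset ℕ := (range P.M).image P.tail

/-- A bound on the running time of `findClub`, up to a constant factor. -/
def Inst.cost (P : Inst) (k : ℕ) : ℕ :=
  2 ^ (P.n - k) * (max P.κ.cut 1 ^ 2 * (P.n * P.M)) + 1

section

variable {P : Inst} {k : ℕ} {s s' : Store}

theorem Inst.support_subset (P : Inst) : P.support ⊆ range P.n :=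
  image_subset_iff.2 fun c hc => mem_range.2 (P.tail_lt c (mem_range.1 hc))

theorem Inst.card_support_le (P : Inst) : #P.support ≤ P.n :=
  (card_le_card P.support_subset).trans_eq (card_range _)

theorem Inst.card_support_le_arcs (P : Inst) : #P.support ≤ P.M :=
  card_image_le.trans_eq (card_range _)

theorem hasClub_support_iff (hθ : 0 < P.κ.threshold) (hk : 2 ≤ k) :
    HasClub P.G P.κ k (range P.n) ↔ HasClub P.G P.κ k P.support := by
  refine hasClub_iff_of_adj_mem hθ hk P.support_subset fun x y hxy => ?_
  obtain ⟨c, hc, hx, -⟩ := P.exists_arc x y hxy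
  exact mem_image.2 ⟨c, mem_range.2 hc, hx⟩

theorem separationTime_le (P : Inst) :
    separationTime P ≤ max P.κ.cut 1 * (20 * P.M + 40 * P.n + 25) := by
  have hcut := Nat.mul_le_mul_left (20 * P.M + 37 * P.n + 20) (le_max_left P.κ.cut 1)
  have hone := Nat.mul_le_mul_left (3 * P.n + 5) (le_max_right P.κ.cut 1)
  rw [separationTime]
  linarith

theorem nodeTime_le (hn : 1 ≤ P.n) :
    nodeTime P ≤ 130 * (max P.κ.cut 1 ^ 2 * P.n * (P.n + P.M)) := by
  set f := max P.κ.cut 1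
  have hpairs : (11 * P.M + 20 * P.n + 20) * P.n + 4 + 3 * P.n + 15 ≤
      f ^ 2 * P.n * (11 * P.M + 20 * P.n + 42) := by
    have hf : 1 ≤ f ^ 2 := Nat.one_le_pow _ _ (Nat.le_max_right _ _)
    calc _ ≤ 1 * (P.n * (11 * P.M + 20 * P.n + 42)) := by nlinarith
      _ ≤ f ^ 2 * (P.n * (11 * P.M + 20 * P.n + 42)) := Nat.mul_le_mul_right _ hf
      _ = _ := by ring
  have hseparations : P.κ.cut * (separationTime P * P.n) ≤
      f ^ 2 * P.n * (20 * P.M + 40 * P.n + 25) :=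
    calc P.κ.cut * (separationTime P * P.n)
        ≤ f * (f * (20 * P.M + 40 * P.n + 25) * P.n) := by
          gcongr
          exacts [le_max_left _ _, separationTime_le P]
      _ = _ := by ring
  calc nodeTime P ≤ f ^ 2 * P.n * (20 * P.M + 40 * P.n + 25) +
        f ^ 2 * P.n * (11 * P.M + 20 * P.n + 42) := by
        rw [nodeTime, findBadTime]
        omega
    _ = f ^ 2 * P.n * (31 * P.M + 60 * P.n + 67) := by ring
    _ ≤ f ^ 2 * P.n * (130 * (P.n + P.M)) := Nat.mul_le_mul_left _ (by omega)
    _ = _ := by ring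

-- The exponential term pays for isolated vertices: there are `n - a ≤ 2 ^ (n - a)` of them.
theorem nodeTime_mul_le (hM : 1 ≤ P.M) (hk : k ≤ #P.support) :
    nodeTime P * 2 ^ (#P.support - k + 1) ≤ 780 * P.cost k := by
  have ha := P.card_support_le
  have haM := P.card_support_le_arcs
  have hn : 1 ≤ P.n := (Nat.zero_le _).trans_lt (P.tail_lt 0 hM)
  set a := #P.support
  have hsize : P.n + P.M ≤ 3 * P.M * 2 ^ (P.n - a) :=
    calc P.n + P.M ≤ 2 * P.M * 1 + 1 * (P.n - a) := by omega
      _ ≤ 2 * P.M * 2 ^ (P.n - a) + P.M * 2 ^ (P.n - a) := by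
        gcongr
        exacts [Nat.one_le_two_pow, Nat.lt_two_pow_self.le]
      _ = _ := by ring
  have hpow : 2 ^ (P.n - a) * 2 ^ (a - k + 1) = 2 * 2 ^ (P.n - k) := by
    rw [← pow_add, ← pow_succ']
    congr 1
    omega
  calc nodeTime P * 2 ^ (a - k + 1)
      ≤ 130 * (max P.κ.cut 1 ^ 2 * P.n * (3 * P.M * 2 ^ (P.n - a))) * 2 ^ (a - k + 1) := by
        refine Nat.mul_le_mul_right _ ((nodeTime_le hn).trans ?_)
        gcongr
    _ = 390 * (max P.κ.cut 1 ^ 2 * P.n * P.M) * (2 ^ (P.n - a) * 2 ^ (a - k + 1)) := by ring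
    _ = 780 * (P.cost k - 1) := by
      rw [hpow, Inst.cost, Nat.add_sub_cancel]
      ring
    _ ≤ 780 * P.cost k := Nat.mul_le_mul_left _ (Nat.sub_le _ _)

theorem arcs_le_cost (P : Inst) (k : ℕ) : P.M ≤ P.cost k := by
  rcases P.M.eq_zero_or_pos with hM | hM
  · simp [hM]
  · have hn : 1 ≤ P.n := (Nat.zero_le _).trans_lt (P.tail_lt 0 hM)
    have hfactor : 1 ≤ 2 ^ (P.n - k) * (max P.κ.cut 1 ^ 2 * P.n) := by
      rw [Nat.one_le_iff_ne_zero]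
      positivity
    calc P.M ≤ 2 ^ (P.n - k) * (max P.κ.cut 1 ^ 2 * P.n) * P.M := Nat.le_mul_of_pos_left _ hfactor
      _ ≤ P.cost k := by
        rw [Inst.cost]
        linarith

/-- The store contains the edge list of the instance `P` and the parameters of the search for a
club with at least `k` vertices. -/
structure Given (P : Inst) (k : ℕ) (s : Store) : Prop where
  n : s.var .n = P.n
  arcs : P.M = 2 * s.var .m
  k : s.var .k = k
  weight : s.var .weight = P.κ.edgeWeight
  threshold : s.var .threshold = P.κ.threshold
  cut : s.var .cut = P.κ.cut
  size : s.var .size = 0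
  tail : P.tail = s.inp
  head : P.head = arcHead s.inp
  arr : ∀ A i, s.arr A i = 0

theorem runs_loadSupport (h : Given P k s) :
    Runs P.M P.B loadSupport s fun T s' => T ≤ 30 * P.M + 3 ∧ Loaded P P.support s' ∧
      s'.var .size = #P.support := by
  have hB := P.le_B
  have harcs := h.arcs
  simp only [loadSupport, runs_seq, runs_set, Expr.Ok, ArithOp.eval, Expr.eval, true_and]
  refine ⟨by omega, (runs_readEdges (by simpa using harcs) ?_ (by omega) (by simpa using h.arr)
    (by simpa using h.size)).mono ?_⟩
  · intro c hc
    have htail := P.tail_lt c hc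
    rw [h.tail] at htail
    exact htail.le.trans (by omega)
  · rintro T s' hF ⟨hT, hread⟩
    rw [Store.set_inp, ← h.head, ← h.tail] at hread
    have hvar : ∀ X ∉ readEdges.vars, X ≠ .arcs → s'.var X = s.var X := fun X hX hne => by
      rw [hF.var X hX, Store.set_var, if_neg hne]
    refine ⟨by omega, ⟨⟨?_, ?_, ?_, ?_, ?_, hread.lists⟩, P.support_subset, hread.holds⟩,
      hread.size⟩
    · exact (hvar _ (by decide) (by decide)).trans h.n
    · rw [hF.var _ (by decide), harcs]
      simp
    · exact (hvar _ (by decide) (by decide)).trans h.weight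
    · exact (hvar _ (by decide) (by decide)).trans h.threshold
    · exact (hvar _ (by decide) (by decide)).trans h.cut

theorem runs_searchSupport (h : Given P k s) (hθ : 0 < P.κ.threshold) (hk : 2 ≤ k)
    (hM : 1 ≤ P.M) (hcut : P.κ.cut ≤ k) :
    Runs P.M P.B searchSupport s fun T s' =>
      T ≤ 820 * P.cost k ∧ Answered P k (range P.n) s' := by
  have hB := P.le_B
  have hcost := arcs_le_cost P k
  have ha := P.card_support_le
  simp only [Answered, hasClub_support_iff hθ hk]
  rw [searchSupport, runs_seq]
  refine (runs_loadSupport h).mono ?_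
  rintro T s₁ hF ⟨hT, hloaded, hsize⟩
  have hk₁ : s₁.var .k = k := (hF.var .k (by decide)).trans h.k
  simp only [runs_ite, Expr.Ok, and_self, Expr.eval, hsize, hk₁, runs_set, zero_le, Nat.reduceAdd,
    Store.set_var, ↓reduceIte, zero_ne_one, false_and, true_and, false_or, not_lt, runs_seq,
    Expr.ok_sub, tsub_le_iff_right, Expr.eval_sub]
  refine ⟨fun hlt => ⟨by omega, fun hclub => hclub.le_card.not_gt hlt⟩,
    fun hle => ⟨by omega, ?_⟩⟩
  refine (runs_explore (hloaded.congr (by simp) (by simp)) hle (by simp) hcut).mono ?_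
  rintro T' s₂ - ⟨hT', hanswered⟩
  have hnode := nodeTime_mul_le hM hle
  exact ⟨by omega, hanswered⟩

theorem runs_findClub (h : Given P k s) (hcut : P.κ.cut ≤ k)
    (hθ : P.κ.threshold = 0 → P.κ.cut = 0) :
    Runs P.M P.B findClub s fun T s' =>
      T ≤ 830 * P.cost k ∧ Answered P k (range P.n) s' := by
  have hB := P.le_B
  have harcs := h.arcs
  have hpos : 1 ≤ P.cost k := Nat.le_add_left _ _
  simp only [findClub, runs_ite, Expr.Ok, and_self, Expr.eval, h.n, h.k, Order.add_one_le_iff,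
    runs_set, zero_le, true_and, not_lt, Order.lt_two_iff, Nat.reduceAdd, not_le, h.threshold,
    Order.lt_one_iff]
  have hyes (hclub : HasClub P.G P.κ k (range P.n)) :
      Answered P k (range P.n) (s.set .answer 1) := .inl ⟨by simp, hclub⟩
  have hno (hclub : ¬ HasClub P.G P.κ k (range P.n)) :
      Answered P k (range P.n) (s.set .answer 0) := .inr ⟨by simp, hclub⟩
  refine ⟨fun hkn => ⟨by omega, hno fun hclub => ?_⟩, fun hkn => ⟨by omega,
    fun hk => ⟨by omega, by omega, hyes (hasClub_of_le_one hk (by simpa using hkn))⟩,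
    fun hk => ⟨by omega,
      fun hzero => ⟨by omega, by omega, hyes (hasClub_of_trivial hzero (hθ hzero) (by simpa))⟩,
      fun hzero => ⟨by omega, fun hm => ⟨by omega, hno ?_⟩, fun hm => ?_⟩⟩⟩⟩
  · exact hclub.le_card.not_gt (by simpa using hkn)
  · have ha := P.card_support_le_arcs
    rw [hasClub_support_iff (Nat.pos_of_ne_zero hzero) hk]
    exact fun hclub => hclub.le_card.not_gt (by omega)
  · refine (runs_searchSupport h (Nat.pos_of_ne_zero hzero) hk (by omega) hcut).mono ?_
    rintro T s' - ⟨hT, hanswered⟩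
    exact ⟨by omega, hanswered⟩

/-- Decide whether there is a club with at least `k` vertices, and return the answer in the
variable `n`, which stands for register `0` of the machine. -/
def decideClub : Cmd := findClub ;; .n ::= Var.answer

theorem runs_decideClub (h : Given P k s) (hcut : P.κ.cut ≤ k)
    (hθ : P.κ.threshold = 0 → P.κ.cut = 0) :
    Runs P.M P.B decideClub s fun T s' => T ≤ 840 * P.cost k ∧
      (HasClub P.G P.κ k (range P.n) → s'.var .n = 1) ∧
      (¬ HasClub P.G P.κ k (range P.n) → s'.var .n = 0) := by
  have hpos : 1 ≤ P.cost k := Nat.le_add_left _ _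
  rw [decideClub, runs_seq]
  refine (runs_findClub h hcut hθ).mono ?_
  rintro T s' - ⟨hT, ⟨hanswer, hclub⟩ | ⟨hanswer, hclub⟩⟩
  · simp only [hclub, forall_const, not_true_eq_false, IsEmpty.forall_iff, and_true, runs_set,
      Expr.Ok, Order.add_one_le_iff, Expr.eval, hanswer, Store.set_var, ↓reduceIte, true_and]
    omega
  · simp only [hclub, IsEmpty.forall_iff, not_false_eq_true, forall_const, true_and, runs_set,
      Expr.Ok, Order.add_one_le_iff, Expr.eval, hanswer, Store.set_var, ↓reduceIte, and_true]
    omega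

end

/-! ### The instance described by an edge list -/

section EdgeList

variable {n : ℕ} {G : SimpleGraph (Fin n)} {E : List (Fin n × Fin n)} {c i : ℕ}

namespace IsEdgeList

theorem ncard_edgeSet (h : IsEdgeList G E) : G.edgeSet.ncard = E.length := by
  have hset : G.edgeSet = ((E.map fun e => s(e.1, e.2)).toFinset : Set (Sym2 (Fin n))) := by
    ext e
    rw [← h.2 e, mem_coe, List.mem_toFinset]
  rw [hset, Set.ncard_coe_finset, List.toFinset_card_of_nodup h.1, List.length_map]

theorem adj (h : IsEdgeList G E) (hi : i < E.length) : G.Adj E[i].1 E[i].2 := by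
  rw [← SimpleGraph.mem_edgeSet, ← h.2]
  exact List.mem_map.2 ⟨E[i], List.getElem_mem hi, rfl⟩

theorem eq_of_sym2_eq {j : ℕ} (h : IsEdgeList G E) (hi : i < E.length) (hj : j < E.length)
    (hij : s(E[i].1, E[i].2) = s(E[j].1, E[j].2)) : i = j := by
  refine (h.1.getElem_inj_iff (hi := by simpa using hi) (hj := by simpa using hj)).1 ?_
  simpa using hij

theorem exists_getElem {x y : Fin n} (h : IsEdgeList G E) (hxy : G.Adj x y) :
    ∃ (i : ℕ) (hi : i < E.length), E[i] = (x, y) ∨ E[i] = (y, x) := by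
  obtain ⟨e, he, hes⟩ := List.mem_map.1 ((h.2 s(x, y)).2 hxy)
  obtain ⟨i, hi, rfl⟩ := List.mem_iff_getElem.1 he
  rw [Sym2.eq_iff] at hes
  exact ⟨i, hi, hes.imp (fun h => Prod.ext h.1 h.2) fun h => Prod.ext h.1 h.2⟩

end IsEdgeList

/-- The memory of the input: the endpoints of the edges one after the other. The tail of the
arc `c` is entry `c`, and its head is the other endpoint of the same edge. -/
def endpoints (E : List (Fin n × Fin n)) (c : ℕ) : ℕ :=
  (E.flatMap fun e => [e.1.val, e.2.val]).getD c 0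

theorem endpoints_cons_add_two (e : Fin n × Fin n) (E : List (Fin n × Fin n)) (c : ℕ) :
    endpoints (e :: E) (c + 2) = endpoints E c := by
  simp [endpoints]

theorem endpoints_two_mul (hi : i < E.length) : endpoints E (2 * i) = E[i].1 := by
  induction E generalizing i with
  | nil => simp at hi
  | cons e E ih =>
    cases i with
    | zero => simp [endpoints]
    | succ i =>
      rw [mul_add_one, endpoints_cons_add_two]
      exact ih (Nat.lt_of_succ_lt_succ hi)

theorem endpoints_two_mul_add_one (hi : i < E.length) : endpoints E (2 * i + 1) = E[i].2 := by
  induction E generalizing i with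
  | nil => simp at hi
  | cons e E ih =>
    cases i with
    | zero => simp [endpoints]
    | succ i =>
      rw [mul_add_one, add_right_comm, endpoints_cons_add_two]
      exact ih (Nat.lt_of_succ_lt_succ hi)

theorem endpoints_of_le (hc : 2 * E.length ≤ c) : endpoints E c = 0 := by
  rw [endpoints, List.getD_eq_default]
  simpa [List.length_flatMap, mul_comm] using hc

theorem arc_cases (hc : c < 2 * E.length) : ∃ (i : ℕ) (hi : i < E.length),
    (c = 2 * i ∧ endpoints E c = E[i].1 ∧ arcHead (endpoints E) c = E[i].2) ∨
      (c = 2 * i + 1 ∧ endpoints E c = E[i].2 ∧ arcHead (endpoints E) c = E[i].1) := by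
  rcases Nat.even_or_odd' c with ⟨i, rfl | rfl⟩
  · have hi : i < E.length := by omega
    exact ⟨i, hi, .inl ⟨rfl, endpoints_two_mul hi,
      (arcHead_two_mul _ _).trans (endpoints_two_mul_add_one hi)⟩⟩
  · have hi : i < E.length := by omega
    exact ⟨i, hi, .inr ⟨rfl, endpoints_two_mul_add_one hi,
      (arcHead_two_mul_add_one _ _).trans (endpoints_two_mul hi)⟩⟩

theorem endpoints_lt (hc : c < 2 * E.length) : endpoints E c < n := by
  obtain ⟨i, hi, ⟨-, htail, -⟩ | ⟨-, htail, -⟩⟩ := arc_cases hc <;> rw [htail] <;>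
    exact Fin.isLt _

theorem arcHead_endpoints_lt (hc : c < 2 * E.length) : arcHead (endpoints E) c < n := by
  obtain ⟨i, hi, ⟨-, -, hhead⟩ | ⟨-, -, hhead⟩⟩ := arc_cases hc <;> rw [hhead] <;>
    exact Fin.isLt _

namespace IsEdgeList

theorem adj_endpoints (h : IsEdgeList G E) (hc : c < 2 * E.length) :
    (G.map Fin.valEmbedding).Adj (endpoints E c) (arcHead (endpoints E) c) := by
  rw [SimpleGraph.map_adj]
  obtain ⟨i, hi, ⟨-, htail, hhead⟩ | ⟨-, htail, hhead⟩⟩ := arc_cases hc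
  · exact ⟨_, _, h.adj hi, htail.symm, hhead.symm⟩
  · exact ⟨_, _, (h.adj hi).symm, htail.symm, hhead.symm⟩

theorem exists_arc (h : IsEdgeList G E) {x y : ℕ} (hxy : (G.map Fin.valEmbedding).Adj x y) :
    ∃ c < 2 * E.length, endpoints E c = x ∧ arcHead (endpoints E) c = y := by
  obtain ⟨x, y, hadj, rfl, rfl⟩ := (SimpleGraph.map_adj _ _ _ _).1 hxy
  obtain ⟨i, hi, he | he⟩ := h.exists_getElem hadj
  · refine ⟨2 * i, by omega, ?_, ?_⟩
    · rw [endpoints_two_mul hi, he, Fin.valEmbedding_apply]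
    · rw [arcHead_two_mul, endpoints_two_mul_add_one hi, he, Fin.valEmbedding_apply]
  · refine ⟨2 * i + 1, by omega, ?_, ?_⟩
    · rw [endpoints_two_mul_add_one hi, he, Fin.valEmbedding_apply]
    · rw [arcHead_two_mul_add_one, endpoints_two_mul hi, he, Fin.valEmbedding_apply]

theorem arc_inj (h : IsEdgeList G E) {d : ℕ} (hc : c < 2 * E.length) (hd : d < 2 * E.length)
    (htail : endpoints E c = endpoints E d)
    (hhead : arcHead (endpoints E) c = arcHead (endpoints E) d) : c = d := by
  obtain ⟨i, hi, hci⟩ := arc_cases hc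
  obtain ⟨j, hj, hdj⟩ := arc_cases hd
  have hij : i = j := by
    apply h.eq_of_sym2_eq hi hj
    rw [Sym2.eq_iff, Fin.ext_iff, Fin.ext_iff, Fin.ext_iff, Fin.ext_iff]
    omega
  subst hij
  have hne := Fin.val_ne_of_ne (h.adj hi).ne
  omega

/-- The instance given by an edge list, where the vertices are regarded as natural numbers. -/
def inst (h : IsEdgeList G E) (κ : Criterion) (B : ℕ)
    (hB : n + 2 * E.length + κ.edgeWeight + κ.cut + 2 ≤ B) : Inst where
  G := G.map Fin.valEmbedding
  n := n
  M := 2 * E.length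
  B := B
  κ := κ
  tail := endpoints E
  head := arcHead (endpoints E)
  tail_lt _ := endpoints_lt
  head_lt _ := arcHead_endpoints_lt
  adj _ := h.adj_endpoints
  exists_arc _ _ := h.exists_arc
  arc_inj _ hc _ := h.arc_inj hc
  le_B := hB

end IsEdgeList

end EdgeList

/-! ### Deciding the problems on the machine -/

/-- The store that the initial state of the machine represents. -/
def inputStore (n : ℕ) (E : List (Fin n × Fin n)) (t k : ℕ) : Store where
  var X := (inputState n E t k).reg X.idx
  arr _ _ := 0
  inp := endpoints E

theorem inputState_reg_le (n : ℕ) (E : List (Fin n × Fin n)) (t k x : ℕ) :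
    (inputState n E t k).reg x ≤ n + E.length + t + k := by
  rcases x with _ | _ | _ | _ | x <;> simp [inputState] <;> omega

theorem repr_inputStore {n : ℕ} {E : List (Fin n × Fin n)} {t k W : ℕ}
    (hW : n + E.length + t + k ≤ W) :
    Repr (2 * E.length) W (inputStore n E t k)
      ((inputState n E t k).setReg baseReg (2 * E.length)) where
  var X := by rw [State.setReg_reg, if_neg (show X.idx ≠ baseReg from X.idx_lt.ne), inputStore]
  base := by rw [State.setReg_reg, if_pos rfl]
  inp _ _ := rfl
  arr _ _ := endpoints_of_le (by omega)
  var_le X := (inputState_reg_le n E t k _).trans hW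
  arr_le _ _ := W.zero_le
  inp_le _ hi := (endpoints_lt hi).le.trans (by omega)

/-- A reduction of the problem `Q` to finding a club for the criterion `κ t` with at least
`size t k` vertices. The command `setup` computes the parameters of the search. -/
structure Reduction (Q : ∀ n : ℕ, SimpleGraph (Fin n) → ℕ → ℕ → Prop) where
  κ : ℕ → Criterion
  size : ℕ → ℕ → ℕ
  hasClub_iff : ∀ n (G : SimpleGraph (Fin n)) t k, Q n G t k ↔ HasClub G (κ t) (size t k) univ
  edgeWeight_le : ∀ t, (κ t).edgeWeight ≤ t + 1
  cut_le : ∀ t, (κ t).cut ≤ t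
  cut_le_size : ∀ t k, (κ t).cut ≤ size t k
  cut_eq_zero : ∀ t, (κ t).threshold = 0 → (κ t).cut = 0
  le_size : ∀ t k, k ≤ size t k
  setup : Cmd
  vars_subset : setup.vars ⊆ [.weight, .threshold, .cut, .k]
  arrs_eq : setup.arrs = []
  runs_setup : ∀ (M B : ℕ) (s : Store), s.var .t + 1 ≤ B → Runs M B setup s fun T s' =>
    T ≤ 10 ∧ s'.var .weight = (κ (s.var .t)).edgeWeight ∧
      s'.var .threshold = (κ (s.var .t)).threshold ∧ s'.var .cut = (κ (s.var .t)).cut ∧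
      s'.var .k = size (s.var .t) (s.var .k)

namespace Reduction

variable {Q : ∀ n : ℕ, SimpleGraph (Fin n) → ℕ → ℕ → Prop} (R : Reduction Q) {n t k : ℕ}
  {G : SimpleGraph (Fin n)} {E : List (Fin n × Fin n)}

theorem iff_hasClub_map :
    Q n G t k ↔ HasClub (G.map Fin.valEmbedding) (R.κ t) (R.size t k) (range n) := by
  have huniv : (univ : Finset (Fin n)).map Fin.valEmbedding = range n := by
    rw [Fin.map_valEmbedding_univ, Nat.Iio_eq_range]
  rw [R.hasClub_iff, ← huniv, hasClub_map_iff]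

/-- The search program for the problem. -/
def command : Cmd := R.setup ;; decideClub

/-- The RAM program for the problem. The arrays are put behind the `2 * m` cells of the input. -/
def program : Prog := .seq (.arith .add baseReg 1 1) R.command.compile

/-- A bound on the running time of `command`, up to a constant factor. -/
def cost (n m t k : ℕ) : ℕ := 2 ^ (n - k) * (max (R.κ t).cut 1 ^ 2 * (n * m)) + 1

theorem cost_inst_le (h : IsEdgeList G E) {B : ℕ}
    (hB : n + 2 * E.length + (R.κ t).edgeWeight + (R.κ t).cut + 2 ≤ B) :
    (h.inst (R.κ t) B hB).cost (R.size t k) ≤ 2 * R.cost n E.length t k := by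
  have hpow : 2 ^ (n - R.size t k) ≤ 2 ^ (n - k) :=
    Nat.pow_le_pow_right two_pos (Nat.sub_le_sub_left (R.le_size t k) n)
  calc 2 ^ (n - R.size t k) * (max (R.κ t).cut 1 ^ 2 * (n * (2 * E.length))) + 1
      ≤ 2 ^ (n - k) * (max (R.κ t).cut 1 ^ 2 * (n * (2 * E.length))) + 1 := by gcongr
    _ ≤ 2 * R.cost n E.length t k := by
      rw [cost]
      linarith

theorem runs_command (h : IsEdgeList G E) {B : ℕ} (hB : n + 2 * E.length + 2 * t + 3 ≤ B) :
    Runs (2 * E.length) B R.command (inputStore n E t k) fun T s' =>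
      T ≤ 1690 * R.cost n E.length t k ∧ (Q n G t k → s'.var .n = 1) ∧
        (¬ Q n G t k → s'.var .n = 0) := by
  have hweight := R.edgeWeight_le t
  have hcut := R.cut_le t
  have hB' : n + 2 * E.length + (R.κ t).edgeWeight + (R.κ t).cut + 2 ≤ B := by omega
  have hvar : ∀ X ∉ [Var.weight, .threshold, .cut, .k], X ∉ R.setup.vars :=
    fun X hX hmem => hX (R.vars_subset hmem)
  have ht : (inputStore n E t k).var .t + 1 ≤ B := by
    change t + 1 ≤ B
    omega
  rw [R.iff_hasClub_map, command, runs_seq]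
  refine (R.runs_setup _ B _ ht).mono ?_
  rintro T s hF ⟨hT, hw, hθ, hc, hk⟩
  have hgiven : Given (h.inst (R.κ t) B hB') (R.size t k) s :=
    { n := hF.var .n (hvar _ (by decide))
      arcs := congrArg (2 * ·) (hF.var .m (hvar _ (by decide))).symm
      k := hk
      weight := hw
      threshold := hθ
      cut := hc
      size := hF.var .size (hvar _ (by decide))
      tail := hF.inp.symm
      head := congrArg arcHead hF.inp.symm
      arr := fun A i => by
        rw [hF.arr A (by simp [R.arrs_eq])]
        rfl }
  refine (runs_decideClub hgiven (R.cut_le_size t k) (R.cut_eq_zero t)).mono ?_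
  rintro T' s' - ⟨hT', hanswer⟩
  refine ⟨?_, hanswer⟩
  have hcost := R.cost_inst_le (k := k) h hB'
  have hpos : 1 ≤ R.cost n E.length t k := Nat.le_add_left _ _
  omega

theorem exec_program (h : IsEdgeList G E) {W : ℕ}
    (hW : 34 * (n + E.length + t + k + 2) ≤ W) : ∃ τ s,
      Exec W R.program (inputState n E t k) τ s ∧
        τ ≤ (1690 * R.command.size + 1) * R.cost n E.length t k ∧
        (Q n G t k → s.reg 0 = 1) ∧ (¬ Q n G t k → s.reg 0 = 0) := by
  obtain ⟨τ, s, heval, hτ, hyes, hno⟩ := R.runs_command (t := t) (k := k) h le_rfl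
  obtain ⟨τ', r, hexec, hτ', hr⟩ := Cmd.exec_compile (by omega) heval
    (repr_inputStore (W := W) (by omega))
  have hdouble : ArithOp.add.eval ((inputState n E t k).reg 1) ((inputState n E t k).reg 1) =
      2 * E.length := (two_mul E.length).symm
  have hbase := Exec.arith (W := W) (inputState n E t k) .add baseReg 1 1 (by omega)
  rw [hdouble] at hbase
  rw [← hr.var .n] at hyes hno
  refine ⟨1 + τ', r, hbase.seq hexec, ?_, hyes, hno⟩
  have hpos : 1 ≤ R.cost n E.length t k := Nat.le_add_left _ _
  calc 1 + τ' ≤ R.cost n E.length t k + R.command.size * (1690 * R.cost n E.length t k) :=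
        Nat.add_le_add hpos (hτ'.trans (Nat.mul_le_mul_left _ hτ))
    _ = _ := by ring

theorem solvableInTime : SolvableInTime Q fun n m t k => R.cost n m t k := by
  refine ⟨R.program, 1690 * R.command.size + 1, 7, fun n G t k E hE => ?_⟩
  rw [hE.ncard_edgeSet]
  refine R.exec_program hE ?_
  have hpow : 2 ^ 6 ≤ (n + E.length + t + k + 2) ^ 6 := Nat.pow_le_pow_left (by omega) 6
  rw [pow_succ]
  exact Nat.mul_le_mul_right _ (by omega)

end Reduction

/-! ### The three problems -/

/-- The reduction of the hereditary problem. -/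
def hereditaryReduction : Reduction fun _ G t k => HereditaryTwoClubProblem G t k where
  κ := hereditary
  size _ k := k
  hasClub_iff _ _ _ _ := by
    simp only [HereditaryTwoClubProblem, HasClub, isHereditaryTwoClub_iff_isClub, subset_univ,
      true_and]
  edgeWeight_le _ := le_rfl
  cut_le := Nat.zero_le
  cut_le_size _ := Nat.zero_le
  cut_eq_zero _ _ := rfl
  le_size _ _ := le_rfl
  setup := .weight ::= Var.t + 1 ;; .threshold ::= Var.t + 1 ;; .cut ::= 0
  vars_subset := by decide
  arrs_eq := rfl
  runs_setup _ _ _ _ := by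
    simp only [hereditary, runs_seq, runs_set, Expr.Ok, zero_le, Expr.eval, Store.set_var,
      reduceCtorEq, ↓reduceIte, true_and, ArithOp.eval, Order.add_one_le_iff, Nat.reduceAdd,
      Nat.reduceLeDiff, Nat.add_right_cancel_iff, Nat.one_le_ofNat, and_self,
      and_true]
    omega

/-- The reduction of the robust problem. -/
def robustReduction : Reduction fun _ G t k => RobustTwoClubProblem G t k where
  κ := robust
  size _ k := k
  hasClub_iff _ _ _ _ := by
    simp only [RobustTwoClubProblem, HasClub, isRobustTwoClub_iff_isClub, subset_univ, true_and]
  edgeWeight_le t := t.succ_pos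
  cut_le := Nat.zero_le
  cut_le_size _ := Nat.zero_le
  cut_eq_zero _ _ := rfl
  le_size _ _ := le_rfl
  setup := .weight ::= 1 ;; .threshold ::= Var.t ;; .cut ::= 0
  vars_subset := by decide
  arrs_eq := rfl
  runs_setup _ _ _ _ := by
    simp only [robust, runs_seq, runs_set, Expr.Ok, zero_le, Expr.eval, Store.set_var, reduceCtorEq,
      ↓reduceIte, true_and, Nat.reduceAdd, Nat.reduceLeDiff, Nat.one_le_ofNat, and_self, and_true]
    omega

/-- The reduction of the connected problem. As a `t`-connected 2-club has more than `t` vertices,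
at least `max k (t + 1)` vertices are requested. -/
def connectedReduction : Reduction fun _ G t k => ConnectedTwoClubProblem G t k where
  κ := connected
  size t k := max k (t + 1)
  hasClub_iff _ _ _ _ := by
    simp only [ConnectedTwoClubProblem, HasClub, isConnectedTwoClub_iff, subset_univ, true_and,
      max_le_iff, and_assoc, Nat.succ_le_iff]
  edgeWeight_le t := t.succ_pos
  cut_le _ := le_rfl
  cut_le_size t k := t.le_succ.trans (le_max_right k (t + 1))
  cut_eq_zero _ h := absurd h one_ne_zero
  le_size k t := le_max_left t (k + 1)
  setup := .weight ::= 1 ;; .threshold ::= 1 ;; .cut ::= Var.t ;;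
    .ite Var.k (Var.t + 1) (.k ::= Var.t + 1) .skip
  vars_subset := by decide
  arrs_eq := rfl
  runs_setup _ _ _ _ := by
    simp only [connected, runs_seq, runs_ite, Expr.Ok, ArithOp.eval, Expr.eval,
      Order.add_one_le_iff, true_and, Order.lt_add_one_iff, runs_set, Nat.reduceAdd, Store.set_var,
      reduceCtorEq, ↓reduceIte, not_le, runs_skip, Nat.reduceLeDiff, Nat.one_le_ofNat, right_eq_sup,
      left_eq_sup, imp_self, and_true, and_self_left]
    omega

end WellConnectedClub

theorem mainTheorem3 :
    WellConnectedClub.SolvableInTime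
      (fun _ G t k => WellConnectedClub.HereditaryTwoClubProblem G t k)
      (fun n m _ k => 2 ^ (n - k) * (n * m) + 1) ∧
    WellConnectedClub.SolvableInTime
      (fun _ G t k => WellConnectedClub.RobustTwoClubProblem G t k)
      (fun n m _ k => 2 ^ (n - k) * (n * m) + 1) ∧
    WellConnectedClub.SolvableInTime
      (fun _ G t k => WellConnectedClub.ConnectedTwoClubProblem G t k)
      (fun n m t k => 2 ^ (n - k) * ((max t 1) ^ 2 * (n * m)) + 1) := by
  refine ⟨?_, ?_, WellConnectedClub.connectedReduction.solvableInTime⟩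
  · simpa [WellConnectedClub.Reduction.cost, WellConnectedClub.hereditaryReduction,
      WellConnectedClub.hereditary] using WellConnectedClub.hereditaryReduction.solvableInTime
  · simpa [WellConnectedClub.Reduction.cost, WellConnectedClub.robustReduction,
      WellConnectedClub.robust] using WellConnectedClub.robustReduction.solvableInTime
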